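/- A cellular pseudomanifold is a finite ranked lattice $M$ (with rank function $\rho$, smallest element $\mathbf 0$ of rank $0$, largest element $\mathbf 1$) such that for all $x<z$ in $M$: (i) if $\rho(z)=\rho(x)+2$ there are exactly two $y$ with $x<y<z$; (ii) if $\rho(z)>\rho(x)+2$, the graph whose vertices are the elements of $[x,z]$ of rank $\rho(z)-1$, two of them being adjacent when their meet has rank $\rho(z)-2$, is connected. Its elements are called faces, and $\dim M=\rho(\mathbf 1)-2$. Vertices are the elements of rank $1$ and facets are those of rank $\rho(\mathbf 1)-1$; the shadow of a face is the set of vertices $\le$ it. If $M$ has $n$ vertices, its excess is $n-\dim M-2$. For vertices $x,y$ write $x\sim y$ if $x=y$ or if the transposition $(x\,y)$, fixing all other vertices, is induced by an automorphism of the poset $M$. This is an equivalence relation, and $M$ is reducible if some $\sim$-class is not contained in the shadow of any facet. Isomorphism means isomorphism of posets. For $b\ge -1$, let $S^{b}$ be the standard $b$-sphere, i.e. the lattice of all subsets of a set of $b+2$ elements. The direct product $M\otimes N$ is the product poset with componentwise order, and the join $M*N$ is the subposet of $M\otimes N$ of all $(\alpha,\beta)$ with either $\alpha\ne\mathbf 1$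 and $\beta\neq\mathbf 1$, or $\alpha=\mathbf 1$ and $\beta=\mathbf 1$. A polytopal sphere is a poset isomorphic to the poset of all closed faces (including $\emptyset$ and the polytope itself), ordered by inclusion, of a convex polytope with non-empty interior in some $\mathbb R^n$. **Theorem.** Let $d\ge -1$ be an integer. Up to isomorphism, the reducible cellular pseudomanifolds of dimension $d$ and excess $2$ are exactly 1. $S^{b_1}*S^{b_2}*S^{b_3}$ with integers $0\le b_1\le b_2\le b_3$, $b_1+b_2+b_3=d-2$, and 2. $((S^{d_1}*S^{d_2})\otimes S^{d_3})*S^{d_4}$ with integers $0\le d_1\le d_2$, $-1\le d_3$, $0\le d_4$, $d_1+d_2+d_3+d_4=d-4$. These are mutually non-isomorphic polytopal spheres, and the number of them (the number of isomorphism classes of reducible $d$-dimensional cellular pseudomanifolds of excess $2$) is $$\left\lfloor\frac{(d^2+1)(2d-1)+9}{24}\right\rfloor .$$ -/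

import Mathlib

universe u v

namespace CPM

section Basic

variable {L : Type u} [PartialOrder L]

/-- The rank of an element of a finite poset: the largest length `r` of a chain
`x₀ < x₁ < ⋯ < xᵣ = x`. In a ranked finite lattice this is the common length of all maximal
chains joining the smallest element to `x`. -/
noncomputable def rank (x : L) : ℕ := (Order.height x).toNat

/-- The graph `Λ([x, z])`: its vertices are the elements of the interval `[x, z]` of rank
`rank z - 1`, and `σ`, `τ` are adjacent when the meet `σ ∧ τ` has rank `rank z - 2`. -/
def facetGraph (x z : L) : SimpleGraph {σ : L // x ≤ σ ∧ σ ≤ z ∧ rank σ + 1 = rank z} where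
  Adj σ τ := ∃ m : L, IsGLB {σ.1, τ.1} m ∧ rank m + 2 = rank z
  symm := ⟨by
    rintro σ τ ⟨m, hm, hr⟩
    exact ⟨m, by rwa [Set.pair_comm], hr⟩⟩
  loopless := ⟨by
    rintro σ ⟨m, hm, hr⟩
    have h1 : m = σ.1 := by
      rw [Set.pair_eq_singleton] at hm
      exact hm.unique isGLB_singleton
    have h2 := σ.2.2.2
    rw [h1] at hr
    omega⟩

end Basic

/-- `L` is a cellular pseudomanifold: a finite ranked lattice in which every interval of rank two
has exactly two interior elements and every interval `[x, z]` of larger rank has a connected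
graph `Λ([x, z])`. -/
structure IsCellularPseudomanifold (L : Type u) [PartialOrder L] [BoundedOrder L] : Prop where
  finite : Finite L
  exists_meet : ∀ a b : L, ∃ m : L, IsGLB {a, b} m
  exists_join : ∀ a b : L, ∃ j : L, IsLUB {a, b} j
  /-- Since the rank goes up by one along every covering pair, all maximal chains from the smallest
  element to `x` have length `rank x`. -/
  ranked : ∀ x y : L, x ⋖ y → rank y = rank x + 1
  diamond : ∀ x z : L, x < z → rank z = rank x + 2 → (Set.Ioo x z).ncard = 2
  connected : ∀ x z : L, x < z → rank x + 2 < rank z → (facetGraph x z).Connected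

section Invariants

variable (L : Type u) [PartialOrder L] [BoundedOrder L]

/-- The dimension of `L`; the dimension of a face `f` being `rank f - 1`, the facets have this
dimension. -/
noncomputable def dim : ℤ := (rank (⊤ : L) : ℤ) - 2

/-- The vertices: the faces of rank one (dimension zero). -/
def vertices : Set L := {v | rank v = 1}

/-- The facets: the faces of dimension `dim L`. -/
def facets : Set L := {σ | rank σ + 1 = rank (⊤ : L)}

/-- The excess `n - d - 2`, with `n` the number of vertices and `d` the dimension. -/
noncomputable def excess : ℤ := ((vertices L).ncard : ℤ) - dim L - 2

variable {L}

/-- The relation `∼` on vertices: `x = y`, or the transposition of `x` and `y`, fixing all the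
other vertices, is (the restriction to the vertices of) an automorphism of `L`. -/
def VertexEquiv (x y : L) : Prop :=
  x = y ∨ ∃ φ : L ≃o L, φ x = y ∧ φ y = x ∧ ∀ w ∈ vertices L, w ≠ x → w ≠ y → φ w = w

/-- The `∼`-class of a vertex. -/
def vertexClass (x : L) : Set L := {y | y ∈ vertices L ∧ VertexEquiv x y}

/-- The shadow of a face: the set of vertices below it. -/
def shadow (f : L) : Set L := {v | v ∈ vertices L ∧ v ≤ f}

variable (L)

/-- `L` is reducible: some `∼`-class is not contained in the shadow of any facet. -/
def IsReducible : Prop :=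
  ∃ x ∈ vertices L, ∀ σ ∈ facets L, ¬ vertexClass x ⊆ shadow σ

end Invariants

/-- The standard sphere of dimension `b` (with `b ≥ -1`): all subsets of a set with `b + 2`
elements, ordered by inclusion. -/
abbrev StdSphere (b : ℤ) : Type := Finset (Fin (b + 2).toNat)

/-- The direct product: all pairs of faces, with the componentwise order. -/
abbrev DirectProduct (M : Type u) (N : Type v) : Type (max u v) := M × N

/-- The join: the pairs `(α, β)` in the direct product such that either both `α` and `β` are
different from the largest face or both are equal to it. -/
abbrev Join (M : Type u) (N : Type v) [PartialOrder M] [BoundedOrder M]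
    [PartialOrder N] [BoundedOrder N] : Type (max u v) :=
  {p : DirectProduct M N // (p.1 < ⊤ ∧ p.2 < ⊤) ∨ (p.1 = ⊤ ∧ p.2 = ⊤)}

section JoinBounded

variable (M : Type u) (N : Type v) [PartialOrder M] [BoundedOrder M]
  [PartialOrder N] [BoundedOrder N]

/-- The largest element is `(1, 1)`; the smallest element is `(0, 0)`, unless one of the factors
has only one element, where only `(1, 1)` may remain. -/
noncomputable instance Join.instBoundedOrder : BoundedOrder (Join M N) where
  top := ⟨(⊤, ⊤), Or.inr ⟨rfl, rfl⟩⟩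
  le_top p := ⟨le_top, le_top⟩
  bot := by
    classical
    exact if h : (⊥ : M) < ⊤ ∧ (⊥ : N) < ⊤ then ⟨(⊥, ⊥), Or.inl h⟩ else
      ⟨(⊤, ⊤), Or.inr ⟨rfl, rfl⟩⟩
  bot_le := by
    intro p
    by_cases h : (⊥ : M) < ⊤ ∧ (⊥ : N) < ⊤
    · simp only [h, and_self, dite_true]
      exact ⟨bot_le, bot_le⟩
    · simp only [h, dite_false]
      rcases p.2 with hp | hp
      · exact absurd ⟨lt_of_le_of_lt bot_le hp.1, lt_of_le_of_lt bot_le hp.2⟩ h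
      · exact ⟨hp.1.ge, hp.2.ge⟩

end JoinBounded

/-- The joins `S^{b₁} * S^{b₂} * S^{b₃}` of three standard spheres. -/
abbrev TripleJoin (b₁ b₂ b₃ : ℤ) : Type :=
  Join (Join (StdSphere b₁) (StdSphere b₂)) (StdSphere b₃)

/-- The posets `((S^{d₁} * S^{d₂}) ⊗ S^{d₃}) * S^{d₄}`. -/
abbrev MixedJoin (d₁ d₂ d₃ d₄ : ℤ) : Type :=
  Join (DirectProduct (Join (StdSphere d₁) (StdSphere d₂)) (StdSphere d₃)) (StdSphere d₄)

/-- The parameters of the first family in dimension `d`. -/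
def TripleParams (d b₁ b₂ b₃ : ℤ) : Prop :=
  0 ≤ b₁ ∧ b₁ ≤ b₂ ∧ b₂ ≤ b₃ ∧ b₁ + b₂ + b₃ = d - 2

/-- The parameters of the second family in dimension `d`. -/
def MixedParams (d d₁ d₂ d₃ d₄ : ℤ) : Prop :=
  0 ≤ d₁ ∧ d₁ ≤ d₂ ∧ -1 ≤ d₃ ∧ 0 ≤ d₄ ∧ d₁ + d₂ + d₃ + d₄ = d - 4

/-- The boundary complex of a polytope `X`: its closed faces (the empty face, `X` itself, and
the intersections of `X` with its supporting hyperplanes), ordered by inclusion. -/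
abbrev BoundaryComplex {n : ℕ} (X : Set (EuclideanSpace ℝ (Fin n))) : Type :=
  {F : Set (EuclideanSpace ℝ (Fin n)) // IsExposed ℝ X F}

/-- `L` is polytopal (a polytopal sphere): it is isomorphic to the boundary complex of a convex
polytope, i.e. of the convex hull with non-empty interior of a finite set of points. -/
def IsPolytopal (L : Type u) [PartialOrder L] : Prop :=
  ∃ (n : ℕ) (S : Set (EuclideanSpace ℝ (Fin n))), S.Finite ∧
    (interior (convexHull ℝ S)).Nonempty ∧
    Nonempty (L ≃o BoundaryComplex (convexHull ℝ S))

/-- A bundled cellular pseudomanifold, used to speak of isomorphism classes. -/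
structure CellularPseudomanifold : Type (u + 1) where
  Face : Type u
  [po : PartialOrder Face]
  [bo : BoundedOrder Face]
  isCellular : IsCellularPseudomanifold Face

attribute [instance] CellularPseudomanifold.po CellularPseudomanifold.bo

/-- Two cellular pseudomanifolds are equivalent when they are isomorphic as posets. -/
instance CellularPseudomanifold.isoSetoid : Setoid CellularPseudomanifold.{u} where
  r M N := Nonempty (M.Face ≃o N.Face)
  iseqv :=
    { refl := fun M => ⟨OrderIso.refl M.Face⟩
      symm := fun ⟨e⟩ => ⟨e.symm⟩
      trans := fun ⟨e⟩ ⟨f⟩ => ⟨e.trans f⟩ }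

/-- The set of isomorphism classes of the reducible cellular pseudomanifolds of dimension `d` and
excess two. -/
def reducibleClasses (d : ℤ) : Set (Quotient CellularPseudomanifold.isoSetoid.{u}) :=
  (fun M => Quotient.mk _ M) ''
    {M : CellularPseudomanifold.{u} | IsReducible M.Face ∧ dim M.Face = d ∧ excess M.Face = 2}

end CPM

namespace CPM

/-! ### Rank functions of finite graded posets -/

section Rank

variable {L : Type u} [PartialOrder L]

/-! The excess is the number of vertices minus `rank ⊤`. The diamond condition makes a face
determined by its shadow (`shadow_subset_iff`) and makes every face the meet of the facets above it
(`le_of_forall_facet`). A pseudomanifold is therefore a family of vertex sets, and the isomorphisms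
are obtained by showing that two such families coincide (`nonempty_orderIso_of_range`). The other
use of the diamond condition is that a face of corank two never lies in three facets
(`not_three_facets`).

Reducible case: let `A` be a class not contained in any facet. The transpositions of elements of `A`
give an exchange property for facets. Three facets over a common corank-two face are impossible, so
a facet containing some element of `A` misses exactly one; connectedness of the facet graph shows
that every facet contains one. The missed element can then be moved at will without changing the
facet outside `A`. Hence the whole lattice is the join of the interval above `p`, the face with
vertices `A \ {x}`, with the Boolean lattice on `A` (`nonempty_iso_join_of_exchange`). Vertex
numbers add under joins, while ranks add up to one less, so the interval has excess one.

Excess one (`nonempty_iso_of_excess_one`): if some facet misses only one vertex, the lattice is a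
pyramid over that facet, which again has excess one. Otherwise every facet is a simplex missing two
vertices. These missed pairs form a graph in which an edge and a further vertex always span exactly
two edges; such a graph is complete bipartite, and the lattice is the join of two Boolean lattices.
Together this gives `((S * S) ⊗ S) * S`, where an empty third factor yields the triple joins
(`exists_iso_of_reducible`).

Non-isomorphism: call two vertices related when some facet misses both. After identifying twins,
this relation becomes a triangle for a triple join and a triangle with a pendant edge for a mixed
join. The sizes of the twin classes recover the parameters (`exists_label_equiv`).

Polytopality: the lattice is described by the zero sets of nonnegative functions in a linear space
of functions on the vertices, playing the role of the affine functions on a polytope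
(`IsAffineModel`). Direct products and joins act on such spaces, and every such description is
realized by a polytope (`IsAffineModel.isPolytopal`).

The number of parameters is found from recursions that peel off a vanishing or minimal parameter,
then compared with the floor modulo 6. -/

theorem rank_eq_of_grading [OrderBot L] [Finite L] (r : L → ℕ) (h0 : r ⊥ = 0)
    (h : ∀ x y, x ⋖ y → r y = r x + 1) (x : L) : rank x = r x := by
  -- Strict monotonicity of `r` is carried through the induction because it supplies the upper bound
  -- for the height; a coatom of the lower set supplies the lower bound.
  have key : ∀ x : L, Order.height x = r x ∧ ∀ y < x, r y < r x := by
    intro x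
    induction x using (wellFounded_lt (α := L)).induction with
    | _ x ih =>
      have hlt : ∀ y < x, r y < r x := by
        intro y hy
        obtain ⟨c, hc, hcx⟩ := exists_le_covBy_of_lt hy
        have h1 := h c x hcx
        rcases hc.eq_or_lt with rfl | hc'
        · omega
        · have := (ih c hcx.lt).2 y hc'
          omega
      refine ⟨le_antisymm ?_ ?_, hlt⟩
      · rw [Order.height_eq_iSup_lt_height]
        refine iSup₂_le fun y hy => ?_
        rw [(ih y hy).1]
        exact_mod_cast hlt y hy
      · rcases eq_or_ne x ⊥ with rfl | hx
        · simp [h0]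
        · obtain ⟨c, -, hcx⟩ := exists_le_covBy_of_lt (bot_lt_iff_ne_bot.2 hx)
          have := Order.height_add_one_le hcx.lt
          rw [(ih c hcx.lt).1] at this
          rw [h c x hcx]
          exact_mod_cast this
  unfold rank
  rw [(key x).1]
  rfl

theorem rank_orderIso {L' : Type v} [PartialOrder L'] (e : L ≃o L') (x : L) :
    rank (e x) = rank x := by
  unfold rank
  rw [Order.height_orderIso]

end Rank

/-- A finite poset with binary meets and a largest element has infima of all sets. -/
theorem exists_inf_of_exists_isGLB {L : Type u} [PartialOrder L] [OrderTop L] [Finite L]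
    (h : ∀ a b : L, ∃ m, IsGLB {a, b} m) (P : L → Prop) :
    ∃ m : L, ∀ a, a ≤ m ↔ ∀ σ, P σ → a ≤ σ := by
  have key : ∀ s : Set L, s.Finite → ∃ m : L, ∀ a, a ≤ m ↔ ∀ σ ∈ s, a ≤ σ := by
    intro s hs
    induction s, hs using Set.Finite.induction_on with
    | empty => exact ⟨⊤, by simp⟩
    | @insert b s _ _ ih =>
      obtain ⟨m, hm⟩ := ih
      obtain ⟨m', hm'⟩ := h b m
      refine ⟨m', fun a => ?_⟩
      rw [le_isGLB_iff hm']
      simp [lowerBounds, hm]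
  exact key {σ | P σ} (Set.toFinite _)

/-! ### Shadows, facets and the diamond condition -/

namespace IsCellularPseudomanifold

variable {M : Type u} [PartialOrder M] [BoundedOrder M] (h : IsCellularPseudomanifold M)
include h

theorem exists_inf (P : M → Prop) : ∃ m : M, ∀ a, a ≤ m ↔ ∀ σ, P σ → a ≤ σ :=
  have := h.finite
  exists_inf_of_exists_isGLB h.exists_meet P

theorem exists_inf₂ (a b : M) : ∃ m : M, ∀ x, x ≤ m ↔ x ≤ a ∧ x ≤ b := by
  obtain ⟨m, hm⟩ := h.exists_meet a b
  refine ⟨m, fun x => ?_⟩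
  rw [le_isGLB_iff hm]
  simp [lowerBounds]

theorem rank_bot : rank (⊥ : M) = 0 := by simp [rank]

theorem rank_strictMono : StrictMono (rank : M → ℕ) := by
  have := h.finite
  intro x y hxy
  induction y using (wellFounded_lt (α := M)).induction with
  | _ y ih =>
    obtain ⟨c, hc, hcy⟩ := exists_le_covBy_of_lt hxy
    have h1 := h.ranked c y hcy
    rcases hc.eq_or_lt with rfl | hc'
    · omega
    · have := ih c hcy.lt hc'
      omega

theorem rank_mono : Monotone (rank : M → ℕ) := h.rank_strictMono.monotone

theorem eq_of_le_of_rank_le {x y : M} (hxy : x ≤ y) (hr : rank y ≤ rank x) : x = y := by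
  by_contra hne
  have := h.rank_strictMono (lt_of_le_of_ne hxy hne)
  omega

theorem covBy_iff {x y : M} : x ⋖ y ↔ x ≤ y ∧ rank y = rank x + 1 := by
  refine ⟨fun hc => ⟨hc.le, h.ranked x y hc⟩, fun ⟨hxy, hr⟩ => ⟨?_, fun z hxz hzy => ?_⟩⟩
  · refine lt_of_le_of_ne hxy ?_
    rintro rfl
    omega
  · have h1 := h.rank_strictMono hxz
    have h2 := h.rank_strictMono hzy
    omega

theorem mem_vertices {v : M} : v ∈ vertices M ↔ IsAtom v := by
  rw [← bot_covBy_iff, h.covBy_iff, h.rank_bot]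
  simp [vertices]

theorem mem_facets {σ : M} : σ ∈ facets M ↔ IsCoatom σ := by
  rw [← covBy_top_iff, h.covBy_iff]
  simp [facets, eq_comm]

theorem exists_lt_of_rank {x z : M} (hxz : x < z) (k : ℕ) (h1 : rank x ≤ k) (h2 : k ≤ rank z) :
    ∃ y, x ≤ y ∧ y ≤ z ∧ rank y = k := by
  have := h.finite
  induction z using (wellFounded_lt (α := M)).induction with
  | _ z ih =>
    rcases h2.eq_or_lt with rfl | h2
    · exact ⟨z, hxz.le, le_rfl, rfl⟩
    obtain ⟨c, hc, hcz⟩ := exists_le_covBy_of_lt hxz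
    have hr := h.ranked c z hcz
    rcases hc.eq_or_lt with rfl | hc'
    · exact ⟨x, le_rfl, hxz.le, by omega⟩
    · obtain ⟨y, hy1, hy2, hy3⟩ := ih c hcz.lt hc' (by omega)
      exact ⟨y, hy1, hy2.trans hcz.le, hy3⟩

theorem exists_pair {x z : M} (hxz : x < z) (hr : rank z = rank x + 2) :
    ∃ a b, a ≠ b ∧ ∀ y, (x < y ∧ y < z) ↔ y = a ∨ y = b := by
  obtain ⟨a, b, hab, hs⟩ := Set.ncard_eq_two.1 (h.diamond x z hxz hr)
  refine ⟨a, b, hab, fun y => ?_⟩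
  have : y ∈ Set.Ioo x z ↔ y ∈ ({a, b} : Set M) := by rw [hs]
  simpa using this

/-- A face of rank at least two is determined by the faces that it covers. -/
theorem le_of_forall_covBy_le {x y : M} (hx : 2 ≤ rank x) (hy : ∀ c, c ⋖ x → c ≤ y) : x ≤ y := by
  have hb : (⊥ : M) < x := by
    rw [bot_lt_iff_ne_bot]
    rintro rfl
    rw [h.rank_bot] at hx
    omega
  -- A face two ranks below `x` gives two distinct faces covered by `x`, both below `y`. If `x ∧ y`
  -- were strictly below `x`, it would lie above both and hence equal both.
  obtain ⟨w, -, hwx, hw⟩ := h.exists_lt_of_rank hb (rank x - 2) (by rw [h.rank_bot]; omega)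
    (by omega)
  have hwx' : w < x := lt_of_le_of_ne hwx (by rintro rfl; omega)
  obtain ⟨a, b, hab, hs⟩ := h.exists_pair hwx' (by omega)
  have ha := (hs a).2 (Or.inl rfl)
  have hb := (hs b).2 (Or.inr rfl)
  have key : ∀ c, w < c → c < x → c ⋖ x := by
    intro c h1 h2
    have := h.rank_strictMono h1
    have := h.rank_strictMono h2
    exact h.covBy_iff.2 ⟨h2.le, by omega⟩
  have ca := key a ha.1 ha.2
  have cb := key b hb.1 hb.2
  obtain ⟨m, hm⟩ := h.exists_inf₂ x y
  have hmx := ((hm m).1 le_rfl).1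
  have ham := (hm a).2 ⟨ca.le, hy a ca⟩
  have hbm := (hm b).2 ⟨cb.le, hy b cb⟩
  rcases hmx.eq_or_lt with rfl | hlt
  · exact ((hm m).1 le_rfl).2
  · exfalso
    have e1 : a = m := ham.eq_or_lt.resolve_right fun hh => ca.2 hh hlt
    have e2 : b = m := hbm.eq_or_lt.resolve_right fun hh => cb.2 hh hlt
    exact hab (e1.trans e2.symm)

/-- Ranks 0 and 1 are immediate, and above them a face is bounded as soon as the faces it covers
are. This turns the lattice into a family of vertex sets, and it is in this form that it is compared
with the models. -/
theorem shadow_subset_iff {a b : M} : shadow a ⊆ shadow b ↔ a ≤ b := by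
  have := h.finite
  refine ⟨fun hs => ?_, fun hab v hv => ⟨hv.1, hv.2.trans hab⟩⟩
  induction a using (wellFounded_lt (α := M)).induction with
  | _ a ih =>
    rcases Nat.lt_or_ge (rank a) 2 with ha | ha
    · by_cases h0 : rank a = 1
      · exact (hs ⟨h0, le_rfl⟩).2
      · have : ⊥ = a := h.eq_of_le_of_rank_le bot_le (by omega)
        exact this ▸ bot_le
    · exact h.le_of_forall_covBy_le ha fun c hc =>
        ih c hc.lt fun v hv => hs ⟨hv.1, hv.2.trans hc.le⟩

theorem shadow_injective : Function.Injective (shadow : M → Set M) := fun a b hab =>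
  le_antisymm (h.shadow_subset_iff.1 hab.subset) (h.shadow_subset_iff.1 hab.superset)

theorem shadow_top : shadow (⊤ : M) = vertices M := by
  ext v
  simp [shadow]

/-- Every face is the meet of the facets above it. -/
theorem le_of_forall_facet {a b : M} (hs : ∀ σ, IsCoatom σ → b ≤ σ → a ≤ σ) : a ≤ b := by
  have := h.finite
  induction b using (wellFounded_gt (α := M)).induction with
  | _ b ih =>
    rcases eq_or_ne b ⊤ with rfl | hb
    · exact le_top
    have hbt : b < ⊤ := lt_top_iff_ne_top.2 hb
    by_cases hc : IsCoatom b
    · exact hs b hc le_rfl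
    have hr1 := h.rank_strictMono hbt
    have hr2 : rank (⊤ : M) ≠ rank b + 1 := fun hh => hc (covBy_top_iff.1
      (h.covBy_iff.2 ⟨le_top, hh⟩))
    -- The dual diamond argument: `b` is the meet of two distinct faces covering it, and the
    -- induction puts `a` below both.
    obtain ⟨z, hbz, -, hz⟩ := h.exists_lt_of_rank hbt (rank b + 2) (by omega) (by omega)
    have hbz' : b < z := lt_of_le_of_ne hbz (by rintro rfl; omega)
    obtain ⟨x, y, hxy, hp⟩ := h.exists_pair hbz' hz
    have hx := (hp x).2 (Or.inl rfl)
    have hy := (hp y).2 (Or.inr rfl)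
    have hax := ih x hx.1 fun σ hσ hxσ => hs σ hσ (hx.1.le.trans hxσ)
    have hay := ih y hy.1 fun σ hσ hyσ => hs σ hσ (hy.1.le.trans hyσ)
    obtain ⟨m, hm⟩ := h.exists_inf₂ x y
    have ham := (hm a).2 ⟨hax, hay⟩
    have hbm := (hm b).2 ⟨hx.1.le, hy.1.le⟩
    have hmx := ((hm m).1 le_rfl)
    rcases hbm.eq_or_lt with rfl | hlt
    · exact ham
    · exfalso
      have r1 := h.rank_strictMono hx.1
      have r2 := h.rank_strictMono hx.2
      have r3 := h.rank_strictMono hlt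
      have r4 := h.rank_strictMono hy.1
      have r5 := h.rank_strictMono hy.2
      have e1 := h.eq_of_le_of_rank_le hmx.1 (by omega)
      have e2 := h.eq_of_le_of_rank_le hmx.2 (by omega)
      exact hxy (e1.symm.trans e2)

/-- The set of vertices common to all facets with a given property is a shadow. -/
theorem exists_shadow_eq (P : M → Prop) :
    ∃ m : M, shadow m = {v | v ∈ vertices M ∧ ∀ σ, P σ → v ≤ σ} := by
  obtain ⟨m, hm⟩ := h.exists_inf P
  refine ⟨m, ?_⟩
  ext v
  simp [shadow, hm]

theorem exists_facet_of_not_le {a b : M} (hab : ¬ a ≤ b) : ∃ σ, IsCoatom σ ∧ b ≤ σ ∧ ¬ a ≤ σ := by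
  by_contra hc
  push Not at hc
  exact hab (h.le_of_forall_facet hc)

theorem exists_facet_ge {a : M} (ha : a ≠ ⊤) : ∃ σ, IsCoatom σ ∧ a ≤ σ := by
  have : ¬ (⊤ : M) ≤ a := fun hh => ha (top_le_iff.1 hh)
  obtain ⟨σ, h1, h2, -⟩ := h.exists_facet_of_not_le this
  exact ⟨σ, h1, h2⟩

theorem eq_of_facet_le {σ τ : M} (hσ : IsCoatom σ) (hτ : IsCoatom τ) (hle : σ ≤ τ) : σ = τ :=
  hle.eq_or_lt.resolve_right fun hlt => hτ.1 (hσ.2 τ hlt)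

theorem rank_facet {σ : M} (hσ : IsCoatom σ) : rank σ + 1 = rank (⊤ : M) := h.mem_facets.2 hσ

theorem finite_set (s : Set M) : s.Finite := have := h.finite; s.toFinite

/-- Shadows grow strictly along a maximal chain. Thus every face has nonnegative excess; equality is
the simplex case. -/
theorem rank_le_ncard_shadow (a : M) : rank a ≤ (shadow a).ncard := by
  have := h.finite
  induction a using (wellFounded_lt (α := M)).induction with
  | _ a ih =>
    rcases eq_or_ne a ⊥ with rfl | ha
    · simp [h.rank_bot]
    obtain ⟨c, -, hc⟩ := exists_le_covBy_of_lt (bot_lt_iff_ne_bot.2 ha)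
    have h1 := ih c hc.lt
    have h2 := h.ranked c a hc
    have h3 : shadow c ⊂ shadow a := by
      refine ⟨h.shadow_subset_iff.2 hc.le, fun hh => ?_⟩
      exact hc.lt.not_ge (h.shadow_subset_iff.1 hh)
    have h4 := Set.ncard_lt_ncard h3 (h.finite_set _)
    omega

theorem rank_top_le : rank (⊤ : M) ≤ (vertices M).ncard := by
  rw [← h.shadow_top]
  exact h.rank_le_ncard_shadow ⊤

/-- A face `R` of corank two lies in exactly two facets. -/
theorem exists_facet_pair {R : M} (hR : rank R + 2 = rank (⊤ : M)) :
    ∃ a b, a ≠ b ∧ ∀ y, (IsCoatom y ∧ R ≤ y) ↔ y = a ∨ y = b := by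
  have hRt : R < ⊤ := lt_top_iff_ne_top.2 (by rintro rfl; omega)
  obtain ⟨a, b, hab, hs⟩ := h.exists_pair hRt hR.symm
  refine ⟨a, b, hab, fun y => ?_⟩
  rw [← hs y]
  constructor
  · rintro ⟨h1, h2⟩
    refine ⟨lt_of_le_of_ne h2 ?_, lt_top_iff_ne_top.2 h1.1⟩
    rintro rfl
    have := h.rank_facet h1
    omega
  · rintro ⟨h1, h2⟩
    have r1 := h.rank_strictMono h1
    have r2 := h.rank_strictMono h2
    exact ⟨covBy_top_iff.1 (h.covBy_iff.2 ⟨le_top, by omega⟩), h1.le⟩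

/-- The diamond condition at the top of the lattice, in the form that refutes configurations in both
the excess-one and the exchange arguments. -/
theorem not_three_facets {R a b c : M} (hR : rank R + 2 = rank (⊤ : M)) (ha : IsCoatom a)
    (hb : IsCoatom b) (hc : IsCoatom c) (hRa : R ≤ a) (hRb : R ≤ b) (hRc : R ≤ c)
    (hab : a ≠ b) (hac : a ≠ c) (hbc : b ≠ c) : False := by
  obtain ⟨x, y, -, hs⟩ := h.exists_facet_pair hR
  rcases (hs a).1 ⟨ha, hRa⟩ with rfl | rfl <;> rcases (hs b).1 ⟨hb, hRb⟩ with rfl | rfl <;>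
  rcases (hs c).1 ⟨hc, hRc⟩ with rfl | rfl <;> simp_all

/-- In a cellular pseudomanifold, also the graphs of the intervals of length one and two are
connected. -/
theorem connected_of_lt {x z : M} (hxz : x < z) : (facetGraph x z).Connected := by
  have hr := h.rank_strictMono hxz
  rcases Nat.lt_or_ge (rank x + 2) (rank z) with h1 | h1
  · exact h.connected x z hxz h1
  rcases (show rank z = rank x + 1 ∨ rank z = rank x + 2 by omega) with h2 | h2
  · have : ∀ σ : {σ : M // x ≤ σ ∧ σ ≤ z ∧ rank σ + 1 = rank z}, σ = ⟨x, le_rfl, hxz.le, h2.symm⟩ := by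
      intro σ
      exact Subtype.ext (h.eq_of_le_of_rank_le σ.2.1 (by have := σ.2.2.2; omega)).symm
    have : Subsingleton {σ : M // x ≤ σ ∧ σ ≤ z ∧ rank σ + 1 = rank z} :=
      ⟨fun a b => (this a).trans (this b).symm⟩
    have : Nonempty {σ : M // x ≤ σ ∧ σ ≤ z ∧ rank σ + 1 = rank z} :=
      ⟨⟨x, le_rfl, hxz.le, h2.symm⟩⟩
    exact ⟨SimpleGraph.Preconnected.of_subsingleton⟩
  · have hne : ∀ σ τ : {σ : M // x ≤ σ ∧ σ ≤ z ∧ rank σ + 1 = rank z}, σ ≠ τ →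
        (facetGraph x z).Adj σ τ := by
      intro σ τ hστ
      refine ⟨x, ⟨?_, fun m hm => ?_⟩, h2.symm⟩
      · rintro m (rfl | rfl)
        exacts [σ.2.1, τ.2.1]
      · obtain ⟨g, hg⟩ := h.exists_inf₂ σ.1 τ.1
        have hxg := (hg x).2 ⟨σ.2.1, τ.2.1⟩
        have hmg := (hg m).2 ⟨hm (by simp), hm (by simp)⟩
        have hgg := (hg g).1 le_rfl
        rcases hxg.eq_or_lt with rfl | hlt
        · exact hmg
        · exfalso
          have := h.rank_strictMono hlt
          have r1 := σ.2.2.2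
          have r2 := τ.2.2.2
          have e1 := h.eq_of_le_of_rank_le hgg.1 (by omega)
          have e2 := h.eq_of_le_of_rank_le hgg.2 (by omega)
          exact hστ (Subtype.ext (e1.symm.trans e2))
    obtain ⟨y, hy1, hy2, hy3⟩ := h.exists_lt_of_rank hxz (rank x + 1) (by omega) (by omega)
    have : Nonempty {σ : M // x ≤ σ ∧ σ ≤ z ∧ rank σ + 1 = rank z} :=
      ⟨⟨y, hy1, hy2, by omega⟩⟩
    refine ⟨fun σ τ => ?_⟩
    by_cases hst : σ = τ
    · exact hst ▸ SimpleGraph.Reachable.refl _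
    · exact (hne σ τ hst).reachable

end IsCellularPseudomanifold

end CPM

/-! ### A criterion by gradings, and intervals -/

namespace CPM

namespace IsCellularPseudomanifold

variable {M : Type u} [PartialOrder M] [BoundedOrder M]

/-- Joins come for free: the join is the meet of all common upper bounds. Any grading vanishing at
the bottom is the rank, so the remaining axioms may be checked with `r`. -/
theorem of_grading [Finite M] (r : M → ℕ) (h0 : r ⊥ = 0) (hcov : ∀ x y, x ⋖ y → r y = r x + 1)
    (hmeet : ∀ a b : M, ∃ m, IsGLB {a, b} m)
    (hdia : ∀ x z : M, x < z → r z = r x + 2 → (Set.Ioo x z).ncard = 2)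
    (hconn : ∀ x z : M, x < z → r x + 2 < r z → (facetGraph x z).Connected) :
    IsCellularPseudomanifold M := by
  have hr : ∀ x : M, rank x = r x := rank_eq_of_grading r h0 hcov
  refine ⟨inferInstance, hmeet, fun a b => ?_, ?_, ?_, ?_⟩
  · obtain ⟨m, hm⟩ := exists_inf_of_exists_isGLB hmeet (fun σ => a ≤ σ ∧ b ≤ σ)
    refine ⟨m, ⟨?_, fun σ hσ => (hm m).1 le_rfl σ ⟨hσ (by simp), hσ (by simp)⟩⟩⟩
    rintro c (rfl | rfl)
    exacts [(hm _).2 fun σ hσ => hσ.1, (hm _).2 fun σ hσ => hσ.2]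
  · simpa only [hr] using hcov
  · simpa only [hr] using hdia
  · simpa only [hr] using hconn

section Embedding

variable {N : Type v} [PartialOrder N] [BoundedOrder N] (f : N ↪o M)

/-- An order-connected image preserves covering pairs, so the rank is only shifted by the rank of
the image of the bottom. -/
theorem rank_apply_of_ordConnected (h : IsCellularPseudomanifold M)
    (hf : (Set.range f).OrdConnected) (x : N) : rank (f x) = rank x + rank (f ⊥) := by
  have := h.finite
  have : Finite N := Finite.of_injective f f.injective
  have hb : ∀ x, rank (f ⊥) ≤ rank (f x) := fun x => h.rank_mono (f.monotone bot_le)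
  have := rank_eq_of_grading (fun x : N => rank (f x) - rank (f ⊥)) (by simp) (fun x y hxy => by
    have := h.ranked _ _ ((hf.apply_covBy_apply_iff f).2 hxy)
    have := hb x
    omega) x
  have := hb x
  omega

/-- An interval of a cellular pseudomanifold is a cellular pseudomanifold. -/
theorem of_embedding (h : IsCellularPseudomanifold M)
    (hf : (Set.range f).OrdConnected) : IsCellularPseudomanifold N := by
  have := h.finite
  have : Finite N := Finite.of_injective f f.injective
  have hrk := rank_apply_of_ordConnected f h hf
  have hmem : ∀ {a b : N} {c : M}, f a ≤ c → c ≤ f b → ∃ d, f d = c :=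
    fun {a b c} h1 h2 => hf.out (Set.mem_range_self a) (Set.mem_range_self b) ⟨h1, h2⟩
  refine of_grading rank (by simp [rank]) ?_ ?_ ?_ ?_
  · intro x y hxy
    have := h.ranked _ _ ((hf.apply_covBy_apply_iff f).2 hxy)
    rw [hrk, hrk x] at this
    omega
  · intro a b
    obtain ⟨m, hm⟩ := h.exists_inf₂ (f a) (f b)
    obtain ⟨c, rfl⟩ := hmem ((hm (f ⊥)).2 ⟨f.monotone bot_le, f.monotone bot_le⟩)
      ((hm m).1 le_rfl).1
    refine ⟨c, ⟨?_, fun d hd => ?_⟩⟩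
    · have := (hm (f c)).1 le_rfl
      rintro d (rfl | rfl)
      exacts [f.le_iff_le.1 this.1, f.le_iff_le.1 this.2]
    · exact f.le_iff_le.1 ((hm (f d)).2
        ⟨f.monotone (hd (by simp)), f.monotone (hd (by simp))⟩)
  · intro x z hxz hr
    rw [← h.diamond (f x) (f z) (f.strictMono hxz) (by rw [hrk, hrk x]; omega),
      ← Set.ncard_image_of_injective _ f.injective]
    congr 1
    ext c
    constructor
    · rintro ⟨d, hd, rfl⟩
      exact ⟨f.strictMono hd.1, f.strictMono hd.2⟩
    · intro hc
      obtain ⟨d, rfl⟩ := hmem hc.1.le hc.2.le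
      exact ⟨d, ⟨f.lt_iff_lt.1 hc.1, f.lt_iff_lt.1 hc.2⟩, rfl⟩
  · intro x z hxz _
    choose g hg using fun σ : {σ : M // f x ≤ σ ∧ σ ≤ f z ∧ rank σ + 1 = rank (f z)} =>
      hmem σ.2.1 σ.2.2.1
    have hg' : ∀ σ, x ≤ g σ ∧ g σ ≤ z ∧ rank (g σ) + 1 = rank z := by
      intro σ
      have h1 := σ.2
      rw [← hg σ, f.le_iff_le, f.le_iff_le, hrk, hrk z] at h1
      exact ⟨h1.1, h1.2.1, by omega⟩
    -- Facets and meets between `f x` and `f z` pull back along `f`; this homomorphism is surjective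
    -- and so transfers connectedness.
    let F : facetGraph (f x) (f z) →g facetGraph x z :=
      { toFun := fun σ => ⟨g σ, hg' σ⟩
        map_rel' := by
          rintro σ τ ⟨m, hm, hr⟩
          have hxm : f x ≤ m := hm.2 (by
            rintro c (rfl | rfl)
            exacts [σ.2.1, τ.2.1])
          obtain ⟨c, rfl⟩ := hmem hxm ((hm.1 (by simp)).trans σ.2.2.1)
          rw [hrk, hrk z] at hr
          refine ⟨c, ⟨?_, fun d hd => ?_⟩, by omega⟩
          · rintro d (rfl | rfl)
            · exact f.le_iff_le.1 (by rw [hg]; exact hm.1 (by simp))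
            · exact f.le_iff_le.1 (by rw [hg]; exact hm.1 (by simp))
          · refine f.le_iff_le.1 (hm.2 ?_)
            rintro e (rfl | rfl)
            · rw [← hg]; exact f.monotone (hd (by simp))
            · rw [← hg]; exact f.monotone (hd (by simp)) }
    refine SimpleGraph.Connected.map F (fun τ => ?_) (h.connected_of_lt (f.strictMono hxz))
    refine ⟨⟨f τ, f.monotone τ.2.1, f.monotone τ.2.2.1, ?_⟩, ?_⟩
    · have := τ.2.2.2
      rw [hrk, hrk z]
      omega
    · exact Subtype.ext (f.injective (hg _))

theorem of_orderIso (h : IsCellularPseudomanifold M) (e : N ≃o M) : IsCellularPseudomanifold N :=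
  h.of_embedding e.toOrderEmbedding (by
    have : Set.range e.toOrderEmbedding = Set.univ := e.surjective.range_eq
    rw [this]
    exact Set.ordConnected_univ)

omit [BoundedOrder M] in
theorem range_subtype_Iic (F : M) :
    Set.range (OrderEmbedding.subtype (fun x => x ∈ Set.Iic F)) = Set.Iic F := Subtype.range_coe

omit [BoundedOrder M] in
theorem range_subtype_Ici (F : M) :
    Set.range (OrderEmbedding.subtype (fun x => x ∈ Set.Ici F)) = Set.Ici F := Subtype.range_coe

theorem Iic (h : IsCellularPseudomanifold M) (F : M) : IsCellularPseudomanifold (Set.Iic F) :=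
  h.of_embedding (OrderEmbedding.subtype _)
    (by rw [range_subtype_Iic]; exact Set.ordConnected_Iic)

theorem Ici (h : IsCellularPseudomanifold M) (p : M) : IsCellularPseudomanifold (Set.Ici p) :=
  h.of_embedding (OrderEmbedding.subtype _)
    (by rw [range_subtype_Ici]; exact Set.ordConnected_Ici)

theorem rank_Iic (h : IsCellularPseudomanifold M) {F : M} (x : Set.Iic F) :
    rank x = rank (x : M) := by
  have := rank_apply_of_ordConnected (OrderEmbedding.subtype (fun x => x ∈ Set.Iic F)) h
    (by rw [range_subtype_Iic]; exact Set.ordConnected_Iic) x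
  have hb : ((⊥ : Set.Iic F) : M) = ⊥ := rfl
  simp only [OrderEmbedding.subtype_apply, hb, h.rank_bot] at this
  exact this.symm

end Embedding

end IsCellularPseudomanifold

/-! ### Direct products -/

section Product

variable {M : Type u} {N : Type v} [PartialOrder M] [BoundedOrder M] [PartialOrder N]
  [BoundedOrder N] (hM : IsCellularPseudomanifold M) (hN : IsCellularPseudomanifold N)
include hM hN

theorem rank_prod (x : M × N) : rank x = rank x.1 + rank x.2 := by
  have := hM.finite
  have := hN.finite
  refine rank_eq_of_grading (fun x : M × N => rank x.1 + rank x.2) ?_ ?_ x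
  · simp [rank]
  · rintro ⟨a, b⟩ ⟨c, d⟩ hc
    rw [Prod.mk_covBy_mk_iff] at hc
    rcases hc with ⟨h1, rfl⟩ | ⟨h1, rfl⟩
    · have := hM.ranked _ _ h1
      simp only
      omega
    · have := hN.ranked _ _ h1
      simp only
      omega

omit [BoundedOrder M] [BoundedOrder N] hM hN in
theorem isGLB_pair_prod {a b m : M} {c d n : N} (h1 : IsGLB {a, b} m) (h2 : IsGLB {c, d} n) :
    IsGLB {(a, c), (b, d)} (m, n) := by
  constructor
  · rintro x (rfl | rfl)
    exacts [⟨h1.1 (by simp), h2.1 (by simp)⟩, ⟨h1.1 (by simp), h2.1 (by simp)⟩]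
  · rintro ⟨x, y⟩ hx
    have e1 : (x, y) ≤ (a, c) := hx (by simp)
    have e2 : (x, y) ≤ (b, d) := hx (by simp)
    refine ⟨h1.2 ?_, h2.2 ?_⟩
    · rintro z (rfl | rfl)
      exacts [e1.1, e2.1]
    · rintro z (rfl | rfl)
      exacts [e1.2, e2.2]

omit [BoundedOrder M] hM [PartialOrder N] [BoundedOrder N] hN in
theorem isGLB_pair_self (a : M) : IsGLB {a, a} a := by
  rw [Set.pair_eq_singleton]
  exact isGLB_singleton

omit [BoundedOrder M] hM [PartialOrder N] [BoundedOrder N] hN in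
theorem isGLB_pair_of_le {a b : M} (hab : a ≤ b) : IsGLB {a, b} a := by
  refine ⟨?_, fun x hx => hx (by simp)⟩
  rintro x (rfl | rfl)
  exacts [le_rfl, hab]

/-- A facet of the interval is `(σ, z₂)` or `(z₁, τ)`. Each of the two kinds is connected by itself,
and a facet of one kind is adjacent to every facet of the other, with meet `(σ, τ)`. -/
theorem connected_prod {x z : M × N} (hxz : x < z) : (facetGraph x z).Connected := by
  have hr := rank_prod hM hN
  obtain ⟨x1, x2⟩ := x
  obtain ⟨z1, z2⟩ := z
  have hle1 : x1 ≤ z1 := hxz.le.1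
  have hle2 : x2 ≤ z2 := hxz.le.2
  let i1 : facetGraph x1 z1 →g facetGraph (x1, x2) (z1, z2) :=
    { toFun := fun σ => ⟨(σ.1, z2), ⟨σ.2.1, hle2⟩, ⟨σ.2.2.1, le_rfl⟩, by
        have := σ.2.2.2
        simp only [hr]
        omega⟩
      map_rel' := by
        rintro σ τ ⟨m, hm, hrm⟩
        exact ⟨(m, z2), isGLB_pair_prod hm (isGLB_pair_self _), by simp only [hr]; omega⟩ }
  let i2 : facetGraph x2 z2 →g facetGraph (x1, x2) (z1, z2) :=
    { toFun := fun σ => ⟨(z1, σ.1), ⟨hle1, σ.2.1⟩, ⟨le_rfl, σ.2.2.1⟩, by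
        have := σ.2.2.2
        simp only [hr]
        omega⟩
      map_rel' := by
        rintro σ τ ⟨m, hm, hrm⟩
        exact ⟨(z1, m), isGLB_pair_prod (isGLB_pair_self _) hm, by simp only [hr]; omega⟩ }
  have hcase : ∀ c, (∃ σ, i1 σ = c) ∨ ∃ τ, i2 τ = c := by
    rintro ⟨⟨c1, c2⟩, ⟨h1, h2⟩, ⟨h3, h4⟩, h5⟩
    simp only [hr] at h1 h2 h3 h4 h5
    have r1 := hM.rank_mono h3
    have r2 := hN.rank_mono h4
    by_cases e : rank c2 = rank z2
    · have : c2 = z2 := hN.eq_of_le_of_rank_le h4 e.ge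
      subst this
      exact Or.inl ⟨⟨c1, h1, h3, by omega⟩, rfl⟩
    · have : c1 = z1 := hM.eq_of_le_of_rank_le h3 (by omega)
      subst this
      exact Or.inr ⟨⟨c2, h2, h4, by omega⟩, rfl⟩
  have hcross : ∀ σ τ, (facetGraph (x1, x2) (z1, z2)).Adj (i1 σ) (i2 τ) := by
    intro σ τ
    refine ⟨(σ.1, τ.1), isGLB_pair_prod (isGLB_pair_of_le σ.2.2.1) ?_, ?_⟩
    · rw [Set.pair_comm]
      exact isGLB_pair_of_le τ.2.2.1
    · have h1 := σ.2.2.2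
      have h2 := τ.2.2.2
      simp only [hr]
      omega
  have h11 : ∀ σ σ', (facetGraph (x1, x2) (z1, z2)).Reachable (i1 σ) (i1 σ') := fun σ σ' => by
    have : x1 < z1 := lt_of_le_of_ne hle1 (by
      rintro rfl
      have := σ.2.2.2
      have := hM.rank_mono σ.2.1
      omega)
    exact ((hM.connected_of_lt this).preconnected σ σ').map i1
  have h22 : ∀ σ σ', (facetGraph (x1, x2) (z1, z2)).Reachable (i2 σ) (i2 σ') := fun σ σ' => by
    have : x2 < z2 := lt_of_le_of_ne hle2 (by
      rintro rfl
      have := σ.2.2.2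
      have := hN.rank_mono σ.2.1
      omega)
    exact ((hN.connected_of_lt this).preconnected σ σ').map i2
  have hne : Nonempty {σ : M × N // (x1, x2) ≤ σ ∧ σ ≤ (z1, z2) ∧ rank σ + 1 = rank (z1, z2)} := by
    rcases Prod.lt_iff.1 hxz with ⟨h1, -⟩ | ⟨-, h1⟩
    · exact (hM.connected_of_lt h1).nonempty.map i1
    · exact (hN.connected_of_lt h1).nonempty.map i2
  refine ⟨fun c d => ?_⟩
  rcases hcase c with ⟨σ, rfl⟩ | ⟨σ, rfl⟩ <;> rcases hcase d with ⟨τ, rfl⟩ | ⟨τ, rfl⟩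
  · exact h11 σ τ
  · exact (hcross σ τ).reachable
  · exact (hcross τ σ).symm.reachable
  · exact h22 σ τ

theorem diamond_prod {x z : M × N} (hxz : x < z) (h2 : rank z = rank x + 2) :
    (Set.Ioo x z).ncard = 2 := by
  obtain ⟨x1, x2⟩ := x
  obtain ⟨z1, z2⟩ := z
  have hle1 : x1 ≤ z1 := hxz.le.1
  have hle2 : x2 ≤ z2 := hxz.le.2
  simp only [rank_prod hM hN] at h2
  have r1 := hM.rank_mono hle1
  have r2 := hN.rank_mono hle2
  -- Rank two splits as 2 + 0, 0 + 2 or 1 + 1; in the last case the interval is a product of two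
  -- covering pairs, hence a square.
  rcases (show rank z2 = rank x2 ∨ rank z1 = rank x1 ∨
    (rank z1 = rank x1 + 1 ∧ rank z2 = rank x2 + 1) by omega) with e | e | ⟨e1, e2⟩
  · obtain rfl := hN.eq_of_le_of_rank_le hle2 e.le
    have : x1 < z1 := lt_of_le_of_ne hle1 (by rintro rfl; omega)
    refine Eq.trans ?_ ((Set.ncard_image_of_injective _ (Prod.mk_left_injective x2)).trans
      (hM.diamond x1 z1 this (by omega)))
    congr 1
    ext ⟨c, d⟩
    simp only [Set.mem_Ioo, Set.mem_image, Prod.mk.injEq]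
    constructor
    · rintro ⟨h3, h4⟩
      obtain rfl := le_antisymm h3.le.2 h4.le.2
      exact ⟨c, ⟨Prod.mk_lt_mk_iff_left.1 h3, Prod.mk_lt_mk_iff_left.1 h4⟩, rfl, rfl⟩
    · rintro ⟨a, ⟨h3, h4⟩, rfl, rfl⟩
      exact ⟨Prod.mk_lt_mk_iff_left.2 h3, Prod.mk_lt_mk_iff_left.2 h4⟩
  · obtain rfl := hM.eq_of_le_of_rank_le hle1 e.le
    have : x2 < z2 := lt_of_le_of_ne hle2 (by rintro rfl; omega)
    refine Eq.trans ?_ ((Set.ncard_image_of_injective _ (Prod.mk_right_injective x1)).trans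
      (hN.diamond x2 z2 this (by omega)))
    congr 1
    ext ⟨c, d⟩
    simp only [Set.mem_Ioo, Set.mem_image, Prod.mk.injEq]
    constructor
    · rintro ⟨h3, h4⟩
      obtain rfl := le_antisymm h3.le.1 h4.le.1
      exact ⟨d, ⟨Prod.mk_lt_mk_iff_right.1 h3, Prod.mk_lt_mk_iff_right.1 h4⟩, rfl, rfl⟩
    · rintro ⟨a, ⟨h3, h4⟩, rfl, rfl⟩
      exact ⟨Prod.mk_lt_mk_iff_right.2 h3, Prod.mk_lt_mk_iff_right.2 h4⟩
  · have c1 : x1 ⋖ z1 := hM.covBy_iff.2 ⟨hle1, e1⟩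
    have c2 : x2 ⋖ z2 := hN.covBy_iff.2 ⟨hle2, e2⟩
    rw [Set.ncard_eq_two]
    refine ⟨(x1, z2), (z1, x2), fun hh => c1.ne (congrArg Prod.fst hh), ?_⟩
    ext ⟨c, d⟩
    simp only [Set.mem_Ioo, Set.mem_insert_iff, Set.mem_singleton_iff, Prod.mk.injEq]
    constructor
    · rintro ⟨h3, h4⟩
      rcases c1.eq_or_eq h3.le.1 h4.le.1 with f1 | f1 <;>
        rcases c2.eq_or_eq h3.le.2 h4.le.2 with f2 | f2 <;> simp_all
    · rintro (⟨rfl, rfl⟩ | ⟨rfl, rfl⟩)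
      · exact ⟨Prod.mk_lt_mk_iff_right.2 c2.lt, Prod.mk_lt_mk_iff_left.2 c1.lt⟩
      · exact ⟨Prod.mk_lt_mk_iff_left.2 c1.lt, Prod.mk_lt_mk_iff_right.2 c2.lt⟩

theorem exists_isGLB_prod (a b : M × N) : ∃ m, IsGLB {a, b} m := by
  obtain ⟨m, hm⟩ := hM.exists_meet a.1 b.1
  obtain ⟨n, hn⟩ := hN.exists_meet a.2 b.2
  exact ⟨(m, n), isGLB_pair_prod hm hn⟩

theorem IsCellularPseudomanifold.prod : IsCellularPseudomanifold (M × N) := by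
  have := hM.finite
  have := hN.finite
  refine .of_grading rank (by simp [rank]) ?_ (exists_isGLB_prod hM hN)
    (fun x z => diamond_prod hM hN) (fun x z hxz _ => connected_prod hM hN hxz)
  rintro ⟨a, b⟩ ⟨c, d⟩ hc
  simp only [rank_prod hM hN]
  rw [Prod.mk_covBy_mk_iff] at hc
  rcases hc with ⟨h1, rfl⟩ | ⟨h1, rfl⟩
  · have := hM.ranked _ _ h1
    omega
  · have := hN.ranked _ _ h1
    omega

end Product

end CPM

namespace CPM

/-! ### Joins -/

section Join

variable {M : Type u} {N : Type v} [PartialOrder M] [BoundedOrder M] [PartialOrder N]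
  [BoundedOrder N]

/-- The face of the join given by two proper faces. -/
def Join.mk (a : M) (b : N) (ha : a < ⊤) (hb : b < ⊤) : Join M N := ⟨(a, b), Or.inl ⟨ha, hb⟩⟩

theorem Join.mk_le_mk {a c : M} {b d : N} {ha : a < ⊤} {hb : b < ⊤} {hc : c < ⊤} {hd : d < ⊤} :
    Join.mk a b ha hb ≤ Join.mk c d hc hd ↔ a ≤ c ∧ b ≤ d := Iff.rfl

theorem Join.eq_top_or_mk (p : Join M N) : p = ⊤ ∨ ∃ a b ha hb, p = Join.mk a b ha hb := by
  obtain ⟨⟨a, b⟩, ⟨h1, h2⟩ | ⟨h1, h2⟩⟩ := p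
  · exact Or.inr ⟨a, b, h1, h2, rfl⟩
  · simp only at h1 h2
    subst h1 h2
    exact Or.inl rfl

theorem Join.mk_lt_top {a : M} {b : N} {ha : a < ⊤} {hb : b < ⊤} : Join.mk a b ha hb < ⊤ :=
  lt_of_le_of_ne le_top fun hh => ha.ne (congrArg (fun p => p.1.1) hh)

theorem Join.mk_lt_mk {a c : M} {b d : N} {ha : a < ⊤} {hb : b < ⊤} {hc : c < ⊤} {hd : d < ⊤} :
    Join.mk a b ha hb < Join.mk c d hc hd ↔ (a, b) < (c, d) := Iff.rfl

theorem Join.mk_eq_bot [Nontrivial M] [Nontrivial N] :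
    Join.mk (⊥ : M) (⊥ : N) bot_lt_top bot_lt_top = ⊥ := by
  refine le_antisymm ?_ bot_le
  rcases Join.eq_top_or_mk (⊥ : Join M N) with h | ⟨a, b, ha, hb, h⟩
  · rw [h]; exact le_top
  · rw [h]; exact ⟨bot_le, bot_le⟩

theorem Join.mk_covBy_mk {a c : M} {b d : N} {ha : a < ⊤} {hb : b < ⊤} {hc : c < ⊤} {hd : d < ⊤} :
    Join.mk a b ha hb ⋖ Join.mk c d hc hd ↔ (a, b) ⋖ (c, d) := by
  constructor
  · rintro ⟨h1, h2⟩
    refine ⟨h1, fun e h3 h4 => ?_⟩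
    exact h2 (c := Join.mk e.1 e.2 (h4.le.1.trans_lt hc) (h4.le.2.trans_lt hd)) h3 h4
  · rintro ⟨h1, h2⟩
    refine ⟨h1, fun e h3 h4 => h2 (c := e.1) h3 h4⟩

theorem Join.mk_covBy_top {a : M} {b : N} {ha : a < ⊤} {hb : b < ⊤} :
    Join.mk a b ha hb ⋖ ⊤ ↔ IsCoatom a ∧ IsCoatom b := by
  constructor
  · rintro ⟨h1, h2⟩
    refine ⟨⟨ha.ne, fun c hc => ?_⟩, hb.ne, fun c hc => ?_⟩
    · by_contra hne
      exact h2 (c := Join.mk c b (lt_top_iff_ne_top.2 hne) hb)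
        (Join.mk_lt_mk.2 (Prod.mk_lt_mk_iff_left.2 hc)) Join.mk_lt_top
    · by_contra hne
      exact h2 (c := Join.mk a c ha (lt_top_iff_ne_top.2 hne))
        (Join.mk_lt_mk.2 (Prod.mk_lt_mk_iff_right.2 hc)) Join.mk_lt_top
  · rintro ⟨h1, h2⟩
    refine ⟨Join.mk_lt_top, fun e h3 h4 => ?_⟩
    obtain h | ⟨c, d, hc, hd, rfl⟩ := Join.eq_top_or_mk e
    · exact h4.ne h
    · rcases Prod.mk_lt_mk.1 (Join.mk_lt_mk.1 h3) with ⟨h5, -⟩ | ⟨-, h5⟩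
      · exact hc.ne (h1.2 _ h5)
      · exact hd.ne (h2.2 _ h5)

theorem Join.isCoatom_mk {a : M} {b : N} {ha : a < ⊤} {hb : b < ⊤} :
    IsCoatom (Join.mk a b ha hb) ↔ IsCoatom a ∧ IsCoatom b := by
  rw [← covBy_top_iff, Join.mk_covBy_top]

theorem Join.isGLB_of_val {p q m : Join M N} (hg : IsGLB {p.1, q.1} m.1) : IsGLB {p, q} m := by
  constructor
  · rintro x (rfl | rfl)
    exacts [hg.1 (Set.mem_insert _ _), hg.1 (Set.mem_insert_of_mem _ rfl)]
  · intro x hx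
    refine (le_isGLB_iff (b := x.1) hg).2 ?_
    rintro y (rfl | rfl)
    exacts [hx (Set.mem_insert _ _), hx (Set.mem_insert_of_mem _ rfl)]

section

variable [Nontrivial M] [Nontrivial N] (hM : IsCellularPseudomanifold M)
  (hN : IsCellularPseudomanifold N)
include hM hN

theorem rank_join_aux (x : Join M N) :
    (∀ a b ha hb, x = Join.mk a b ha hb → rank x = rank a + rank b) ∧
      (x = ⊤ → rank x + 1 = rank (⊤ : M) + rank (⊤ : N)) := by
  classical
  have := hM.finite
  have := hN.finite
  have hpos : 0 < rank (⊤ : M) + rank (⊤ : N) := by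
    have := hM.rank_strictMono (bot_lt_top (α := M))
    omega
  -- The top covers the pairs of coatoms, so its rank is one less than in the direct product; `hpos`
  -- keeps the natural subtraction from truncating.
  have key := rank_eq_of_grading (fun x : Join M N =>
    if x = ⊤ then rank (⊤ : M) + rank (⊤ : N) - 1 else rank x.1.1 + rank x.1.2) ?_ ?_ x
  · rw [key]
    constructor
    · rintro a b ha hb rfl
      rw [if_neg Join.mk_lt_top.ne]
      rfl
    · rintro rfl
      rw [if_pos rfl]
      omega
  · rw [← Join.mk_eq_bot, if_neg Join.mk_lt_top.ne]
    simp [Join.mk, rank]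
  · intro p q hpq
    obtain rfl | ⟨a, b, ha, hb, rfl⟩ := Join.eq_top_or_mk p
    · exact absurd hpq.lt not_top_lt
    rw [if_neg (Join.mk_lt_top (ha := ha) (hb := hb)).ne]
    obtain rfl | ⟨c, d, hc, hd, rfl⟩ := Join.eq_top_or_mk q
    · have h1 := Join.mk_covBy_top.1 hpq
      have h2 := hM.rank_facet h1.1
      have h3 := hN.rank_facet h1.2
      simp only [if_true, Join.mk]
      omega
    · rw [if_neg Join.mk_lt_top.ne]
      have h1 := Join.mk_covBy_mk.1 hpq
      rw [Prod.mk_covBy_mk_iff] at h1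
      simp only [Join.mk]
      rcases h1 with ⟨h1, rfl⟩ | ⟨h1, rfl⟩
      · have := hM.ranked _ _ h1
        omega
      · have := hN.ranked _ _ h1
        omega

theorem rank_join_mk {a : M} {b : N} (ha : a < ⊤) (hb : b < ⊤) :
    rank (Join.mk a b ha hb) = rank a + rank b := (rank_join_aux hM hN _).1 a b ha hb rfl

theorem rank_join_top : rank (⊤ : Join M N) + 1 = rank (⊤ : M) + rank (⊤ : N) :=
  (rank_join_aux hM hN _).2 rfl

/-- Below a proper face the intervals are those of the direct product. At the top the facets are
pairs of facets, and changing one component along an edge is an edge, so the box product of the two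
graphs maps onto the facet graph. -/
theorem connected_join {x z : Join M N} (hxz : x < z) : (facetGraph x z).Connected := by
  have hrm := fun {a : M} {b : N} (ha : a < ⊤) (hb : b < ⊤) => rank_join_mk hM hN ha hb
  have hrp := rank_prod hM hN
  have htop := rank_join_top hM hN
  obtain rfl | ⟨x1, x2, hx1, hx2, rfl⟩ := Join.eq_top_or_mk x
  · exact absurd hxz not_top_lt
  obtain rfl | ⟨z1, z2, hz1, hz2, rfl⟩ := Join.eq_top_or_mk z
  · have hl1 : ∀ σ : {σ : M // x1 ≤ σ ∧ σ ≤ ⊤ ∧ rank σ + 1 = rank (⊤ : M)}, σ.1 < ⊤ :=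
      fun σ => lt_top_iff_ne_top.2 fun hh => by
        have := σ.2.2.2
        rw [hh] at this
        omega
    have hl2 : ∀ σ : {σ : N // x2 ≤ σ ∧ σ ≤ ⊤ ∧ rank σ + 1 = rank (⊤ : N)}, σ.1 < ⊤ :=
      fun σ => lt_top_iff_ne_top.2 fun hh => by
        have := σ.2.2.2
        rw [hh] at this
        omega
    let F : (facetGraph x1 ⊤).boxProd (facetGraph x2 ⊤) →g facetGraph (Join.mk x1 x2 hx1 hx2) ⊤ :=
      { toFun := fun σ => ⟨Join.mk σ.1.1 σ.2.1 (hl1 σ.1) (hl2 σ.2), ⟨σ.1.2.1, σ.2.2.1⟩, le_top, by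
          have h1 := σ.1.2.2.2
          have h2 := σ.2.2.2.2
          rw [hrm]
          omega⟩
        map_rel' := by
          rintro ⟨σ, σ'⟩ ⟨τ, τ'⟩ hst
          rw [SimpleGraph.boxProd_adj] at hst
          simp only at hst
          rcases hst with ⟨⟨m, hm, hr⟩, rfl⟩ | ⟨⟨m, hm, hr⟩, rfl⟩
          · have hlt : m < ⊤ := (hm.1 (by simp)).trans_lt (hl1 σ)
            refine ⟨Join.mk m σ'.1 hlt (hl2 σ'),
              Join.isGLB_of_val (isGLB_pair_prod hm (isGLB_pair_self _)), ?_⟩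
            have := σ'.2.2.2
            rw [hrm]
            omega
          · have hlt : m < ⊤ := (hm.1 (by simp)).trans_lt (hl2 σ')
            refine ⟨Join.mk σ.1 m (hl1 σ) hlt,
              Join.isGLB_of_val (isGLB_pair_prod (isGLB_pair_self _) hm), ?_⟩
            have := σ.2.2.2
            rw [hrm]
            omega }
    refine SimpleGraph.Connected.map F (fun τ => ?_)
      ((hM.connected_of_lt hx1).boxProd (hN.connected_of_lt hx2))
    obtain ⟨p, hp1, hp2, hp3⟩ := τ
    obtain rfl | ⟨a, b, ha, hb, rfl⟩ := Join.eq_top_or_mk p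
    · omega
    rw [hrm] at hp3
    have r1 := hM.rank_strictMono ha
    have r2 := hN.rank_strictMono hb
    exact ⟨(⟨a, hp1.1, le_top, by omega⟩, ⟨b, hp1.2, le_top, by omega⟩), rfl⟩
  · let F : facetGraph (x1, x2) (z1, z2) →g
        facetGraph (Join.mk x1 x2 hx1 hx2) (Join.mk z1 z2 hz1 hz2) :=
      { toFun := fun σ => ⟨Join.mk σ.1.1 σ.1.2 (σ.2.2.1.1.trans_lt hz1) (σ.2.2.1.2.trans_lt hz2),
          σ.2.1, σ.2.2.1, by
            have := σ.2.2.2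
            simp only [hrp] at this
            rw [hrm, hrm]
            exact this⟩
        map_rel' := by
          rintro σ τ ⟨m, hm, hr⟩
          have hle : m ≤ (z1, z2) := (hm.1 (by simp)).trans σ.2.2.1
          simp only [hrp] at hr
          refine ⟨Join.mk m.1 m.2 (hle.1.trans_lt hz1) (hle.2.trans_lt hz2), Join.isGLB_of_val hm, ?_⟩
          rw [hrm, hrm]
          exact hr }
    refine SimpleGraph.Connected.map F (fun τ => ?_)
      (connected_prod hM hN (x := (x1, x2)) (z := (z1, z2)) hxz)
    obtain ⟨p, hp1, hp2, hp3⟩ := τ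
    obtain rfl | ⟨a, b, ha, hb, rfl⟩ := Join.eq_top_or_mk p
    · exact absurd hp2 (Join.mk_lt_top.not_ge)
    rw [hrm, hrm] at hp3
    exact ⟨⟨(a, b), hp1, hp2, by simpa only [hrp] using hp3⟩, rfl⟩

theorem diamond_join {x z : Join M N} (hxz : x < z) (h2 : rank z = rank x + 2) :
    (Set.Ioo x z).ncard = 2 := by
  have hrm := fun {a : M} {b : N} (ha : a < ⊤) (hb : b < ⊤) => rank_join_mk hM hN ha hb
  have htop := rank_join_top hM hN
  obtain rfl | ⟨x1, x2, hx1, hx2, rfl⟩ := Join.eq_top_or_mk x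
  · exact absurd hxz not_top_lt
  obtain rfl | ⟨z1, z2, hz1, hz2, rfl⟩ := Join.eq_top_or_mk z
  · have r1 := hM.rank_strictMono hx1
    have r2 := hN.rank_strictMono hx2
    rw [hrm] at h2
    -- One component has corank one and is already a coatom, hence frozen; the two intermediate
    -- faces come from the diamond in the other component.
    rcases (show (rank (⊤ : M) = rank x1 + 1 ∧ rank (⊤ : N) = rank x2 + 2) ∨
      (rank (⊤ : M) = rank x1 + 2 ∧ rank (⊤ : N) = rank x2 + 1) by omega) with ⟨e1, e2⟩ | ⟨e1, e2⟩
    · have hc : IsCoatom x1 := covBy_top_iff.1 (hM.covBy_iff.2 ⟨le_top, e1⟩)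
      obtain ⟨a, b, hab, hs⟩ := hN.exists_pair hx2 e2
      have ha := (hs a).2 (Or.inl rfl)
      have hb := (hs b).2 (Or.inr rfl)
      rw [Set.ncard_eq_two]
      refine ⟨Join.mk x1 a hx1 ha.2, Join.mk x1 b hx1 hb.2,
        fun hh => hab (congrArg (fun p => p.1.2) hh), ?_⟩
      ext p
      simp only [Set.mem_Ioo, Set.mem_insert_iff, Set.mem_singleton_iff]
      constructor
      · rintro ⟨h3, h4⟩
        obtain rfl | ⟨c, d, hc', hd, rfl⟩ := Join.eq_top_or_mk p
        · exact absurd h4 not_top_lt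
        have hcx : c = x1 := ((show x1 ≤ c from h3.le.1).eq_or_lt.resolve_right
          fun hlt => hc'.ne (hc.2 _ hlt)).symm
        subst hcx
        rcases (hs d).1 ⟨Prod.mk_lt_mk_iff_right.1 (Join.mk_lt_mk.1 h3), hd⟩ with rfl | rfl
        exacts [Or.inl rfl, Or.inr rfl]
      · rintro (rfl | rfl)
        · exact ⟨Join.mk_lt_mk.2 (Prod.mk_lt_mk_iff_right.2 ha.1), Join.mk_lt_top⟩
        · exact ⟨Join.mk_lt_mk.2 (Prod.mk_lt_mk_iff_right.2 hb.1), Join.mk_lt_top⟩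
    · have hc : IsCoatom x2 := covBy_top_iff.1 (hN.covBy_iff.2 ⟨le_top, e2⟩)
      obtain ⟨a, b, hab, hs⟩ := hM.exists_pair hx1 e1
      have ha := (hs a).2 (Or.inl rfl)
      have hb := (hs b).2 (Or.inr rfl)
      rw [Set.ncard_eq_two]
      refine ⟨Join.mk a x2 ha.2 hx2, Join.mk b x2 hb.2 hx2,
        fun hh => hab (congrArg (fun p => p.1.1) hh), ?_⟩
      ext p
      simp only [Set.mem_Ioo, Set.mem_insert_iff, Set.mem_singleton_iff]
      constructor
      · rintro ⟨h3, h4⟩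
        obtain rfl | ⟨d, c, hd, hc', rfl⟩ := Join.eq_top_or_mk p
        · exact absurd h4 not_top_lt
        have hcx : c = x2 := ((show x2 ≤ c from h3.le.2).eq_or_lt.resolve_right
          fun hlt => hc'.ne (hc.2 _ hlt)).symm
        subst hcx
        rcases (hs d).1 ⟨Prod.mk_lt_mk_iff_left.1 (Join.mk_lt_mk.1 h3), hd⟩ with rfl | rfl
        exacts [Or.inl rfl, Or.inr rfl]
      · rintro (rfl | rfl)
        · exact ⟨Join.mk_lt_mk.2 (Prod.mk_lt_mk_iff_left.2 ha.1), Join.mk_lt_top⟩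
        · exact ⟨Join.mk_lt_mk.2 (Prod.mk_lt_mk_iff_left.2 hb.1), Join.mk_lt_top⟩
  · rw [hrm, hrm] at h2
    have := diamond_prod hM hN (x := (x1, x2)) (z := (z1, z2)) hxz
      (by simpa only [rank_prod hM hN] using h2)
    rw [← this, ← Set.ncard_image_of_injective (Set.Ioo (Join.mk x1 x2 hx1 hx2) _)
      Subtype.val_injective]
    congr 1
    ext ⟨c, d⟩
    constructor
    · rintro ⟨p, hp, hpe⟩
      rw [← hpe]
      exact hp
    · rintro ⟨h3, h4⟩
      exact ⟨Join.mk c d (h4.le.1.trans_lt hz1) (h4.le.2.trans_lt hz2), ⟨h3, h4⟩, rfl⟩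

theorem IsCellularPseudomanifold.join : IsCellularPseudomanifold (Join M N) := by
  have := hM.finite
  have := hN.finite
  have hrm := fun {a : M} {b : N} (ha : a < ⊤) (hb : b < ⊤) => rank_join_mk hM hN ha hb
  have htop := rank_join_top hM hN
  refine .of_grading rank (by simp [rank]) ?_ ?_
    (fun x z => diamond_join hM hN) (fun x z hxz _ => connected_join hM hN hxz)
  · intro p q hpq
    obtain rfl | ⟨a, b, ha, hb, rfl⟩ := Join.eq_top_or_mk p
    · exact absurd hpq.lt not_top_lt
    obtain rfl | ⟨c, d, hc, hd, rfl⟩ := Join.eq_top_or_mk q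
    · have h1 := Join.mk_covBy_top.1 hpq
      have h2 := hM.rank_facet h1.1
      have h3 := hN.rank_facet h1.2
      rw [hrm]
      omega
    · have h1 := Join.mk_covBy_mk.1 hpq
      rw [Prod.mk_covBy_mk_iff] at h1
      rw [hrm, hrm]
      rcases h1 with ⟨h1, rfl⟩ | ⟨h1, rfl⟩
      · have := hM.ranked _ _ h1
        omega
      · have := hN.ranked _ _ h1
        omega
  · intro p q
    obtain rfl | ⟨a, b, ha, hb, rfl⟩ := Join.eq_top_or_mk p
    · exact ⟨q, by rw [Set.pair_comm]; exact isGLB_pair_of_le le_top⟩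
    obtain rfl | ⟨c, d, hc, hd, rfl⟩ := Join.eq_top_or_mk q
    · exact ⟨_, isGLB_pair_of_le le_top⟩
    obtain ⟨m, hm⟩ := exists_isGLB_prod hM hN (a, b) (c, d)
    have hle : m ≤ (a, b) := hm.1 (by simp)
    exact ⟨Join.mk m.1 m.2 (hle.1.trans_lt ha) (hle.2.trans_lt hb), Join.isGLB_of_val hm⟩

end

end Join

end CPM

namespace CPM

/-! ### Isomorphisms between products and joins -/

section Iso

variable {M M' N N' : Type*} [PartialOrder M] [PartialOrder M'] [PartialOrder N] [PartialOrder N']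

/-- The product of two order isomorphisms. -/
def prodCongr (e : M ≃o M') (f : N ≃o N') : M × N ≃o M' × N' where
  toEquiv := Equiv.prodCongr e.toEquiv f.toEquiv
  map_rel_iff' := by
    rintro ⟨a, b⟩ ⟨c, d⟩
    exact and_congr e.le_iff_le f.le_iff_le

variable [BoundedOrder M] [BoundedOrder M'] [BoundedOrder N] [BoundedOrder N']

/-- The join of two order isomorphisms. -/
def Join.congr (e : M ≃o M') (f : N ≃o N') : Join M N ≃o Join M' N' where
  toEquiv := (prodCongr e f).toEquiv.subtypeEquiv fun p => by
    simp [prodCongr, lt_top_iff_ne_top]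
  map_rel_iff' := (prodCongr e f).le_iff_le

/-- The join is commutative up to isomorphism. -/
def Join.comm : Join M N ≃o Join N M where
  toEquiv := (Equiv.prodComm M N).subtypeEquiv fun p => by
    simp only [Equiv.prodComm_apply, Prod.fst_swap, Prod.snd_swap]
    tauto
  map_rel_iff' := and_comm

theorem Join.lt_top_iff {p : Join M N} : p < ⊤ ↔ p.1.1 < ⊤ ∧ p.1.2 < ⊤ := by
  obtain rfl | ⟨a, b, ha, hb, rfl⟩ := Join.eq_top_or_mk p
  · simp [show ((⊤ : Join M N) : M × N) = (⊤, ⊤) from rfl]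
  · exact ⟨fun _ => ⟨ha, hb⟩, fun _ => Join.mk_lt_top⟩

theorem Join.eq_top_iff {p : Join M N} : p = ⊤ ↔ p.1.1 = ⊤ ∧ p.1.2 = ⊤ := by
  rw [Subtype.ext_iff]
  exact Prod.ext_iff

/-- The membership condition of an iterated join, made symmetric in the three factors so that they
can be permuted. -/
theorem Join.swap_aux {L : Type*} [PartialOrder L] [BoundedOrder L] (p : Join (Join M N) L) :
    (p.1.1.1.1 < ⊤ ∧ p.1.1.1.2 < ⊤ ∧ p.1.2 < ⊤) ∨
      (p.1.1.1.1 = ⊤ ∧ p.1.1.1.2 = ⊤ ∧ p.1.2 = ⊤) := by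
  rcases p.2 with ⟨h1, h2⟩ | ⟨h1, h2⟩
  · rw [Join.lt_top_iff] at h1
    exact Or.inl ⟨h1.1, h1.2, h2⟩
  · rw [Join.eq_top_iff] at h1
    exact Or.inr ⟨h1.1, h1.2, h2⟩

/-- Interchange of the last two factors of a join of three posets. -/
def Join.swapRight {L : Type*} [PartialOrder L] [BoundedOrder L] (p : Join (Join M N) L) :
    Join (Join M L) N :=
  ⟨(⟨(p.1.1.1.1, p.1.2), by have := Join.swap_aux p; tauto⟩, p.1.1.1.2), by
    rw [Join.lt_top_iff, Join.eq_top_iff]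
    have := Join.swap_aux p
    tauto⟩

/-- The last two factors of a join of three posets commute up to isomorphism. -/
def Join.rightComm {L : Type*} [PartialOrder L] [BoundedOrder L] :
    Join (Join M N) L ≃o Join (Join M L) N where
  toFun := Join.swapRight
  invFun := Join.swapRight
  left_inv _ := rfl
  right_inv _ := rfl
  map_rel_iff' := by
    rintro ⟨⟨⟨⟨a, b⟩, _⟩, c⟩, _⟩ ⟨⟨⟨⟨a', b'⟩, _⟩, c'⟩, _⟩
    change ((a ≤ a' ∧ c ≤ c') ∧ b ≤ b') ↔ ((a ≤ a' ∧ b ≤ b') ∧ c ≤ c')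
    tauto

omit [BoundedOrder M] [BoundedOrder N] in
/-- Two posets with order embeddings into a third one with equal ranges are isomorphic. -/
theorem nonempty_orderIso_of_range {X : Type*} [PartialOrder X] (f : M ↪o X) (g : N ↪o X)
    (hfg : Set.range f = Set.range g) : Nonempty (M ≃o N) :=
  ⟨f.orderIso.trans ((OrderIso.setCongr _ _ hfg).trans g.orderIso.symm)⟩

/-- The product with a lattice with one element. -/
def prodSetEmpty (M : Type u) [PartialOrder M] (α : Type v) [IsEmpty α] : M ≃o M × Set α where
  toFun x := (x, ∅)
  invFun := Prod.fst
  left_inv _ := rfl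
  right_inv _ := Prod.ext rfl (Subsingleton.elim _ _)
  map_rel_iff' := ⟨fun hh => hh.1, fun hh => ⟨hh, le_rfl⟩⟩

/-- Boolean lattices of the same rank are isomorphic. -/
theorem nonempty_stdSphere_iso {α : Type*} [Finite α] {b : ℤ} (hb : (Nat.card α : ℤ) = b + 2) :
    Nonempty (Set α ≃o StdSphere b) := by
  have e : α ≃ Fin (b + 2).toNat := Finite.equivFinOfCardEq (by omega)
  exact ⟨e.toOrderIsoSet.trans Fintype.finsetOrderIsoSet.symm⟩

end Iso

/-! ### Vertices missed by a common facet -/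

section Model

/-- A labelling of the atoms by a type `V`, together with the relation of being missed by a
common coatom. -/
structure IsAtomModel {M : Type*} {V : Type*} [PartialOrder M] [BoundedOrder M] (f : V → M)
    (R : V → V → Prop) : Prop where
  injective : Function.Injective f
  isAtom_iff : ∀ x, IsAtom x ↔ ∃ v, f v = x
  rel : ∀ v w, R v w ↔ ∃ σ, IsCoatom σ ∧ ¬ f v ≤ σ ∧ ¬ f w ≤ σ
  refl : ∀ v, R v v

/-- The relation on a disjoint union given by relations on the parts and the constant `c` for
elements in different parts. -/
def sumRel {V W : Type*} (R : V → V → Prop) (S : W → W → Prop) (c : Prop) :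
    V ⊕ W → V ⊕ W → Prop
  | .inl v, .inl w => R v w
  | .inr v, .inr w => S v w
  | _, _ => c

variable {M N V W : Type*} [PartialOrder M] [BoundedOrder M] [PartialOrder N] [BoundedOrder N]
  {f : V → M} {g : W → N} {R : V → V → Prop} {S : W → W → Prop}

/-- A facet of a simplex misses a single vertex, so no two distinct vertices are related. -/
theorem isAtomModel_set (α : Type*) : IsAtomModel (fun a : α => ({a} : Set α)) Eq where
  injective := Set.singleton_injective
  isAtom_iff x := by rw [Set.isAtom_iff]; simp [eq_comm]
  rel v w := by
    simp only [Set.isCoatom_iff]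
    constructor
    · rintro rfl
      exact ⟨{v}ᶜ, ⟨v, rfl⟩, by simp, by simp⟩
    · rintro ⟨_, ⟨x, rfl⟩, h1, h2⟩
      simp only [Set.singleton_subset_iff, Set.mem_compl_iff,
        Set.mem_singleton_iff, not_not] at h1 h2
      rw [h1, h2]
  refl _ := rfl

theorem IsAtomModel.of_orderIso (hf : IsAtomModel f R) (e : M ≃o N) :
    IsAtomModel (fun v => e (f v)) R where
  injective := e.injective.comp hf.injective
  isAtom_iff x := by
    rw [← e.symm.isAtom_iff, hf.isAtom_iff]
    exact exists_congr fun v => by rw [OrderIso.eq_symm_apply]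
  rel v w := by
    rw [hf.rel]
    constructor
    · rintro ⟨σ, h1, h2, h3⟩
      exact ⟨e σ, (e.isCoatom_iff σ).2 h1, by simpa using h2, by simpa using h3⟩
    · rintro ⟨σ, h1, h2, h3⟩
      exact ⟨e.symm σ, (e.symm.isCoatom_iff σ).2 h1, by rwa [e.le_symm_apply],
        by rwa [e.le_symm_apply]⟩
  refl := hf.refl

/-- Both labellings enumerate the atoms, and the relation is defined from the order alone; it is
therefore an isomorphism invariant. -/
theorem IsAtomModel.exists_equiv {g : W → M} (hf : IsAtomModel f R) (hg : IsAtomModel g S) :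
    ∃ φ : V ≃ W, ∀ v w, R v w ↔ S (φ v) (φ w) := by
  have h1 : Set.range f = Set.range g := by
    ext x
    exact (hf.isAtom_iff x).symm.trans (hg.isAtom_iff x)
  let φ : V ≃ W := (Equiv.ofInjective f hf.injective).trans
    ((Equiv.setCongr h1).trans (Equiv.ofInjective g hg.injective).symm)
  have h2 : ∀ v, g (φ v) = f v := fun v => by
    exact Equiv.apply_ofInjective_symm hg.injective ((Equiv.setCongr h1) ⟨f v, v, rfl⟩)
  exact ⟨φ, fun v w => by rw [hf.rel, hg.rel, h2, h2]⟩

theorem IsAtomModel.ncard_vertices (hf : IsAtomModel f R) (h : IsCellularPseudomanifold M) :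
    (vertices M).ncard = Nat.card V := by
  have : vertices M = Set.range f := by
    ext x
    rw [h.mem_vertices, hf.isAtom_iff]
    rfl
  rw [this, ← Set.image_univ, Set.ncard_image_of_injective _ hf.injective, Set.ncard_univ]

theorem IsCellularPseudomanifold.isAtomModel (h : IsCellularPseudomanifold M) :
    IsAtomModel (fun v : vertices M => (v : M))
      (fun v w => ∃ σ, IsCoatom σ ∧ ¬ (v : M) ≤ σ ∧ ¬ (w : M) ≤ σ) where
  injective := Subtype.val_injective
  isAtom_iff x := by
    rw [← h.mem_vertices]
    exact ⟨fun hx => ⟨⟨x, hx⟩, rfl⟩, fun ⟨v, hv⟩ => hv ▸ v.2⟩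
  rel _ _ := Iff.rfl
  refl v := by
    have : ¬ (v : M) ≤ ⊥ := fun hh => (h.mem_vertices.1 v.2).1 (le_bot_iff.1 hh)
    obtain ⟨σ, h1, -, h2⟩ := h.exists_facet_of_not_le this
    exact ⟨σ, h1, h2, h2⟩

/-- A coatom of the direct product is full in one component, so vertices from different factors are
never missed together. -/
theorem IsAtomModel.prod (hf : IsAtomModel f R) (hg : IsAtomModel g S) :
    IsAtomModel (M := M × N) (Sum.elim (fun v => (f v, ⊥)) (fun w => (⊥, g w)))
      (sumRel R S False) := by
  have e1 : ∀ v, f v ≠ ⊥ := fun v => ((hf.isAtom_iff _).2 ⟨v, rfl⟩).1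
  have e2 : ∀ v, g v ≠ ⊥ := fun v => ((hg.isAtom_iff _).2 ⟨v, rfl⟩).1
  have key : ∀ (a : M) (b : N), IsAtom (a, b) ↔ (IsAtom a ∧ b = ⊥) ∨ (IsAtom b ∧ a = ⊥) := by
    intro a b
    rw [← bot_covBy_iff, show (⊥ : M × N) = (⊥, ⊥) from rfl, Prod.mk_covBy_mk_iff,
      bot_covBy_iff, bot_covBy_iff, eq_comm (b := b), eq_comm (b := a)]
  have key' : ∀ (a : M) (b : N), IsCoatom (a, b) ↔
      (IsCoatom a ∧ b = ⊤) ∨ (IsCoatom b ∧ a = ⊤) := by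
    intro a b
    rw [← covBy_top_iff, show (⊤ : M × N) = (⊤, ⊤) from rfl, Prod.mk_covBy_mk_iff,
      covBy_top_iff, covBy_top_iff]
  refine ⟨?_, fun x => ?_, ?_, ?_⟩
  · rintro (v | v) (w | w) hvw
    · exact congrArg _ (hf.injective (congrArg Prod.fst hvw))
    · exact absurd (congrArg Prod.fst hvw) (e1 v)
    · exact absurd (congrArg Prod.snd hvw) (e2 v)
    · exact congrArg _ (hg.injective (congrArg Prod.snd hvw))
  · constructor
    · intro hx
      obtain ⟨a, b⟩ := x
      rcases (key a b).1 hx with ⟨h1, rfl⟩ | ⟨h1, rfl⟩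
      · obtain ⟨v, rfl⟩ := (hf.isAtom_iff a).1 h1
        exact ⟨Sum.inl v, rfl⟩
      · obtain ⟨v, rfl⟩ := (hg.isAtom_iff b).1 h1
        exact ⟨Sum.inr v, rfl⟩
    · rintro ⟨v | v, rfl⟩
      · exact (key (f v) ⊥).2 (Or.inl ⟨(hf.isAtom_iff _).2 ⟨v, rfl⟩, rfl⟩)
      · exact (key ⊥ (g v)).2 (Or.inr ⟨(hg.isAtom_iff _).2 ⟨v, rfl⟩, rfl⟩)
  · have e : ∀ v w, sumRel R S False v w ↔ ∃ a b, ((IsCoatom a ∧ b = ⊤) ∨ (IsCoatom b ∧ a = ⊤)) ∧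
        ¬ (Sum.elim (fun v => (f v, (⊥ : N))) (fun w => ((⊥ : M), g w)) v ≤ (a, b)) ∧
        ¬ (Sum.elim (fun v => (f v, (⊥ : N))) (fun w => ((⊥ : M), g w)) w ≤ (a, b)) := by
      rintro (v | v) (w | w) <;> simp only [sumRel, Sum.elim_inl, Sum.elim_inr, Prod.mk_le_mk,
        bot_le, and_true, true_and]
      · rw [hf.rel]
        constructor
        · rintro ⟨σ, h1, h2⟩
          exact ⟨σ, ⊤, Or.inl ⟨h1, rfl⟩, h2⟩
        · rintro ⟨σ, τ, ⟨h1, -⟩ | ⟨-, rfl⟩, h2⟩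
          · exact ⟨σ, h1, h2⟩
          · exact absurd le_top h2.1
      · rw [false_iff]
        rintro ⟨σ, τ, ⟨-, rfl⟩ | ⟨-, rfl⟩, h2, h3⟩
        · exact h3 le_top
        · exact h2 le_top
      · rw [false_iff]
        rintro ⟨σ, τ, ⟨-, rfl⟩ | ⟨-, rfl⟩, h2, h3⟩
        · exact h2 le_top
        · exact h3 le_top
      · rw [hg.rel]
        constructor
        · rintro ⟨σ, h1, h2⟩
          exact ⟨⊤, σ, Or.inr ⟨h1, rfl⟩, h2⟩
        · rintro ⟨σ, τ, ⟨-, rfl⟩ | ⟨h1, -⟩, h2⟩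
          · exact absurd le_top h2.1
          · exact ⟨τ, h1, h2⟩
    intro v w
    rw [e]
    simp only [← key']
    exact ⟨fun ⟨a, b, hab⟩ => ⟨(a, b), hab⟩, fun ⟨⟨a, b⟩, hab⟩ => ⟨a, b, hab⟩⟩
  · rintro (v | v)
    exacts [hf.refl v, hg.refl v]

/-- A coatom of the join consists of a coatom in each component, chosen independently, so vertices
from different factors are always missed together. Reflexivity of the relations supplies the coatoms
of the other factor. -/
theorem IsAtomModel.join [Nontrivial M] [Nontrivial N] [Nonempty V] [Nonempty W]
    (hf : IsAtomModel f R) (hg : IsAtomModel g S) (hf' : ∀ v, f v < ⊤) (hg' : ∀ w, g w < ⊤) :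
    IsAtomModel (M := Join M N) (Sum.elim (fun v => Join.mk (f v) ⊥ (hf' v) bot_lt_top)
      (fun w => Join.mk ⊥ (g w) bot_lt_top (hg' w))) (sumRel R S True) := by
  have e1 : ∀ v, f v ≠ ⊥ := fun v => ((hf.isAtom_iff _).2 ⟨v, rfl⟩).1
  have e2 : ∀ v, g v ≠ ⊥ := fun v => ((hg.isAtom_iff _).2 ⟨v, rfl⟩).1
  have key : ∀ a b ha hb, IsAtom (Join.mk (M := M) (N := N) a b ha hb) ↔
      (IsAtom a ∧ b = ⊥) ∨ (IsAtom b ∧ a = ⊥) := by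
    intro a b ha hb
    rw [← bot_covBy_iff, ← Join.mk_eq_bot, Join.mk_covBy_mk, Prod.mk_covBy_mk_iff,
      bot_covBy_iff, bot_covBy_iff, eq_comm (b := b), eq_comm (b := a)]
  refine ⟨?_, fun x => ?_, ?_, ?_⟩
  · rintro (v | v) (w | w) hvw
    · exact congrArg _ (hf.injective (congrArg (fun p => p.1.1) hvw))
    · exact absurd (congrArg (fun p => p.1.1) hvw) (e1 v)
    · exact absurd (congrArg (fun p => p.1.2) hvw) (e2 v)
    · exact congrArg _ (hg.injective (congrArg (fun p => p.1.2) hvw))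
  · constructor
    · intro hx
      obtain rfl | ⟨a, b, ha, hb, rfl⟩ := Join.eq_top_or_mk x
      · obtain ⟨v⟩ := ‹Nonempty V›
        have h1 := hx.2 (Join.mk (f v) ⊥ (hf' v) bot_lt_top) Join.mk_lt_top
        rw [← Join.mk_eq_bot] at h1
        exact absurd (congrArg (fun p => p.1.1) h1) (e1 v)
      · rcases (key a b ha hb).1 hx with ⟨h1, rfl⟩ | ⟨h1, rfl⟩
        · obtain ⟨v, rfl⟩ := (hf.isAtom_iff a).1 h1
          exact ⟨Sum.inl v, rfl⟩
        · obtain ⟨v, rfl⟩ := (hg.isAtom_iff b).1 h1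
          exact ⟨Sum.inr v, rfl⟩
    · rintro ⟨v | v, rfl⟩
      · exact (key _ _ (hf' v) bot_lt_top).2 (Or.inl ⟨(hf.isAtom_iff _).2 ⟨v, rfl⟩, rfl⟩)
      · exact (key _ _ bot_lt_top (hg' v)).2 (Or.inr ⟨(hg.isAtom_iff _).2 ⟨v, rfl⟩, rfl⟩)
  · have hex : ∀ P : Join M N → Prop, (∃ σ, IsCoatom σ ∧ P σ) ↔
        ∃ a b ha hb, IsCoatom a ∧ IsCoatom b ∧ P (Join.mk a b ha hb) := by
      intro P
      constructor
      · rintro ⟨σ, h1, h2⟩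
        obtain rfl | ⟨a, b, ha, hb, rfl⟩ := Join.eq_top_or_mk σ
        · exact absurd rfl h1.1
        · exact ⟨a, b, ha, hb, (Join.isCoatom_mk.1 h1).1, (Join.isCoatom_mk.1 h1).2, h2⟩
      · rintro ⟨a, b, ha, hb, h1, h2, h3⟩
        exact ⟨_, Join.isCoatom_mk.2 ⟨h1, h2⟩, h3⟩
    intro v w
    rw [hex]
    rcases v with v | v <;> rcases w with w | w <;>
      simp only [sumRel, Sum.elim_inl, Sum.elim_inr, Join.mk_le_mk, bot_le, and_true, true_and]
    · rw [hf.rel]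
      obtain ⟨τ, hτ, -⟩ := (hg.rel _ _).1 (hg.refl (Classical.arbitrary W))
      constructor
      · rintro ⟨σ, h1, h2⟩
        exact ⟨σ, τ, lt_top_iff_ne_top.2 h1.1, lt_top_iff_ne_top.2 hτ.1, h1, hτ, h2⟩
      · rintro ⟨σ, _, -, -, h1, -, h2⟩
        exact ⟨σ, h1, h2⟩
    · rw [true_iff]
      obtain ⟨τ, hτ, h1, -⟩ := (hg.rel _ _).1 (hg.refl w)
      obtain ⟨σ, hσ, h2, -⟩ := (hf.rel _ _).1 (hf.refl v)
      exact ⟨σ, τ, lt_top_iff_ne_top.2 hσ.1, lt_top_iff_ne_top.2 hτ.1, hσ, hτ, h2, h1⟩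
    · rw [true_iff]
      obtain ⟨τ, hτ, h1, -⟩ := (hg.rel _ _).1 (hg.refl v)
      obtain ⟨σ, hσ, h2, -⟩ := (hf.rel _ _).1 (hf.refl w)
      exact ⟨σ, τ, lt_top_iff_ne_top.2 hσ.1, lt_top_iff_ne_top.2 hτ.1, hσ, hτ, h1, h2⟩
    · rw [hg.rel]
      obtain ⟨τ, hτ, -⟩ := (hf.rel _ _).1 (hf.refl (Classical.arbitrary V))
      constructor
      · rintro ⟨σ, h1, h2⟩
        exact ⟨τ, σ, lt_top_iff_ne_top.2 hτ.1, lt_top_iff_ne_top.2 h1.1, hτ, h1, h2⟩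
      · rintro ⟨_, σ, -, -, -, h1, h2⟩
        exact ⟨σ, h1, h2⟩
  · rintro (v | v)
    exacts [hf.refl v, hg.refl v]

end Model

/-! ### Boolean lattices -/

section Boolean

theorem rank_set {α : Type u} [Finite α] (s : Set α) : rank s = s.ncard := by
  refine rank_eq_of_grading _ (by simp) (fun s t hst => ?_) s
  obtain ⟨a, ha, rfl⟩ := Set.covBy_iff_exists_insert.1 hst
  exact Set.ncard_insert_of_notMem ha

/-- A Boolean lattice is a power of the two-element chain, and direct products stay in the class. -/
theorem isCellularPseudomanifold_set_fin (k : ℕ) : IsCellularPseudomanifold (Set (Fin k)) := by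
  induction k with
  | zero =>
    refine .of_grading rank (by simp [rank]) (fun x y hxy => ?_) (fun a b => ⟨a, ?_⟩)
      (fun x z hxz => ?_) (fun x z hxz => ?_)
    · exact absurd (Subsingleton.elim x y) hxy.ne
    · rw [Subsingleton.elim b a]
      exact isGLB_pair_self a
    · exact absurd (Subsingleton.elim x z) hxz.ne
    · exact absurd (Subsingleton.elim x z) hxz.ne
  | succ k ih =>
    have h1 : IsCellularPseudomanifold (Set (Fin 1)) := by
      have hle : ∀ s : Set (Fin 1), rank s ≤ 1 := fun s => by
        rw [rank_set]
        exact (Set.ncard_le_card s).trans (by simp)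
      refine .of_grading rank (by simp [rank]) (fun x y hxy => ?_) (fun a b => ⟨a ∩ b, ?_⟩)
        (fun x z hxz h => ?_) (fun x z hxz h => ?_)
      · obtain ⟨a, ha, rfl⟩ := Set.covBy_iff_exists_insert.1 hxy
        rw [rank_set, rank_set]
        exact Set.ncard_insert_of_notMem ha
      · exact isGLB_pair
      · have := hle z
        omega
      · have := hle z
        omega
    exact (ih.prod h1).of_orderIso ((finSumFinEquiv (m := k) (n := 1)).symm.toOrderIsoSet.trans
      Set.sumEquiv)

theorem isCellularPseudomanifold_set (α : Type u) [Finite α] :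
    IsCellularPseudomanifold (Set α) :=
  (isCellularPseudomanifold_set_fin (Nat.card α)).of_orderIso (Finite.equivFin α).toOrderIsoSet

theorem rank_set_top (α : Type u) [Finite α] : rank (⊤ : Set α) = Nat.card α := by
  rw [rank_set, Set.top_eq_univ, Set.ncard_univ]

end Boolean

end CPM

namespace CPM

/-! ### Pyramids and simplices -/

namespace IsCellularPseudomanifold

variable {M : Type u} [PartialOrder M] [BoundedOrder M] (h : IsCellularPseudomanifold M)

/-- The order embedding of a cellular pseudomanifold by shadows. -/
def shadowEmbedding : M ↪o Set M := OrderEmbedding.ofMapLEIff shadow fun _ _ => h.shadow_subset_iff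

include h

theorem shadow_bot : shadow (⊥ : M) = ∅ := by
  ext v
  simp only [shadow, Set.mem_ofPred_eq, le_bot_iff, Set.mem_empty_iff_false, iff_false, not_and]
  exact fun hv => (h.mem_vertices.1 hv).1

theorem shadow_ssubset {a b : M} (hab : a < b) : shadow a ⊂ shadow b :=
  h.shadowEmbedding.strictMono hab

theorem image_shadow_Iic {F : M} (X : Set.Iic F) :
    Subtype.val '' (shadow X) = shadow (X : M) := by
  ext v
  constructor
  · rintro ⟨w, ⟨h1, h2⟩, rfl⟩
    exact ⟨by rw [vertices, Set.mem_ofPred_eq, h.rank_Iic] at h1; exact h1, h2⟩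
  · rintro ⟨h1, h2⟩
    exact ⟨⟨v, h2.trans X.2⟩, ⟨by rw [vertices, Set.mem_ofPred_eq, h.rank_Iic]; exact h1, h2⟩, rfl⟩

theorem ncard_vertices_Iic (F : M) : (vertices (Set.Iic F)).ncard = (shadow F).ncard := by
  rw [← (h.Iic F).shadow_top, ← Set.ncard_image_of_injective _ Subtype.val_injective,
    h.image_shadow_Iic]
  rfl

theorem rank_top_Iic (F : M) : rank (⊤ : Set.Iic F) = rank F := h.rank_Iic _

theorem eq_of_shadow_subset_facet {F G : M} (hF : IsCoatom F) (hG : IsCoatom G)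
    (hs : shadow G ⊆ shadow F) : G = F :=
  h.eq_of_facet_le hG hF (h.shadow_subset_iff.1 hs)

theorem covBy_of_shadow_eq_sdiff_singleton {R F c : M} (hR : shadow R = shadow F \ {c})
    (hc : c ∈ shadow F) : R ⋖ F := by
  have hRF : R ≤ F := h.shadow_subset_iff.1 (hR ▸ Set.sdiff_subset)
  refine ⟨lt_of_le_of_ne hRF ?_, fun y h1 h2 => ?_⟩
  · rintro rfl
    rw [hR] at hc
    exact hc.2 rfl
  · have e1 := Set.ncard_lt_ncard (h.shadow_ssubset h1) (h.finite_set _)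
    have e2 := Set.ncard_lt_ncard (h.shadow_ssubset h2) (h.finite_set _)
    have e3 := Set.ncard_sdiff_singleton_add_one hc (h.finite_set _)
    rw [← hR] at e3
    omega

/-- If the facet `F` contains all vertices but `v`, then coning with `v` maps faces of `F` to
faces. -/
theorem exists_shadow_eq_insert {F v : M} (hF : IsCoatom F)
    (hvF : shadow F = vertices M \ {v}) (hv : v ∈ vertices M) {X : M} (hX : X ≤ F) :
    ∃ m : M, shadow m = insert v (shadow X) := by
  obtain ⟨m, hm⟩ := h.exists_shadow_eq fun G => IsCoatom G ∧ X ≤ G ∧ v ≤ G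
  refine ⟨m, hm.trans ?_⟩
  ext w
  simp only [Set.mem_ofPred_eq, Set.mem_insert_iff]
  constructor
  · rintro ⟨h1, h2⟩
    by_contra hc
    push Not at hc
    obtain ⟨G, hG, hXG, hwG⟩ := h.exists_facet_of_not_le (a := w) (b := X) fun hw => hc.2 ⟨h1, hw⟩
    by_cases hvG : v ≤ G
    · exact hwG (h2 G ⟨hG, hXG, hvG⟩)
    -- A facet avoiding `v` has its shadow inside that of `F`, hence is `F`; but `F` contains `w`.
    · have : G = F := h.eq_of_shadow_subset_facet hF hG fun x hx => by
        rw [hvF]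
        refine ⟨hx.1, ?_⟩
        rintro rfl
        exact hvG hx.2
      subst this
      have : w ∈ shadow G := hvF ▸ ⟨h1, hc.1⟩
      exact hwG this.2
  · rintro (rfl | h1)
    · exact ⟨hv, fun G hG => hG.2.2⟩
    · exact ⟨h1.1, fun G hG => h1.2.trans hG.2.1⟩

/-- A face corresponds to its meet with `F` together with the answer to whether it contains the apex
`v`. Coning shows that all combinations occur. -/
theorem nonempty_iso_pyramid {F v : M} (hF : IsCoatom F)
    (hvF : shadow F = vertices M \ {v}) (hv : v ∈ vertices M) :
    Nonempty (M ≃o Set.Iic F × Set Unit) := by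
  have hnot : ∀ X : Set.Iic F, v ∉ shadow (X : M) := fun X hX => by
    have : v ∈ shadow F := ⟨hv, hX.2.trans X.2⟩
    rw [hvF] at this
    exact this.2 rfl
  let g : Set.Iic F × Set Unit ↪o Set M := OrderEmbedding.ofMapLEIff
    (fun p => shadow (p.1 : M) ∪ {w | w = v ∧ () ∈ p.2}) (by
      rintro ⟨X, s⟩ ⟨Y, t⟩
      constructor
      · intro hs
        refine ⟨h.shadow_subset_iff.1 fun w hw => ?_, fun x hx => ?_⟩
        · rcases hs (Or.inl hw) with h1 | h1
          · exact h1
          · exact absurd (h1.1 ▸ hw) (hnot X)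
        · rcases hs (show v ∈ _ from Or.inr ⟨rfl, hx⟩) with h1 | h1
          · exact absurd h1 (hnot Y)
          · exact h1.2
      · rintro ⟨h1, h2⟩ w (hw | hw)
        · exact Or.inl (h.shadow_subset_iff.2 h1 hw)
        · exact Or.inr ⟨hw.1, h2 hw.2⟩)
  refine nonempty_orderIso_of_range h.shadowEmbedding g (Set.Subset.antisymm ?_ ?_)
  · rintro _ ⟨m, rfl⟩
    obtain ⟨X, hX⟩ := h.exists_inf₂ m F
    refine ⟨(⟨X, ((hX X).1 le_rfl).2⟩, {x | v ≤ m}), ?_⟩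
    change shadow X ∪ {w | w = v ∧ v ≤ m} = shadow m
    ext w
    simp only [shadow, Set.mem_union, Set.mem_ofPred_eq, hX]
    constructor
    · rintro (⟨h1, h2, -⟩ | ⟨rfl, h1⟩)
      exacts [⟨h1, h2⟩, ⟨hv, h1⟩]
    · rintro ⟨h1, h2⟩
      by_cases hw : w = v
      · exact Or.inr ⟨hw, hw ▸ h2⟩
      · have : w ∈ shadow F := hvF ▸ ⟨h1, hw⟩
        exact Or.inl ⟨h1, h2, this.2⟩
  · rintro _ ⟨⟨X, s⟩, rfl⟩
    by_cases hs : () ∈ s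
    · obtain ⟨m, hm⟩ := h.exists_shadow_eq_insert hF hvF hv X.2
      refine ⟨m, hm.trans ?_⟩
      ext w
      simp [g, hs]
    · refine ⟨X, ?_⟩
      change shadow (X : M) = shadow (X : M) ∪ {w | w = v ∧ () ∈ s}
      simp [hs]

omit h in
-- Counting shows that a facet misses exactly one vertex and again has excess zero. Induction
-- provides all vertex sets inside the facet, and coning those through the missed vertex.
theorem exists_shadow_eq_of_excess_zero (k : ℕ) : ∀ {M : Type u} [PartialOrder M] [BoundedOrder M],
    IsCellularPseudomanifold M → rank (⊤ : M) = k → (vertices M).ncard = k →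
    ∀ X ⊆ vertices M, ∃ m : M, shadow m = X := by
  induction k with
  | zero =>
    intro M _ _ h hr hn X hX
    rw [Set.ncard_eq_zero (h.finite_set _)] at hn
    refine ⟨⊥, ?_⟩
    rw [h.shadow_bot]
    exact (Set.subset_empty_iff.1 (hn ▸ hX)).symm
  | succ k ih =>
    intro M _ _ h hr hn X hX
    have hbt : (⊥ : M) ≠ ⊤ := fun hh => by
      rw [← hh, h.rank_bot] at hr
      omega
    obtain ⟨F, hF, -⟩ := h.exists_facet_ge hbt
    have hrF := h.rank_facet hF
    have h1 := h.rank_le_ncard_shadow F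
    have h2 := h.shadow_ssubset (lt_top_iff_ne_top.2 hF.1)
    rw [h.shadow_top] at h2
    have h3 := Set.ncard_lt_ncard h2 (h.finite_set _)
    have h4 := Set.ncard_sdiff_add_ncard_of_subset h2.subset (h.finite_set _)
    obtain ⟨v, hv⟩ := Set.ncard_eq_one.1 (show (vertices M \ shadow F).ncard = 1 by omega)
    have hvV : v ∈ vertices M := (hv.symm ▸ Set.mem_singleton v : v ∈ vertices M \ shadow F).1
    have hvF : shadow F = vertices M \ {v} := by
      rw [← hv, Set.sdiff_sdiff_cancel_left h2.subset]
    obtain ⟨Y, hY⟩ := ih (h.Iic F) (by rw [h.rank_top_Iic]; omega)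
      (by rw [h.ncard_vertices_Iic]; omega)
      (Subtype.val ⁻¹' (X \ {v})) (fun w hw => by
        rw [vertices, Set.mem_ofPred_eq, h.rank_Iic]
        exact hX hw.1)
    have hY' : shadow (Y : M) = X \ {v} := by
      rw [← h.image_shadow_Iic, hY, Subtype.image_preimage_coe, Set.inter_eq_right]
      intro w hw
      have : w ∈ shadow F := hvF ▸ ⟨hX hw.1, hw.2⟩
      exact this.2
    by_cases hvX : v ∈ X
    · obtain ⟨m, hm⟩ := h.exists_shadow_eq_insert hF hvF hvV Y.2
      exact ⟨m, by rw [hm, hY', Set.insert_sdiff_singleton, Set.insert_eq_of_mem hvX]⟩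
    · exact ⟨Y, by rw [hY', Set.sdiff_singleton_eq_self hvX]⟩

/-- All sets of vertices of a face of excess zero are shadows. -/
theorem exists_shadow_eq_of_simplex {F : M} (hF : (shadow F).ncard = rank F) {X : Set M}
    (hX : X ⊆ shadow F) : ∃ m : M, shadow m = X := by
  obtain ⟨Y, hY⟩ := exists_shadow_eq_of_excess_zero (rank F) (h.Iic F) (h.rank_top_Iic F)
    (by rw [h.ncard_vertices_Iic, hF]) (Subtype.val ⁻¹' X) (fun w hw => by
        rw [vertices, Set.mem_ofPred_eq, h.rank_Iic]
        exact (hX hw).1)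
  refine ⟨Y, ?_⟩
  rw [← h.image_shadow_Iic, hY, Subtype.image_preimage_coe, Set.inter_eq_right]
  exact fun w hw => (hX hw).2

end IsCellularPseudomanifold

end CPM

namespace CPM

/-! ### Excess one -/

namespace IsCellularPseudomanifold

variable {M : Type u} [PartialOrder M] [BoundedOrder M]

/-- `u` and `w` are distinct vertices and are the only vertices outside some facet. -/
def MissedPair (u w : M) : Prop :=
  u ≠ w ∧ u ∈ vertices M ∧ w ∈ vertices M ∧ ∃ F, IsCoatom F ∧ shadow F = vertices M \ {u, w}

theorem MissedPair.symm {u w : M} (h : MissedPair u w) : MissedPair w u :=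
  ⟨h.1.symm, h.2.2.1, h.2.1, by simpa only [Set.pair_comm] using h.2.2.2⟩

theorem not_missedPair_self (u : M) : ¬ MissedPair u u := fun h => h.1 rfl

variable (h : IsCellularPseudomanifold M)

include h

section Simplicial

variable (hn : (vertices M).ncard = rank (⊤ : M) + 1)
  (hF : ∀ F : M, IsCoatom F → (shadow F).ncard = rank F)
include hn hF

theorem exists_missedPair {F : M} (hc : IsCoatom F) :
    ∃ u w, MissedPair u w ∧ shadow F = vertices M \ {u, w} := by
  have h1 := hF F hc
  have h2 := h.rank_facet hc
  have h3 : shadow F ⊆ vertices M := fun v hv => hv.1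
  have h4 := Set.ncard_sdiff_add_ncard_of_subset h3 (h.finite_set _)
  obtain ⟨u, w, huw, hs⟩ := Set.ncard_eq_two.1 (show (vertices M \ shadow F).ncard = 2 by omega)
  have hu : u ∈ vertices M \ shadow F := hs ▸ Set.mem_insert _ _
  have hw : w ∈ vertices M \ shadow F := hs ▸ Set.mem_insert_of_mem _ rfl
  have e : shadow F = vertices M \ {u, w} := by
    rw [← hs, Set.sdiff_sdiff_cancel_left h3]
  exact ⟨u, w, ⟨huw, hu.1, hw.1, F, hc, e⟩, e⟩

/-- Removing `c` from the simplex missing `{u, w}` leaves a face of corank two whose complement is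
`{u, w, c}`. The facets above it are those missing a pair inside this triple, and there are exactly
two. -/
theorem missedPair_xor {u w c : M} (huw : MissedPair u w) (hc : c ∈ vertices M) (hcu : c ≠ u)
    (hcw : c ≠ w) : (MissedPair u c ∨ MissedPair w c) ∧ ¬ (MissedPair u c ∧ MissedPair w c) := by
  obtain ⟨hne, hu, hw, F, hFc, hFs⟩ := huw
  have hcF : c ∈ shadow F := by
    rw [hFs]
    exact ⟨hc, by simp [hcu, hcw]⟩
  have hsub : shadow F \ {c} ⊆ shadow F := Set.sdiff_subset
  obtain ⟨R, hR⟩ := h.exists_shadow_eq_of_simplex (hF F hFc) hsub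
  have hRF : R ≤ F := h.shadow_subset_iff.1 (hR ▸ hsub)
  have hrF := h.rank_facet hFc
  have hcov : R ⋖ F := h.covBy_of_shadow_eq_sdiff_singleton hR hcF
  have hrR : rank R + 2 = rank (⊤ : M) := by
    have := h.ranked _ _ hcov
    omega
  have hRs : shadow R = vertices M \ {u, w, c} := by
    rw [hR, hFs, Set.sdiff_sdiff]
    congr 1
    ext x
    simp only [Set.mem_union, Set.mem_insert_iff, Set.mem_singleton_iff]
    tauto
  constructor
  · have hG : ∃ G, IsCoatom G ∧ R ≤ G ∧ G ≠ F := by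
      obtain ⟨a, b, hab, hs⟩ := h.exists_facet_pair hrR
      have ha := (hs a).2 (Or.inl rfl)
      have hb := (hs b).2 (Or.inr rfl)
      by_cases haF : a = F
      · exact ⟨b, hb.1, hb.2, fun hbF => hab (haF.trans hbF.symm)⟩
      · exact ⟨a, ha.1, ha.2, haF⟩
    obtain ⟨G, hGc, hRG, hGF⟩ := hG
    obtain ⟨p, q, hpq, hGs⟩ := h.exists_missedPair hn hF hGc
    have hsub : shadow R ⊆ shadow G := h.shadow_subset_iff.2 hRG
    have key : ∀ x ∈ vertices M, x = p ∨ x = q → x = u ∨ x = w ∨ x = c := by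
      intro x hx hxp
      by_contra hcon
      have : x ∈ shadow R := by
        rw [hRs]
        exact ⟨hx, by simpa using hcon⟩
      have h2 := hsub this
      rw [hGs] at h2
      exact h2.2 (by simpa using hxp)
    have hp := key p hpq.2.1 (Or.inl rfl)
    have hq := key q hpq.2.2.1 (Or.inr rfl)
    have hne' : ¬ ((p = u ∧ q = w) ∨ (p = w ∧ q = u)) := by
      intro hh
      refine hGF (h.shadow_injective ?_)
      rw [hGs, hFs]
      rcases hh with ⟨rfl, rfl⟩ | ⟨rfl, rfl⟩
      · rfl
      · rw [Set.pair_comm]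
    have hpq' := hpq.1
    rcases hp with rfl | rfl | rfl <;> rcases hq with rfl | rfl | rfl
    · exact absurd rfl hpq'
    · exact absurd (Or.inl ⟨rfl, rfl⟩) hne'
    · exact Or.inl hpq
    · exact absurd (Or.inr ⟨rfl, rfl⟩) hne'
    · exact absurd rfl hpq'
    · exact Or.inr hpq
    · exact Or.inl hpq.symm
    · exact Or.inr hpq.symm
    · exact absurd rfl hpq'
  · rintro ⟨⟨-, -, -, G, hGc, hGs⟩, -, -, -, G', hGc', hGs'⟩
    have hle : ∀ K : M, ∀ x y, shadow K = vertices M \ {x, y} → (x = u ∨ x = w ∨ x = c) →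
        (y = u ∨ y = w ∨ y = c) → R ≤ K := by
      intro K x y hK hx hy
      refine h.shadow_subset_iff.1 ?_
      rw [hRs, hK]
      refine Set.sdiff_subset_sdiff_right ?_
      rintro z (rfl | rfl)
      · simpa using hx
      · simpa using hy
    have hmem : ∀ {K : M} {x y z}, shadow K = vertices M \ {x, y} → z ∈ vertices M →
        (z ∈ shadow K ↔ ¬ (z = x ∨ z = y)) := by
      intro K x y z hK hz
      rw [hK]
      simp [hz]
    refine h.not_three_facets hrR hFc hGc hGc' hRF (hle G _ _ hGs (Or.inl rfl) (by simp))
      (hle G' _ _ hGs' (by simp) (by simp)) ?_ ?_ ?_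
    · rintro rfl
      exact (hmem hGs hc).1 hcF (Or.inr rfl)
    · rintro rfl
      exact (hmem hGs' hc).1 hcF (Or.inr rfl)
    · rintro rfl
      have h1 := (hmem hGs' hu).2 (by simp [hne, hcu.symm])
      exact (hmem hGs hu).1 h1 (Or.inl rfl)

/-- The parts are the neighbourhoods of the two ends of one edge `u w`. By `missedPair_xor` they
partition the vertices, there are no triangles, and an edge from `u` to `a` together with a vertex
`b` not adjacent to `u` forces the edge `a b`. -/
theorem exists_bipartition (hbt : (⊥ : M) ≠ ⊤) : ∃ A B : Set M, Disjoint A B ∧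
    A ∪ B = vertices M ∧ A.Nonempty ∧ B.Nonempty ∧
    ∀ x y, MissedPair x y ↔ (x ∈ A ∧ y ∈ B) ∨ (x ∈ B ∧ y ∈ A) := by
  have hD := fun {u w c} => h.missedPair_xor hn hF (u := u) (w := w) (c := c)
  obtain ⟨F, hFc, -⟩ := h.exists_facet_ge hbt
  obtain ⟨u, w, huw, -⟩ := h.exists_missedPair hn hF hFc
  have hself := not_missedPair_self (M := M)
  have hcov : ∀ x ∈ vertices M, (MissedPair u x ∨ MissedPair w x) ∧
      ¬ (MissedPair u x ∧ MissedPair w x) := by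
    intro x hx
    by_cases hxu : x = u
    · subst hxu
      exact ⟨Or.inr huw.symm, fun hh => hself _ hh.1⟩
    by_cases hxw : x = w
    · subst hxw
      exact ⟨Or.inl huw, fun hh => hself _ hh.2⟩
    exact hD huw hx hxu hxw
  have hind : ∀ {p a b : M}, MissedPair p a → MissedPair p b → ¬ MissedPair a b := by
    intro p a b ha hb hab
    exact (hD hab ha.2.1 ha.1 hb.1).2 ⟨ha.symm, hb.symm⟩
  have hcross : ∀ a b, MissedPair u a → MissedPair w b → MissedPair a b := by
    intro a b ha hb
    by_cases hbu : b = u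
    · subst hbu
      exact ha.symm
    have hba : b ≠ a := by
      rintro rfl
      exact (hcov b ha.2.2.1).2 ⟨ha, hb⟩
    rcases (hD ha hb.2.2.1 hbu hba).1 with h1 | h1
    · exact absurd ⟨h1, hb⟩ (hcov b hb.2.2.1).2
    · exact h1
  refine ⟨{x | MissedPair u x}, {x | MissedPair w x}, ?_, ?_, ⟨w, huw⟩, ⟨u, huw.symm⟩, ?_⟩
  · rw [Set.disjoint_left]
    exact fun x hx hx' => (hcov x hx.2.2.1).2 ⟨hx, hx'⟩
  · ext x
    refine ⟨?_, fun hx => (hcov x hx).1⟩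
    rintro (hx | hx)
    exacts [hx.2.2.1, hx.2.2.1]
  · intro x y
    constructor
    · intro hxy
      rcases (hcov x hxy.2.1).1 with h1 | h1 <;> rcases (hcov y hxy.2.2.1).1 with h2 | h2
      · exact absurd hxy (hind h1 h2)
      · exact Or.inl ⟨h1, h2⟩
      · exact Or.inr ⟨h1, h2⟩
      · exact absurd hxy (hind h1 h2)
    · rintro (⟨h1, h2⟩ | ⟨h1, h2⟩)
      · exact hcross x y h1 h2
      · exact (hcross y x h2 h1).symm

/-- The facets are the complements of pairs with one vertex in each part, and all of them are
simplices. So the proper faces are the vertex sets that omit something from each part, as in the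
join of two Boolean lattices. -/
theorem nonempty_iso_join_of_simplicial (hbt : (⊥ : M) ≠ ⊤) : ∃ a b : ℕ, 2 ≤ a ∧ 2 ≤ b ∧
    Nonempty (M ≃o Join (Set (Fin a)) (Set (Fin b))) := by
  obtain ⟨A, B, hdis, hun, hA, hB, hE⟩ := h.exists_bipartition hn hF hbt
  have hfin := h.finite
  have hmissed : ∀ {F : M}, IsCoatom F → ∃ a ∈ A, ∃ b ∈ B, shadow F = vertices M \ {a, b} := by
    intro F hc
    obtain ⟨p, q, hpq, hs⟩ := h.exists_missedPair hn hF hc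
    rcases (hE p q).1 hpq with ⟨h1, h2⟩ | ⟨h1, h2⟩
    · exact ⟨p, h1, q, h2, hs⟩
    · exact ⟨q, h2, p, h1, by rw [hs, Set.pair_comm]⟩
  have htop : ∀ v ∈ vertices M, v ≠ ⊤ := by
    rintro v hv rfl
    obtain ⟨a, ha⟩ := hA
    obtain ⟨b, hb⟩ := hB
    have haV : a ∈ vertices M := hun ▸ Or.inl ha
    have hbV : b ∈ vertices M := hun ▸ Or.inr hb
    have ea : a = ⊤ := h.eq_of_le_of_rank_le le_top (by rw [show rank a = 1 from haV]; exact hv.le)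
    have eb : b = ⊤ := h.eq_of_le_of_rank_le le_top (by rw [show rank b = 1 from hbV]; exact hv.le)
    exact Set.disjoint_left.1 hdis ha (ea.trans eb.symm ▸ hb)
  -- A facet through a vertex of the part misses another vertex of the same part.
  have hA2 : 2 ≤ Nat.card A := by
    obtain ⟨w, hw⟩ := hA
    have hwV : w ∈ vertices M := hun ▸ Or.inl hw
    obtain ⟨F, hc, hwF⟩ := h.exists_facet_ge (htop w hwV)
    obtain ⟨a, ha, b, hb, hs⟩ := hmissed hc
    have hwF' : w ∈ shadow F := ⟨hwV, hwF⟩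
    rw [hs] at hwF'
    exact (Set.one_lt_ncard (h.finite_set _)).2 ⟨w, hw, a, ha, fun e => hwF'.2 (Or.inl e)⟩
  have hB2 : 2 ≤ Nat.card B := by
    obtain ⟨w, hw⟩ := hB
    have hwV : w ∈ vertices M := hun ▸ Or.inr hw
    obtain ⟨F, hc, hwF⟩ := h.exists_facet_ge (htop w hwV)
    obtain ⟨a, ha, b, hb, hs⟩ := hmissed hc
    have hwF' : w ∈ shadow F := ⟨hwV, hwF⟩
    rw [hs] at hwF'
    exact (Set.one_lt_ncard (h.finite_set _)).2 ⟨w, hw, b, hb, fun e => hwF'.2 (Or.inr e)⟩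
  refine ⟨Nat.card A, Nat.card B, hA2, hB2, ?_⟩
  let g : Join (Set A) (Set B) ↪o Set M := OrderEmbedding.ofMapLEIff
    (fun p => Subtype.val '' p.1.1 ∪ Subtype.val '' p.1.2) (by
      rintro ⟨⟨S, T⟩, h1⟩ ⟨⟨S', T'⟩, h2⟩
      constructor
      · intro hs
        refine ⟨fun x hx => ?_, fun x hx => ?_⟩
        · rcases hs (Or.inl ⟨x, hx, rfl⟩) with ⟨y, hy, hxy⟩ | ⟨y, hy, hxy⟩
          · exact Subtype.ext hxy ▸ hy
          · exact absurd y.2 (hxy ▸ Set.disjoint_left.1 hdis x.2)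
        · rcases hs (Or.inr ⟨x, hx, rfl⟩) with ⟨y, hy, hxy⟩ | ⟨y, hy, hxy⟩
          · exact absurd x.2 (hxy ▸ Set.disjoint_left.1 hdis y.2)
          · exact Subtype.ext hxy ▸ hy
      · rintro ⟨h3, h4⟩
        exact Set.union_subset_union (Set.image_mono h3) (Set.image_mono h4))
  have key : Nonempty (M ≃o Join (Set A) (Set B)) := by
    refine nonempty_orderIso_of_range h.shadowEmbedding g (Set.Subset.antisymm ?_ ?_)
    · rintro _ ⟨m, rfl⟩
      have hsm : Subtype.val '' (Subtype.val ⁻¹' shadow m : Set A) ∪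
          Subtype.val '' (Subtype.val ⁻¹' shadow m : Set B) = shadow m := by
        rw [Subtype.image_preimage_coe, Subtype.image_preimage_coe, ← Set.union_inter_distrib_right,
          hun, Set.inter_eq_right]
        exact fun v hv => hv.1
      by_cases hm : m = ⊤
      · subst hm
        refine ⟨⟨(Subtype.val ⁻¹' shadow (⊤ : M), Subtype.val ⁻¹' shadow (⊤ : M)),
          Or.inr ⟨?_, ?_⟩⟩, hsm⟩
        · rw [h.shadow_top, Set.top_eq_univ, Set.eq_univ_iff_forall]
          exact fun x => hun ▸ Or.inl x.2
        · rw [h.shadow_top, Set.top_eq_univ, Set.eq_univ_iff_forall]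
          exact fun x => hun ▸ Or.inr x.2
      · obtain ⟨F, hc, hmF⟩ := h.exists_facet_ge hm
        obtain ⟨a, ha, b, hb, hs⟩ := hmissed hc
        have hsub := h.shadow_subset_iff.2 hmF
        rw [hs] at hsub
        refine ⟨⟨(Subtype.val ⁻¹' shadow m, Subtype.val ⁻¹' shadow m), Or.inl ⟨?_, ?_⟩⟩, hsm⟩
        · rw [lt_top_iff_ne_top, Set.top_eq_univ, Set.ne_univ_iff_exists_notMem]
          exact ⟨⟨a, ha⟩, fun hx => (hsub hx).2 (Or.inl rfl)⟩
        · rw [lt_top_iff_ne_top, Set.top_eq_univ, Set.ne_univ_iff_exists_notMem]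
          exact ⟨⟨b, hb⟩, fun hx => (hsub hx).2 (Or.inr rfl)⟩
    · rintro _ ⟨⟨⟨S, T⟩, ⟨h1, h2⟩ | ⟨h1, h2⟩⟩, rfl⟩
      · simp only at h1 h2
        rw [lt_top_iff_ne_top, Set.top_eq_univ, Set.ne_univ_iff_exists_notMem] at h1 h2
        obtain ⟨a, ha⟩ := h1
        obtain ⟨b, hb⟩ := h2
        obtain ⟨-, -, -, F, hFc, hFs⟩ := (hE a b).2 (Or.inl ⟨a.2, b.2⟩)
        refine h.exists_shadow_eq_of_simplex (hF F hFc) ?_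
        rw [hFs]
        rintro x (⟨y, hy, rfl⟩ | ⟨y, hy, rfl⟩)
        · refine ⟨hun ▸ Or.inl y.2, ?_⟩
          rintro (e | e)
          · exact ha (Subtype.ext e ▸ hy)
          · exact Set.disjoint_left.1 hdis y.2 (e ▸ b.2)
        · refine ⟨hun ▸ Or.inr y.2, ?_⟩
          rintro (e | e)
          · exact Set.disjoint_left.1 hdis a.2 (e ▸ y.2)
          · exact hb (Subtype.ext e ▸ hy)
      · simp only at h1 h2
        subst h1 h2
        refine ⟨⊤, h.shadow_top.trans ?_⟩
        change _ = Subtype.val '' (Set.univ : Set A) ∪ Subtype.val '' (Set.univ : Set B)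
        rw [Set.image_univ, Set.image_univ, Subtype.range_coe, Subtype.range_coe, hun]
  obtain ⟨e⟩ := key
  exact ⟨e.trans (Join.congr (Finite.equivFin A).toOrderIsoSet (Finite.equivFin B).toOrderIsoSet)⟩

end Simplicial

omit h in
/-- Cellular pseudomanifolds of excess one are iterated pyramids over joins of two standard
spheres. -/
theorem nonempty_iso_of_excess_one (k : ℕ) : ∀ {M : Type u} [PartialOrder M] [BoundedOrder M],
    IsCellularPseudomanifold M → rank (⊤ : M) = k → (vertices M).ncard = k + 1 →
    ∃ a b c : ℕ, 2 ≤ a ∧ 2 ≤ b ∧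
      Nonempty (M ≃o Join (Set (Fin a)) (Set (Fin b)) × Set (Fin c)) := by
  induction k with
  | zero =>
    intro M _ _ h hr hn
    obtain ⟨v, hv⟩ := Set.ncard_eq_one.1 hn
    have hv' : rank v = 1 := (hv ▸ Set.mem_singleton v : v ∈ vertices M)
    have := h.rank_mono (le_top (a := v))
    omega
  | succ k ih =>
    intro M _ _ h hr hn
    have hbt : (⊥ : M) ≠ ⊤ := fun hh => by
      rw [← hh, h.rank_bot] at hr
      omega
    -- A facet has rank `k` and either `k` or `k + 1` vertices. In the latter case it misses one
    -- vertex and has excess one; if this never happens, all facets are simplices.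
    by_cases hex : ∃ F : M, IsCoatom F ∧ (shadow F).ncard = k + 1
    · obtain ⟨F, hF, hFn⟩ := hex
      have hrF := h.rank_facet hF
      have hsub : shadow F ⊆ vertices M := fun v hv => hv.1
      have h4 := Set.ncard_sdiff_add_ncard_of_subset hsub (h.finite_set _)
      obtain ⟨v, hv⟩ := Set.ncard_eq_one.1 (show (vertices M \ shadow F).ncard = 1 by omega)
      have hvV : v ∈ vertices M := (hv.symm ▸ Set.mem_singleton v : v ∈ vertices M \ shadow F).1
      have hvF : shadow F = vertices M \ {v} := by
        rw [← hv, Set.sdiff_sdiff_cancel_left hsub]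
      obtain ⟨a, b, c, ha, hb, ⟨e⟩⟩ := ih (h.Iic F) (by rw [h.rank_top_Iic]; omega)
        (by rw [h.ncard_vertices_Iic]; exact hFn)
      obtain ⟨e'⟩ := h.nonempty_iso_pyramid hF hvF hvV
      have e1 : Fin c ⊕ Unit ≃ Fin (c + 1) := Finite.equivFinOfCardEq (by simp)
      refine ⟨a, b, c + 1, ha, hb, ⟨e'.trans ((prodCongr e (OrderIso.refl _)).trans
        ((OrderIso.prodAssoc _ _ _).trans (prodCongr (OrderIso.refl _) ?_)))⟩⟩
      exact Set.sumEquiv.symm.trans e1.toOrderIsoSet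
    · push Not at hex
      obtain ⟨a, b, ha, hb, ⟨e⟩⟩ := h.nonempty_iso_join_of_simplicial (by omega) (fun F hF => by
        have h1 := h.rank_facet hF
        have h2 := h.rank_le_ncard_shadow F
        have h3 := hex F hF
        have h4 := h.shadow_ssubset (lt_top_iff_ne_top.2 hF.1)
        rw [h.shadow_top] at h4
        have h5 := Set.ncard_lt_ncard h4 (h.finite_set _)
        omega) hbt
      exact ⟨a, b, 0, ha, hb, ⟨e.trans (prodSetEmpty _ _)⟩⟩

end IsCellularPseudomanifold

end CPM

namespace CPM

/-! ### Reducible pseudomanifolds: the exchange argument -/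

section VertexEquiv

variable {L : Type u} [PartialOrder L]

theorem VertexEquiv.exists_swap {x c a : L} (hx : x ∈ vertices L) (hc : c ∈ vertices L)
    (ha : a ∈ vertices L)
    (hxc : VertexEquiv x c) (hxa : VertexEquiv x a) (hca : c ≠ a) :
    ∃ φ : L ≃o L, φ c = a ∧ φ a = c ∧ ∀ w ∈ vertices L, w ≠ c → w ≠ a → φ w = w := by
  rcases hxc with rfl | ⟨φ, h1, h2, h3⟩
  · exact hxa.resolve_left hca
  rcases hxa with rfl | ⟨ψ, h4, h5, h6⟩
  · exact ⟨φ, h2, h1, fun w hw e1 e2 => h3 w hw e2 e1⟩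
  by_cases hcx : c = x
  · subst hcx
    exact ⟨ψ, h4, h5, h6⟩
  by_cases hax : a = x
  · subst hax
    exact ⟨φ, h2, h1, fun w hw e1 e2 => h3 w hw e2 e1⟩
  -- Conjugation: `(c a) = (x c)(x a)(x c)`.
  refine ⟨φ.trans (ψ.trans φ), ?_, ?_, fun w hw e1 e2 => ?_⟩
  · simp [h2, h4, h3 a ha hax hca.symm]
  · simp [h3 a ha hax hca.symm, h5, h1]
  · by_cases hwx : w = x
    · subst hwx
      simp [h1, h6 c hc hcx hca, h2]
    · simp [h3 w hw hwx e1, h6 w hw hwx e2]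

end VertexEquiv

namespace IsCellularPseudomanifold

variable {M : Type u} [PartialOrder M] [BoundedOrder M]

/-- The automorphism transposing `c` and `a` carries the facet `F` to the required one. The join
decomposition uses the automorphisms only through this exchange property. -/
theorem exists_exchange {x F c a : M} (hx : x ∈ vertices M) (hF : IsCoatom F)
    (hc : c ∈ vertexClass x) (hcF : c ≤ F) (ha : a ∈ vertexClass x) (haF : ¬ a ≤ F) :
    ∃ F', IsCoatom F' ∧ shadow F' = insert a (shadow F \ {c}) := by
  have hca : c ≠ a := by
    rintro rfl
    exact haF hcF
  obtain ⟨φ, h1, h2, h3⟩ := VertexEquiv.exists_swap hx hc.1 ha.1 hc.2 ha.2 hca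
  refine ⟨φ F, (φ.isCoatom_iff F).2 hF, ?_⟩
  ext v
  simp only [shadow, Set.mem_ofPred_eq, Set.mem_insert_iff, Set.mem_sdiff, Set.mem_singleton_iff]
  by_cases hva : v = a
  · subst hva
    simp only [true_or, iff_true]
    exact ⟨ha.1, by rw [← h1]; exact φ.monotone hcF⟩
  by_cases hvc : v = c
  · subst hvc
    simp only [hva, not_true_eq_false, and_false, or_self, iff_false, not_and]
    intro _ hh
    rw [← h2, φ.le_iff_le] at hh
    exact haF hh
  simp only [hva, hvc, false_or, not_false_eq_true, and_true]
  refine and_congr_right fun hv => ?_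
  conv_lhs => rw [← h3 v hv hvc hva, φ.le_iff_le]

variable (h : IsCellularPseudomanifold M)
include h

section Exchange

variable {A : Set M} (hAV : A ⊆ vertices M)
  (hE : ∀ F c a : M, IsCoatom F → c ∈ A → c ≤ F → a ∈ A → ¬ a ≤ F →
    ∃ F', IsCoatom F' ∧ shadow F' = insert a (shadow F \ {c}))
  (hmiss : ∀ F : M, IsCoatom F → ∃ a ∈ A, ¬ a ≤ F)
include hAV hE

omit hE in
-- The face is the meet of the two facets; it has one vertex fewer than `F` and is therefore covered
-- by `F`.
theorem exists_corank_two {F F' c a : M} (hF : IsCoatom F) (hc : c ∈ A) (hcF : c ≤ F)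
    (haF : ¬ a ≤ F) (hs : shadow F' = insert a (shadow F \ {c})) :
    ∃ R, shadow R = shadow F \ {c} ∧ rank R + 2 = rank (⊤ : M) := by
  obtain ⟨R, hR⟩ := h.exists_inf₂ F F'
  have hRs : shadow R = shadow F \ {c} := by
    ext v
    have hv : (v ∈ vertices M ∧ v ≤ F') ↔ v ∈ insert a (shadow F \ {c}) := by
      rw [← hs]
      rfl
    simp only [shadow, Set.mem_ofPred_eq, Set.mem_insert_iff, Set.mem_sdiff,
      Set.mem_singleton_iff] at hv ⊢
    rw [hR]
    by_cases hva : v = a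
    · subst hva
      simp [haF]
    · tauto
  have h1 := h.ranked _ _ (h.covBy_of_shadow_eq_sdiff_singleton hRs ⟨hAV hc, hcF⟩)
  have h2 := h.rank_facet hF
  exact ⟨R, hRs, by omega⟩

/-- Exchanging `c` for `a` and for `b` would give, with `F` itself, three facets over the same face
of corank two. -/
theorem missed_unique {F c a b : M} (hF : IsCoatom F) (hc : c ∈ A) (hcF : c ≤ F)
    (ha : a ∈ A) (haF : ¬ a ≤ F) (hb : b ∈ A) (hbF : ¬ b ≤ F) : a = b := by
  by_contra hab
  obtain ⟨F₁, hF₁, hs₁⟩ := hE F c a hF hc hcF ha haF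
  obtain ⟨F₂, hF₂, hs₂⟩ := hE F c b hF hc hcF hb hbF
  obtain ⟨R, hRs, hR⟩ := h.exists_corank_two hAV hF hc hcF haF hs₁
  have ha₁ : a ∈ shadow F₁ := hs₁ ▸ Set.mem_insert _ _
  have hb₂ : b ∈ shadow F₂ := hs₂ ▸ Set.mem_insert _ _
  refine h.not_three_facets hR hF hF₁ hF₂ (h.shadow_subset_iff.1 (hRs ▸ Set.sdiff_subset))
    (h.shadow_subset_iff.1 (hRs ▸ hs₁ ▸ Set.subset_insert _ _))
    (h.shadow_subset_iff.1 (hRs ▸ hs₂ ▸ Set.subset_insert _ _)) ?_ ?_ ?_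
  · rintro rfl
    exact haF ha₁.2
  · rintro rfl
    exact hbF hb₂.2
  · rintro rfl
    rw [hs₂] at ha₁
    rcases ha₁ with h1 | h1
    · exact hab h1
    · exact haF h1.1.2

include hmiss

/-- Containing a vertex of `A` passes from a facet to an adjacent one, so it spreads over the
connected facet graph from a facet through `x`. -/
theorem exists_mem_le_facet {x : M} (hx : x ∈ A) (hx' : x ≠ ⊤) {F : M} (hF : IsCoatom F) :
    ∃ c ∈ A, c ≤ F := by
  obtain ⟨F₀, hF₀, hxF₀⟩ := h.exists_facet_ge hx'
  have hconn := (h.connected_of_lt (bot_le.trans_lt (lt_top_iff_ne_top.2 hx'))).preconnected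
    ⟨F₀, bot_le, le_top, h.rank_facet hF₀⟩ ⟨F, bot_le, le_top, h.rank_facet hF⟩
  have hstep : ∀ σ τ : {σ : M // ⊥ ≤ σ ∧ σ ≤ ⊤ ∧ rank σ + 1 = rank (⊤ : M)},
      (facetGraph ⊥ ⊤).Adj σ τ → (∃ c ∈ A, c ≤ σ.1) → ∃ c ∈ A, c ≤ τ.1 := by
    rintro ⟨G, _, _, hG⟩ ⟨K, _, _, hK⟩ ⟨m, hglb, hmr⟩ ⟨c, hc, hcG⟩
    simp only at hglb hcG ⊢
    by_contra hcon
    push Not at hcon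
    have hG' : IsCoatom G := h.mem_facets.1 hG
    have hK' : IsCoatom K := h.mem_facets.1 hK
    obtain ⟨b, hb, hbG⟩ := hmiss G hG'
    obtain ⟨G₁, hG₁, hs⟩ := hE G c b hG' hc hcG hb hbG
    obtain ⟨R, hRs, hR⟩ := h.exists_corank_two hAV hG' hc hcG hbG hs
    have hmG : m ≤ G := hglb.1 (Set.mem_insert _ _)
    have hmK : m ≤ K := hglb.1 (Set.mem_insert_of_mem _ rfl)
    -- If `K` avoided `A`, the meet of `G` and `K` would omit `c` and so be `G` with `c` removed.
    -- The facets `G`, `K` and the exchanged `G₁` would then share a face of corank two.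
    have hmR : m = R := by
      refine h.eq_of_le_of_rank_le (h.shadow_subset_iff.1 fun v hv => ?_) (by omega)
      rw [hRs]
      refine ⟨h.shadow_subset_iff.2 hmG hv, ?_⟩
      rintro rfl
      exact hcon v hc (hv.2.trans hmK)
    subst hmR
    have hb₁ : b ∈ shadow G₁ := hs ▸ Set.mem_insert _ _
    refine h.not_three_facets hR hG' hG₁ hK' hmG
      (h.shadow_subset_iff.1 (hRs ▸ hs ▸ Set.subset_insert _ _)) hmK ?_ ?_ ?_
    · rintro rfl
      exact hbG hb₁.2
    · rintro rfl
      exact hcon c hc hcG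
    · rintro rfl
      exact hcon b hb hb₁.2
  obtain ⟨p⟩ := hconn
  have hwalk : ∀ {σ τ : {σ : M // ⊥ ≤ σ ∧ σ ≤ ⊤ ∧ rank σ + 1 = rank (⊤ : M)}},
      (facetGraph ⊥ ⊤).Walk σ τ → (∃ c ∈ A, c ≤ σ.1) → ∃ c ∈ A, c ≤ τ.1 := by
    intro σ τ p
    induction p with
    | nil => exact id
    | cons hadj _ ih => exact fun hh => ih (hstep _ _ hadj hh)
  exact hwalk p ⟨x, hx, hxF₀⟩

/-- Each facet misses exactly one vertex of `A`, and an exchange moves this omission to `b`. The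
choices inside and outside `A` are thus independent, which is what makes a join. -/
theorem exists_facet_move {x : M} (hx : x ∈ A) (hx' : x ≠ ⊤) {F b : M} (hF : IsCoatom F)
    (hb : b ∈ A) : ∃ F', IsCoatom F' ∧ shadow F' = shadow F \ A ∪ A \ {b} := by
  obtain ⟨c, hc, hcF⟩ := h.exists_mem_le_facet hAV hE hmiss hx hx' hF
  obtain ⟨a, ha, haF⟩ := hmiss F hF
  have hu : ∀ v ∈ A, v ≠ a → v ∈ shadow F := by
    intro v hv hva
    by_contra hvF
    exact hva (h.missed_unique hAV hE hF hc hcF hv (fun hh => hvF ⟨hAV hv, hh⟩) ha haF)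
  have ha' : a ∉ shadow F := fun hh => haF hh.2
  by_cases hbF : b ≤ F
  · obtain ⟨F', hF', hs⟩ := hE F b a hF hb hbF ha haF
    refine ⟨F', hF', hs.trans ?_⟩
    ext v
    simp only [Set.mem_insert_iff, Set.mem_sdiff, Set.mem_singleton_iff, Set.mem_union]
    by_cases hva : v = a
    · subst hva
      have : v ≠ b := by
        rintro rfl
        exact haF hbF
      simp [ha, this]
    · by_cases hvA : v ∈ A
      · simp [hva, hvA, hu v hvA hva]
      · have : v ≠ b := by
          rintro rfl
          exact hvA hb
        simp [hva, hvA, this]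
  · obtain rfl := h.missed_unique hAV hE hF hc hcF hb hbF ha haF
    refine ⟨F, hF, ?_⟩
    ext v
    simp only [Set.mem_sdiff, Set.mem_singleton_iff, Set.mem_union]
    by_cases hvA : v ∈ A
    · simp only [hvA, not_true_eq_false, and_false, true_and, false_or]
      refine ⟨?_, hu v hvA⟩
      rintro hv rfl
      exact ha' hv
    · simp [hvA]

/-- The face is the meet of all facets missing `x`. They contain the rest of `A`; any vertex outside
`A` is avoided by some facet, and that facet can be moved so as to miss `x`. -/
theorem exists_shadow_eq_sdiff {x : M} (hx : x ∈ A) (hx' : x ≠ ⊤) :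
    ∃ p : M, shadow p = A \ {x} := by
  have hmove := fun {F} (hF : IsCoatom F) => h.exists_facet_move hAV hE hmiss hx hx' hF hx
  obtain ⟨p, hp⟩ := h.exists_shadow_eq fun F => IsCoatom F ∧ ¬ x ≤ F
  refine ⟨p, hp.trans ?_⟩
  have hnotx : ∀ {F F' : M}, shadow F' = shadow F \ A ∪ A \ {x} → ¬ x ≤ F' := by
    intro F F' hs hxF
    have : x ∈ shadow F' := ⟨hAV hx, hxF⟩
    rw [hs] at this
    rcases this with h1 | h1
    exacts [h1.2 hx, h1.2 rfl]
  ext v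
  simp only [Set.mem_ofPred_eq, Set.mem_sdiff, Set.mem_singleton_iff]
  constructor
  · rintro ⟨hv, hvF⟩
    have hv0 : ¬ v ≤ ⊥ := fun hh => (h.mem_vertices.1 hv).1 (le_bot_iff.1 hh)
    obtain ⟨F, hF, -, hvF0⟩ := h.exists_facet_of_not_le hv0
    obtain ⟨F', hF', hs⟩ := hmove hF
    have hvF' : v ∈ shadow F' := ⟨hv, hvF F' ⟨hF', hnotx hs⟩⟩
    rw [hs] at hvF'
    rcases hvF' with h1 | h1
    · exact absurd h1.1.2 hvF0
    · exact h1
  · rintro ⟨hv, hvx⟩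
    refine ⟨hAV hv, fun F hF => ?_⟩
    by_contra hvF
    obtain ⟨c, hc, hcF⟩ := h.exists_mem_le_facet hAV hE hmiss hx hx' hF.1
    exact hvx (h.missed_unique hAV hE hF.1 hc hcF hv hvF hx hF.2)

/-- A pair `(X, s)` is sent to the vertex set `(shadow X \ A) ∪ s`. A proper face above `p` meets
`A` exactly in `A \ {x}`, so its part outside `A` determines it. -/
theorem nonempty_iso_join_of_exchange {x : M} (hx : x ∈ A) (hx' : x ≠ ⊤) {p : M}
    (hp : shadow p = A \ {x}) : Nonempty (M ≃o Join (Set.Ici p) (Set A)) := by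
  have hmove := fun {F b} (hF : IsCoatom F) (hb : b ∈ A) =>
    h.exists_facet_move hAV hE hmiss hx hx' hF hb
  have htop : ∀ m : M, A ⊆ shadow m → m = ⊤ := by
    intro m hm
    by_contra hne
    obtain ⟨F, hF, hmF⟩ := h.exists_facet_ge hne
    obtain ⟨a, ha, haF⟩ := hmiss F hF
    exact haF ((hm ha).2.trans hmF)
  have hpX : ∀ X : Set.Ici p, A \ {x} ⊆ shadow (X : M) := fun X => by
    rw [← hp]
    exact h.shadow_subset_iff.2 X.2
  have hxX : ∀ X : Set.Ici p, x ∈ shadow (X : M) → X = ⊤ := by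
    intro X hX
    refine Subtype.ext (htop X fun a ha => ?_)
    by_cases hax : a = x
    · exact hax ▸ hX
    · exact hpX X ⟨ha, hax⟩
  let g : Join (Set.Ici p) (Set A) ↪o Set M := OrderEmbedding.ofMapLEIff
    (fun q => shadow (q.1.1 : M) \ A ∪ Subtype.val '' q.1.2) (by
      intro q q'
      constructor
      · intro hs
        have h2 : q.1.2 ≤ q'.1.2 := by
          intro y hy
          rcases hs (Or.inr ⟨y, hy, rfl⟩) with h1 | ⟨z, hz, hzy⟩
          · exact absurd y.2 h1.2
          · exact Subtype.ext hzy ▸ hz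
        refine ⟨h.shadow_subset_iff.1 fun v hv => ?_, h2⟩
        by_cases hvA : v ∈ A
        · by_cases hvx : v = x
          · subst hvx
            rcases q.2 with h3 | h3
            · exact absurd (hxX _ hv) h3.1.ne
            · have h4 : q'.1.2 = ⊤ := top_le_iff.1 (h3.2.ge.trans h2)
              rcases q'.2 with h5 | h5
              · exact absurd h4 h5.2.ne
              · rw [h5.1]
                exact ⟨hv.1, le_top⟩
          · exact hpX _ ⟨hvA, hvx⟩
        · rcases hs (Or.inl ⟨hv, hvA⟩) with h1 | ⟨z, hz, rfl⟩
          · exact h1.1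
          · exact absurd z.2 hvA
      · rintro ⟨h1, h2⟩
        exact Set.union_subset_union (Set.sdiff_subset_sdiff_left (h.shadow_subset_iff.2 h1))
          (Set.image_mono h2))
  have hgtop : g ⊤ = shadow (⊤ : M) := by
    change shadow (⊤ : M) \ A ∪ Subtype.val '' (Set.univ : Set A) = _
    rw [Set.image_univ, Subtype.range_coe, Set.sdiff_union_self, Set.union_eq_left, h.shadow_top]
    exact hAV
  refine nonempty_orderIso_of_range h.shadowEmbedding g (Set.Subset.antisymm ?_ ?_)
  · rintro _ ⟨m, rfl⟩
    by_cases hm : m = ⊤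
    · subst hm
      exact ⟨⊤, hgtop⟩
    obtain ⟨F₀, hF₀, hmF₀⟩ := h.exists_facet_ge hm
    -- The first component for a proper face `m`: all facets over the part of `m` outside `A`, with
    -- the omission fixed at `x`.
    obtain ⟨X, hX⟩ := h.exists_shadow_eq fun F => IsCoatom F ∧ shadow m \ A ⊆ shadow F ∧ ¬ x ≤ F
    have hgood : ∀ {F}, IsCoatom F → m ≤ F → ∃ F', (IsCoatom F' ∧ shadow m \ A ⊆ shadow F' ∧
        ¬ x ≤ F') ∧ shadow F' = shadow F \ A ∪ A \ {x} := by
      intro F hF hmF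
      obtain ⟨F', hF', hs⟩ := hmove hF hx
      refine ⟨F', ⟨hF', ?_, fun hxF => ?_⟩, hs⟩
      · rw [hs]
        exact fun v hv => Or.inl ⟨h.shadow_subset_iff.2 hmF hv.1, hv.2⟩
      · have : x ∈ shadow F' := ⟨hAV hx, hxF⟩
        rw [hs] at this
        rcases this with h1 | h1
        exacts [h1.2 hx, h1.2 rfl]
    obtain ⟨F₁, hF₁, -⟩ := hgood hF₀ hmF₀
    have hXx : ¬ x ≤ X := fun hh => by
      have : x ∈ shadow X := ⟨hAV hx, hh⟩
      rw [hX] at this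
      exact hF₁.2.2 (this.2 F₁ hF₁)
    have hpX' : p ≤ X := by
      refine h.shadow_subset_iff.1 ?_
      rw [hp, hX]
      rintro a ⟨ha, hax⟩
      refine ⟨hAV ha, fun F hF => ?_⟩
      by_contra haF
      obtain ⟨c, hc, hcF⟩ := h.exists_mem_le_facet hAV hE hmiss hx hx' hF.1
      exact hax (h.missed_unique hAV hE hF.1 hc hcF ha haF hx hF.2.2)
    refine ⟨⟨(⟨X, hpX'⟩, Subtype.val ⁻¹' shadow m), Or.inl ⟨?_, ?_⟩⟩, ?_⟩
    · refine lt_top_iff_ne_top.2 fun hh => hXx ?_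
      rw [show X = ⊤ from congrArg Subtype.val hh]
      exact le_top
    · rw [lt_top_iff_ne_top, Set.top_eq_univ, Set.ne_univ_iff_exists_notMem]
      obtain ⟨a, ha, haF⟩ := hmiss F₀ hF₀
      exact ⟨⟨a, ha⟩, fun hh => haF (hh.2.trans hmF₀)⟩
    · change shadow X \ A ∪ Subtype.val '' (Subtype.val ⁻¹' shadow m : Set A) = shadow m
      have : shadow X \ A = shadow m \ A := by
        ext v
        constructor
        · rintro ⟨h1, h2⟩
          refine ⟨?_, h2⟩
          rw [hX] at h1
          by_contra hvm
          obtain ⟨F, hF, hmF, hvF⟩ := h.exists_facet_of_not_le (a := v) (b := m)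
            fun hh => hvm ⟨h1.1, hh⟩
          obtain ⟨F', hF', hs⟩ := hgood hF hmF
          have hv : v ∈ shadow F' := ⟨h1.1, h1.2 F' hF'⟩
          rw [hs] at hv
          rcases hv with h3 | h3
          exacts [hvF h3.1.2, h2 h3.1]
        · rintro ⟨h1, h2⟩
          refine ⟨?_, h2⟩
          rw [hX]
          exact ⟨h1.1, fun F hF => (hF.2.1 ⟨h1, h2⟩).2⟩
      rw [this, Subtype.image_preimage_coe, Set.inter_comm, Set.sdiff_union_inter]
  · rintro _ ⟨q, rfl⟩
    rcases q.2 with ⟨h1, h2⟩ | ⟨h1, h2⟩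
    · obtain ⟨m, hm⟩ := h.exists_shadow_eq fun F => IsCoatom F ∧ g q ⊆ shadow F
      refine ⟨m, hm.trans ?_⟩
      have hgq : g q = shadow (q.1.1 : M) \ A ∪ Subtype.val '' q.1.2 := rfl
      have hgV : g q ⊆ vertices M := by
        rw [hgq]
        rintro v (hv | ⟨y, -, rfl⟩)
        exacts [hv.1.1, hAV y.2]
      have hgood : ∀ {F b}, IsCoatom F → (q.1.1 : M) ≤ F → (hb : b ∈ A) → ⟨b, hb⟩ ∉ q.1.2 →
          ∃ F', (IsCoatom F' ∧ g q ⊆ shadow F') ∧ shadow F' = shadow F \ A ∪ A \ {b} := by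
        intro F b hF hqF hb hbq
        obtain ⟨F', hF', hs⟩ := hmove hF hb
        refine ⟨F', ⟨hF', ?_⟩, hs⟩
        rw [hs, hgq]
        rintro v (hv | ⟨y, hy, rfl⟩)
        · exact Or.inl ⟨h.shadow_subset_iff.2 hqF hv.1, hv.2⟩
        · refine Or.inr ⟨y.2, ?_⟩
          rintro rfl
          exact hbq hy
      ext v
      constructor
      · rintro ⟨h3, h4⟩
        rw [hgq]
        by_cases hvA : v ∈ A
        · refine Or.inr ⟨⟨v, hvA⟩, ?_, rfl⟩
          by_contra hvq
          have hne : (q.1.1 : M) ≠ ⊤ := fun hh => h1.ne (Subtype.ext hh)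
          obtain ⟨F, hF, hqF⟩ := h.exists_facet_ge hne
          obtain ⟨F', hF', hs⟩ := hgood hF hqF hvA hvq
          have hv : v ∈ shadow F' := ⟨h3, h4 F' hF'⟩
          rw [hs] at hv
          rcases hv with h5 | h5
          exacts [h5.2 hvA, h5.2 rfl]
        · refine Or.inl ⟨?_, hvA⟩
          by_contra hvq
          obtain ⟨b, hb⟩ := (Set.ne_univ_iff_exists_notMem _).1 h2.ne
          obtain ⟨F, hF, hqF, hvF⟩ := h.exists_facet_of_not_le (a := v) (b := (q.1.1 : M))
            fun hh => hvq ⟨h3, hh⟩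
          obtain ⟨F', hF', hs⟩ := hgood hF hqF b.2 hb
          have hv : v ∈ shadow F' := ⟨h3, h4 F' hF'⟩
          rw [hs] at hv
          rcases hv with h5 | h5
          exacts [hvF h5.1.2, hvA h5.1]
      · exact fun hv => ⟨hgV hv, fun F hF => (hF.2 hv).2⟩
    · have : q = ⊤ := Join.eq_top_iff.2 ⟨h1, h2⟩
      subst this
      exact ⟨⊤, hgtop.symm⟩

end Exchange

/-- A reducible cellular pseudomanifold is the join of an interval with a standard sphere. -/
theorem exists_iso_join_of_isReducible (hred : IsReducible M) (hr : 1 < rank (⊤ : M)) :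
    ∃ (p : M) (A : Set M), p ≠ ⊤ ∧ 2 ≤ Nat.card A ∧
      Nonempty (M ≃o Join (Set.Ici p) (Set A)) := by
  obtain ⟨x, hx, hσ⟩ := hred
  have hxA : x ∈ vertexClass x := ⟨hx, Or.inl rfl⟩
  have hAV : vertexClass x ⊆ vertices M := fun v hv => hv.1
  have hE : ∀ F c a : M, IsCoatom F → c ∈ vertexClass x → c ≤ F → a ∈ vertexClass x → ¬ a ≤ F →
      ∃ F', IsCoatom F' ∧ shadow F' = insert a (shadow F \ {c}) :=
    fun F c a hF hc hcF ha haF => exists_exchange hx hF hc hcF ha haF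
  have hmiss : ∀ F : M, IsCoatom F → ∃ a ∈ vertexClass x, ¬ a ≤ F := by
    intro F hF
    obtain ⟨a, ha, haF⟩ := Set.not_subset.1 (hσ F (h.mem_facets.2 hF))
    exact ⟨a, ha, fun hh => haF ⟨hAV ha, hh⟩⟩
  have hx' : x ≠ ⊤ := by
    rintro rfl
    have : rank (⊤ : M) = 1 := hx
    omega
  obtain ⟨p, hp⟩ := h.exists_shadow_eq_sdiff hAV hE hmiss hxA hx'
  refine ⟨p, vertexClass x, ?_, ?_, h.nonempty_iso_join_of_exchange hAV hE hmiss hxA hx' hp⟩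
  · rintro rfl
    have : x ∈ vertexClass x \ {x} := hp ▸ ⟨hx, le_top⟩
    exact this.2 rfl
  · obtain ⟨F, hF, hxF⟩ := h.exists_facet_ge hx'
    obtain ⟨a, ha, haF⟩ := hmiss F hF
    refine (Set.one_lt_ncard (h.finite_set _)).2 ⟨x, hxA, a, ha, ?_⟩
    rintro rfl
    exact haF hxF

end IsCellularPseudomanifold

end CPM

namespace CPM

/-! ### Spaces of affine functions on the vertices -/

section AffineModel

/-- A representation of a poset by subsets of a set `V`, such that the subsets which occur are the
zero sets of the nonnegative functions in a linear space containing the constants. -/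
structure IsAffineModel {M V : Type*} [PartialOrder M] (g : M → Set V)
    (U : Submodule ℝ (V → ℝ)) : Prop where
  le_iff : ∀ a b, g a ⊆ g b ↔ a ≤ b
  one_mem : (1 : V → ℝ) ∈ U
  range : ∀ T, (∃ a, g a = T) ↔ ∃ u ∈ U, (∀ v, 0 ≤ u v) ∧ T = {v | u v = 0}

variable {M N V W : Type*} [PartialOrder M] [PartialOrder N] {g : M → Set V} {g' : N → Set W}
  {U : Submodule ℝ (V → ℝ)} {U' : Submodule ℝ (W → ℝ)}

/-- On the vertices of a simplex every function is affine. -/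
theorem isAffineModel_set (α : Type*) : IsAffineModel (id : Set α → Set α) ⊤ where
  le_iff _ _ := Iff.rfl
  one_mem := trivial
  range T := by
    classical
    refine ⟨fun _ => ⟨fun v => if v ∈ T then 0 else 1, trivial, fun v => ?_, ?_⟩,
      fun _ => ⟨T, rfl⟩⟩
    · positivity
    · ext v
      by_cases hv : v ∈ T <;> simp [hv]

theorem IsAffineModel.top_eq [OrderTop M] (hg : IsAffineModel g U) : g ⊤ = Set.univ := by
  obtain ⟨a, ha⟩ := (hg.range Set.univ).2 ⟨0, U.zero_mem, fun _ => le_rfl, by simp⟩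
  exact Set.univ_subset_iff.1 (ha ▸ (hg.le_iff a ⊤).2 le_top)

theorem IsAffineModel.eq_top_iff [OrderTop M] (hg : IsAffineModel g U) {a : M} :
    a = ⊤ ↔ g a = Set.univ := by
  refine ⟨fun ha => ha ▸ hg.top_eq, fun ha => top_le_iff.1 ((hg.le_iff _ _).1 ?_)⟩
  rw [ha]
  exact Set.subset_univ _

/-- The subset of a disjoint union given by subsets of the parts. -/
def sumSet (p : M × N) (g : M → Set V) (g' : N → Set W) : Set (V ⊕ W) :=
  Sum.inl '' g p.1 ∪ Sum.inr '' g' p.2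

theorem sumSet_subset_iff (hg : IsAffineModel g U) (hg' : IsAffineModel g' U') {p q : M × N} :
    sumSet p g g' ⊆ sumSet q g g' ↔ p ≤ q := by
  have := Set.sumEquiv.symm.le_iff_le (x := (g p.1, g' p.2)) (y := (g q.1, g' q.2))
  refine this.trans ?_
  exact and_congr (hg.le_iff _ _) (hg'.le_iff _ _)

omit [PartialOrder M] [PartialOrder N] in
theorem sumSet_eq_iff {p : M × N} {u : V ⊕ W → ℝ} :
    sumSet p g g' = {v | u v = 0} ↔
      g p.1 = {v | u (Sum.inl v) = 0} ∧ g' p.2 = {v | u (Sum.inr v) = 0} := by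
  simp only [sumSet, Set.ext_iff, Set.mem_union, Set.mem_image, Set.mem_ofPred_eq]
  constructor
  · intro hh
    exact ⟨fun v => by simpa using hh (Sum.inl v), fun v => by simpa using hh (Sum.inr v)⟩
  · rintro ⟨h1, h2⟩ (v | v)
    · simpa using h1 v
    · simpa using h2 v

/-- The affine functions on the two parts are prescribed independently: this models the convex hull
of two polytopes in skew affine subspaces. -/
theorem IsAffineModel.prod (hg : IsAffineModel g U) (hg' : IsAffineModel g' U') :
    IsAffineModel (fun p : M × N => sumSet p g g')
      (U.comap (LinearMap.funLeft ℝ ℝ Sum.inl) ⊓ U'.comap (LinearMap.funLeft ℝ ℝ Sum.inr)) where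
  le_iff _ _ := sumSet_subset_iff hg hg'
  one_mem := ⟨hg.one_mem, hg'.one_mem⟩
  range T := by
    constructor
    · rintro ⟨⟨a, b⟩, rfl⟩
      obtain ⟨u, hu, hu0, hT⟩ := (hg.range _).1 ⟨a, rfl⟩
      obtain ⟨u', hu', hu0', hT'⟩ := (hg'.range _).1 ⟨b, rfl⟩
      exact ⟨Sum.elim u u', ⟨hu, hu'⟩, by rintro (v | v); exacts [hu0 v, hu0' v],
        sumSet_eq_iff.2 ⟨hT, hT'⟩⟩
    · rintro ⟨u, ⟨hu, hu'⟩, hu0, rfl⟩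
      obtain ⟨a, ha⟩ := (hg.range _).2 ⟨_, hu, fun v => hu0 _, rfl⟩
      obtain ⟨b, hb⟩ := (hg'.range _).2 ⟨_, hu', fun v => hu0 _, rfl⟩
      exact ⟨(a, b), sumSet_eq_iff.2 ⟨ha, hb⟩⟩

/-- The functions on a disjoint union with equal means on the two parts. -/
def equalMeans (V W : Type*) [Fintype V] [Fintype W] : Submodule ℝ (V ⊕ W → ℝ) where
  carrier := {u | Fintype.card W * ∑ v, u (Sum.inl v) = Fintype.card V * ∑ w, u (Sum.inr w)}
  add_mem' := by
    intro a b ha hb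
    simp only [Set.mem_ofPred_eq, Pi.add_apply, Finset.sum_add_distrib, mul_add] at *
    rw [ha, hb]
  zero_mem' := by simp
  smul_mem' := by
    intro c a ha
    simp only [Set.mem_ofPred_eq, Pi.smul_apply, smul_eq_mul, ← Finset.mul_sum] at *
    linear_combination c * ha

/-- Equality of means places the two centroids at the same point. A nonnegative function has mean
zero on a part exactly when it vanishes on that part, so it vanishes on both parts or on neither;
conversely, two nonzero functions can be rescaled to equal means. -/
theorem IsAffineModel.join [BoundedOrder M] [BoundedOrder N] [Fintype V] [Fintype W]
    [Nonempty V] [Nonempty W] (hg : IsAffineModel g U) (hg' : IsAffineModel g' U') :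
    IsAffineModel (fun p : Join M N => sumSet p.1 g g')
      (U.comap (LinearMap.funLeft ℝ ℝ Sum.inl) ⊓ U'.comap (LinearMap.funLeft ℝ ℝ Sum.inr) ⊓
        equalMeans V W) where
  le_iff _ _ := sumSet_subset_iff hg hg'
  one_mem := ⟨⟨hg.one_mem, hg'.one_mem⟩, by
    change _ = _
    simp [mul_comm]⟩
  range T := by
    have hV : (0 : ℝ) < Fintype.card V := by exact_mod_cast Fintype.card_pos
    have hW : (0 : ℝ) < Fintype.card W := by exact_mod_cast Fintype.card_pos
    constructor
    · rintro ⟨⟨⟨a, b⟩, ⟨ha, hb⟩ | ⟨ha, hb⟩⟩, rfl⟩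
      · obtain ⟨u, hu, hu0, hT⟩ := (hg.range _).1 ⟨a, rfl⟩
        obtain ⟨u', hu', hu0', hT'⟩ := (hg'.range _).1 ⟨b, rfl⟩
        have hs : 0 < ∑ v, u v := by
          have : g a ≠ Set.univ := fun hh => ha.ne (hg.eq_top_iff.2 hh)
          obtain ⟨v, hv⟩ := (Set.ne_univ_iff_exists_notMem _).1 this
          rw [hT] at hv
          exact Finset.sum_pos' (fun v _ => hu0 v)
            ⟨v, Finset.mem_univ v, lt_of_le_of_ne (hu0 v) (Ne.symm hv)⟩
        have hs' : 0 < ∑ v, u' v := by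
          have : g' b ≠ Set.univ := fun hh => hb.ne (hg'.eq_top_iff.2 hh)
          obtain ⟨v, hv⟩ := (Set.ne_univ_iff_exists_notMem _).1 this
          rw [hT'] at hv
          exact Finset.sum_pos' (fun v _ => hu0' v)
            ⟨v, Finset.mem_univ v, lt_of_le_of_ne (hu0' v) (Ne.symm hv)⟩
        have hc : 0 < Fintype.card V * ∑ v, u' v := mul_pos hV hs'
        have hc' : 0 < Fintype.card W * ∑ v, u v := mul_pos hW hs
        -- Cross-multiplication by positive factors equalizes the means and keeps the zero sets.
        refine ⟨Sum.elim ((Fintype.card V * ∑ v, u' v) • u) ((Fintype.card W * ∑ v, u v) • u'),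
          ⟨⟨U.smul_mem _ hu, U'.smul_mem _ hu'⟩, ?_⟩, ?_, sumSet_eq_iff.2 ⟨?_, ?_⟩⟩
        · change _ = _
          simp only [Sum.elim_inl, Sum.elim_inr, Pi.smul_apply, smul_eq_mul, ← Finset.mul_sum]
          ring
        · rintro (v | v)
          exacts [mul_nonneg hc.le (hu0 v), mul_nonneg hc'.le (hu0' v)]
        · rw [hT]
          ext v
          simp [hs'.ne']
        · rw [hT']
          ext v
          simp [hs.ne']
      · simp only at ha hb
        subst ha hb
        refine ⟨0, Submodule.zero_mem _, fun _ => le_rfl, sumSet_eq_iff.2 ⟨?_, ?_⟩⟩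
        · simpa using hg.top_eq
        · simpa using hg'.top_eq
    · rintro ⟨u, ⟨⟨hu, hu'⟩, hm⟩, hu0, rfl⟩
      obtain ⟨a, ha⟩ := (hg.range _).2 ⟨_, hu, fun v => hu0 _, rfl⟩
      obtain ⟨b, hb⟩ := (hg'.range _).2 ⟨_, hu', fun v => hu0 _, rfl⟩
      change (_ : ℝ) = _ at hm
      have e1 : a = ⊤ ↔ ∑ v, u (Sum.inl v) = 0 := by
        rw [hg.eq_top_iff, ha, Finset.sum_eq_zero_iff_of_nonneg fun v _ => hu0 _]
        simp [Set.eq_univ_iff_forall, LinearMap.funLeft]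
      have e2 : b = ⊤ ↔ ∑ v, u (Sum.inr v) = 0 := by
        rw [hg'.eq_top_iff, hb, Finset.sum_eq_zero_iff_of_nonneg fun v _ => hu0 _]
        simp [Set.eq_univ_iff_forall, LinearMap.funLeft]
      have e3 : a = ⊤ ↔ b = ⊤ := by
        rw [e1, e2]
        constructor
        · intro h0
          rw [h0, mul_zero] at hm
          exact (mul_eq_zero.1 hm.symm).resolve_left hV.ne'
        · intro h0
          rw [h0, mul_zero] at hm
          exact (mul_eq_zero.1 hm).resolve_left hW.ne'
      refine ⟨⟨(a, b), ?_⟩, sumSet_eq_iff.2 ⟨ha, hb⟩⟩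
      by_cases hat : a = ⊤
      · exact Or.inr ⟨hat, e3.1 hat⟩
      · exact Or.inl ⟨lt_top_iff_ne_top.2 hat, lt_top_iff_ne_top.2 fun hh => hat (e3.2 hh)⟩

end AffineModel

/-! ### Realization as polytopes -/

section Polytope

/-- The exposed faces of a polytope, as sets of vertices. -/
theorem exposed_le_iff {E : Type*} [NormedAddCommGroup E] [NormedSpace ℝ E] {S : Set E}
    (hS : S.Finite) {F G : Set E} (hF : IsExposed ℝ (convexHull ℝ S) F)
    (hG : IsExposed ℝ (convexHull ℝ S) G) : F ∩ S ⊆ G ↔ F ⊆ G := by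
  refine ⟨fun hh => ?_, fun hh => Set.inter_subset_left.trans hh⟩
  have hcomp : IsCompact F := hF.isCompact (hS.isCompact_convexHull ℝ)
  have hconv : Convex ℝ F := hF.convex (convex_convexHull ℝ S)
  have hext : F.extremePoints ℝ ⊆ F ∩ S := fun x hx =>
    ⟨extremePoints_subset hx, extremePoints_convexHull_subset
      (hF.isExtreme.extremePoints_subset_extremePoints hx)⟩
  have hGc : IsClosed G := (hG.isCompact (hS.isCompact_convexHull ℝ)).isClosed
  rw [← closure_convexHull_extremePoints hcomp hconv]
  exact closure_minimal (convexHull_min (hext.trans hh) (hG.convex (convex_convexHull ℝ S))) hGc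

theorem forall_mem_convexHull_le_iff {E : Type*} [NormedAddCommGroup E] [NormedSpace ℝ E]
    {S : Set E} (l : StrongDual ℝ E) (c : ℝ) :
    (∀ y ∈ convexHull ℝ S, l y ≤ c) ↔ ∀ y ∈ S, l y ≤ c := by
  refine ⟨fun hh y hy => hh y (subset_convexHull ℝ S hy), fun hh => ?_⟩
  exact convexHull_min hh (convex_halfSpace_le l.toLinearMap.isLinear c)

variable {M V : Type*} [PartialOrder M] {g : M → Set V} {U : Submodule ℝ (V → ℝ)}

/-- The points of `V` are given, as coordinates, the values of a basis of the functions in `U`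
vanishing at a base point. The linear functionals then restrict to exactly these functions, so `U`
is the space of affine functions, and exposed faces correspond to zero sets. -/
theorem IsAffineModel.isPolytopal [Finite V] [Nonempty V] (hg : IsAffineModel g U) :
    IsPolytopal M := by
  classical
  obtain ⟨v₀⟩ := ‹Nonempty V›
  let W : Submodule ℝ (V → ℝ) := U ⊓ LinearMap.ker (LinearMap.proj v₀ : (V → ℝ) →ₗ[ℝ] ℝ)
  have hW : ∀ f, f ∈ W ↔ f ∈ U ∧ f v₀ = 0 := fun f => by simp [W]
  let n := Module.finrank ℝ W
  let b : Module.Basis (Fin n) ℝ W := Module.finBasis ℝ W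
  let s : V → EuclideanSpace ℝ (Fin n) := fun v => WithLp.toLp 2 fun j => (b j : V → ℝ) v
  have hs₀ : s v₀ = 0 := by
    ext j
    exact ((hW _).1 (b j).2).2
  have hl : ∀ l : EuclideanSpace ℝ (Fin n) →ₗ[ℝ] ℝ, ∃ c : Fin n → ℝ,
      (∀ v, l (s v) = ((∑ j, c j • b j : W) : V → ℝ) v) ∧ (c = 0 → l = 0) := by
    intro l
    refine ⟨fun j => l (EuclideanSpace.single j 1), fun v => ?_, fun hc => ?_⟩
    · have := (EuclideanSpace.basisFun (Fin n) ℝ).sum_repr (s v)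
      conv_lhs => rw [← this]
      simp [s, Finset.sum_apply, mul_comm]
    · refine (EuclideanSpace.basisFun (Fin n) ℝ).toBasis.ext fun j => ?_
      simpa using congrFun hc j
  have hl' : ∀ f ∈ W, ∃ l : StrongDual ℝ (EuclideanSpace ℝ (Fin n)), ∀ v, l (s v) = f v := by
    intro f hf
    refine ⟨∑ j, b.repr ⟨f, hf⟩ j • EuclideanSpace.proj j, fun v => ?_⟩
    have := congrArg (fun x : W => (x : V → ℝ) v) (b.sum_repr ⟨f, hf⟩)
    simp only [Submodule.coe_sum, Finset.sum_apply] at this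
    refine Eq.trans ?_ this
    simp [s]
  have hfin : (Set.range s).Finite := Set.finite_range s
  refine ⟨n, Set.range s, hfin, ?_, ?_⟩
  · rw [interior_convexHull_nonempty_iff_affineSpan_eq_top,
      AffineSubspace.affineSpan_eq_top_iff_vectorSpan_eq_top_of_nonempty ℝ _ _ ⟨s v₀, Set.mem_range_self v₀⟩,
      vectorSpan_range_eq_span_range_vsub_right ℝ s v₀]
    by_contra hne
    obtain ⟨l, hl0, hlk⟩ := Submodule.exists_le_ker_of_lt_top _ (lt_top_iff_ne_top.2 hne)
    obtain ⟨c, hc, hc0⟩ := hl l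
    refine hl0 (hc0 ?_)
    have h0 : (∑ j, c j • b j : W) = 0 := by
      refine Subtype.ext (funext fun v => ?_)
      rw [← hc v]
      have := hlk (Submodule.subset_span ⟨v, rfl⟩)
      simpa [hs₀] using this
    exact funext fun j => Fintype.linearIndependent_iff.1 b.linearIndependent c h0 j
  · let G : BoundaryComplex (convexHull ℝ (Set.range s)) ↪o Set V := OrderEmbedding.ofMapLEIff
      (fun F => s ⁻¹' F.1) (by
        rintro ⟨F, hF⟩ ⟨F', hF'⟩
        refine Iff.trans ?_ (exposed_le_iff hfin hF hF')
        constructor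
        · rintro hh _ ⟨hx, v, rfl⟩
          exact hh hx
        · exact fun hh v hv => hh ⟨hv, v, rfl⟩)
    have hmem : ∀ (l : StrongDual ℝ (EuclideanSpace ℝ (Fin n))) v,
        s v ∈ {x ∈ convexHull ℝ (Set.range s) | ∀ y ∈ convexHull ℝ (Set.range s), l y ≤ l x} ↔
          ∀ w, l (s w) ≤ l (s v) := by
      intro l v
      rw [Set.mem_sep_iff, forall_mem_convexHull_le_iff]
      simp [subset_convexHull ℝ (Set.range s) ⟨v, rfl⟩]
    refine nonempty_orderIso_of_range (OrderEmbedding.ofMapLEIff g hg.le_iff) G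
      (Set.Subset.antisymm ?_ ?_)
    · rintro _ ⟨a, rfl⟩
      obtain ⟨u, hu, hu0, hT⟩ := (hg.range _).1 ⟨a, rfl⟩
      change ∃ F : BoundaryComplex (convexHull ℝ (Set.range s)), s ⁻¹' F.1 = g a
      -- The empty face is exposed by convention and is treated apart: only when `u` has a zero do
      -- its zeros coincide with its minima, that is, with the maxima of `u v₀ - u`.
      rcases (g a).eq_empty_or_nonempty with hne | ⟨v₁, hv₁⟩
      · exact ⟨⟨∅, isExposed_empty⟩, hne.symm⟩
      have hf : u v₀ • (1 : V → ℝ) - u ∈ W :=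
        (hW _).2 ⟨U.sub_mem (U.smul_mem _ hg.one_mem) hu, by simp⟩
      obtain ⟨l, hlf⟩ := hl' _ hf
      refine ⟨⟨_, ContinuousLinearMap.toExposed.isExposed (l := l)⟩, ?_⟩
      ext v
      refine (hmem l v).trans ?_
      rw [hT] at hv₁ ⊢
      simp only [hlf, Pi.sub_apply, Pi.smul_apply, Pi.one_apply, smul_eq_mul, mul_one,
        Set.mem_ofPred_eq, sub_le_sub_iff_left] at hv₁ ⊢
      constructor
      · intro hh
        exact le_antisymm (hv₁ ▸ hh v₁) (hu0 v)
      · intro hv w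
        rw [hv]
        exact hu0 w
    · rintro _ ⟨⟨F, hF⟩, rfl⟩
      refine (hg.range _).2 ?_
      change ∃ u ∈ U, _ ∧ s ⁻¹' F = _
      rcases F.eq_empty_or_nonempty with rfl | hne
      · exact ⟨1, hg.one_mem, fun _ => zero_le_one, by simp⟩
      obtain ⟨l, hlF⟩ := hF hne
      obtain ⟨x, hx⟩ := hne
      obtain ⟨c, hc, -⟩ := hl l.toLinearMap
      have hx' := hx
      rw [hlF] at hx'
      have hmax : ∀ v, l (s v) ≤ l x := fun v => hx'.2 _ (subset_convexHull ℝ _ ⟨v, rfl⟩)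
      have hc' : ∀ v, ((∑ j, c j • b j : W) : V → ℝ) v = l (s v) := fun v => (hc v).symm
      refine ⟨l x • (1 : V → ℝ) - ((∑ j, c j • b j : W) : V → ℝ), U.sub_mem
        (U.smul_mem _ hg.one_mem) ((hW _).1 (∑ j, c j • b j : W).2).1, fun v => ?_, ?_⟩
      · rw [Pi.sub_apply, hc']
        simpa using hmax v
      · ext v
        rw [Set.mem_preimage, hlF, hmem, Set.mem_ofPred_eq, Pi.sub_apply, hc']
        simp only [Pi.smul_apply, Pi.one_apply, smul_eq_mul, mul_one, sub_eq_zero]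
        constructor
        · intro hh
          exact le_antisymm ((forall_mem_convexHull_le_iff l _).2
            (by rintro _ ⟨w, rfl⟩; exact hh w) x hx'.1) (hmax v)
        · intro hh w
          rw [← hh]
          exact hmax w

theorem IsPolytopal.of_orderIso {N : Type*} [PartialOrder N] (h : IsPolytopal M) (e : N ≃o M) :
    IsPolytopal N := by
  obtain ⟨n, S, hS, hi, ⟨e'⟩⟩ := h
  exact ⟨n, S, hS, hi, ⟨e.trans e'⟩⟩

end Polytope

end CPM

namespace CPM

/-! ### Invariance under isomorphism -/

section Invariance

variable {M : Type u} {N : Type v} [PartialOrder M] [BoundedOrder M] [PartialOrder N]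
  [BoundedOrder N] (e : M ≃o N)
include e

theorem dim_orderIso : dim N = dim M := by
  unfold dim
  rw [← e.map_top, rank_orderIso]

omit [BoundedOrder M] [BoundedOrder N] in
theorem mem_vertices_orderIso {x : M} : e x ∈ vertices N ↔ x ∈ vertices M := by
  simp [vertices, rank_orderIso]

theorem excess_orderIso : excess N = excess M := by
  have : vertices N = e '' vertices M := by
    ext y
    obtain ⟨x, rfl⟩ := e.surjective y
    rw [mem_vertices_orderIso]
    exact (e.injective.mem_set_image).symm
  unfold excess
  rw [dim_orderIso e, this, Set.ncard_image_of_injective _ e.injective]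

theorem IsReducible.of_orderIso (h : IsReducible N) : IsReducible M := by
  obtain ⟨y, hy, hσ⟩ := h
  obtain ⟨x, rfl⟩ := e.surjective y
  refine ⟨x, (mem_vertices_orderIso e).1 hy, fun σ hσM hsub => ?_⟩
  have hσN : e σ ∈ facets N := by
    simp only [facets, Set.mem_ofPred_eq] at hσM ⊢
    rw [← e.map_top, rank_orderIso, rank_orderIso, hσM]
  refine hσ _ hσN fun z hz => ?_
  obtain ⟨z, rfl⟩ := e.surjective z
  have hzM := (mem_vertices_orderIso e).1 hz.1
  refine ⟨hz.1, e.monotone (hsub ⟨hzM, ?_⟩).2⟩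
  rcases hz.2 with h1 | ⟨φ, h1, h2, h3⟩
  · exact Or.inl (e.injective h1)
  · refine Or.inr ⟨e.trans (φ.trans e.symm), by simp [h1], by simp [h2], fun w hw h4 h5 => ?_⟩
    simp [h3 (e w) ((mem_vertices_orderIso e).2 hw) (e.injective.ne h4) (e.injective.ne h5)]

end Invariance

/-! ### The families as lattices of sets -/

section Families

instance Join.nontrivial {M N : Type*} [PartialOrder M] [BoundedOrder M] [PartialOrder N]
    [BoundedOrder N] [Nontrivial M] [Nontrivial N] : Nontrivial (Join M N) :=
  ⟨⟨Join.mk ⊥ ⊥ bot_lt_top bot_lt_top, ⊤, Join.mk_lt_top.ne⟩⟩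

theorem singleton_lt_top {α : Type*} [Nontrivial α] (a : α) : ({a} : Set α) < ⊤ := by
  rw [lt_top_iff_ne_top, Set.top_eq_univ, Set.ne_univ_iff_exists_notMem]
  obtain ⟨b, hb⟩ := exists_ne a
  exact ⟨b, hb⟩

/-- Permutations of `α` act on the join, so the vertices coming from `α` lie in one class, while
every facet omits one of them. -/
theorem isReducible_join_set {M : Type u} [PartialOrder M] [BoundedOrder M] [Nontrivial M]
    (hM : IsCellularPseudomanifold M) (α : Type v) [Finite α] [Nontrivial α] :
    IsReducible (Join M (Set α)) := by
  classical
  have hS := isCellularPseudomanifold_set α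
  obtain ⟨a⟩ : Nonempty α := inferInstance
  let f : α → Join M (Set α) := fun a => Join.mk ⊥ {a} bot_lt_top (singleton_lt_top a)
  have hf : ∀ a, f a ∈ vertices (Join M (Set α)) := fun a => by
    change rank _ = 1
    rw [rank_join_mk hM hS, rank_set, hM.rank_bot, Set.ncard_singleton]
  refine ⟨f a, hf a, fun σ hσ hsub => ?_⟩
  obtain rfl | ⟨s, t, hs, ht, rfl⟩ := Join.eq_top_or_mk σ
  · simp [facets] at hσ
  obtain ⟨b, hb⟩ := (Set.ne_univ_iff_exists_notMem _).1 ht.ne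
  have hmem : f b ∈ vertexClass (f a) := by
    refine ⟨hf b, Or.inr ⟨Join.congr (OrderIso.refl M) (Equiv.swap a b).toOrderIsoSet, ?_, ?_, ?_⟩⟩
    · exact Subtype.ext (Prod.ext rfl (by
        change Equiv.swap a b '' {a} = {b}
        simp))
    · exact Subtype.ext (Prod.ext rfl (by
        change Equiv.swap a b '' {b} = {a}
        simp))
    · intro w hw h1 h2
      obtain rfl | ⟨x, s, hx, hs, rfl⟩ := Join.eq_top_or_mk w
      · exact OrderIso.map_top _
      refine Subtype.ext (Prod.ext rfl ?_)
      change Equiv.swap a b '' s = s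
      change rank _ = 1 at hw
      rw [rank_join_mk hM hS, rank_set] at hw
      rcases (show s.ncard = 0 ∨ (s.ncard = 1 ∧ rank x = 0) by omega) with h3 | ⟨h3, h4⟩
      · rw [Set.ncard_eq_zero] at h3
        simp [h3]
      · obtain ⟨c, rfl⟩ := Set.ncard_eq_one.1 h3
        have hx0 : ⊥ = x := hM.eq_of_le_of_rank_le bot_le (by omega)
        subst hx0
        rw [Set.image_singleton, Equiv.swap_apply_of_ne_of_ne]
        · rintro rfl
          exact h1 rfl
        · rintro rfl
          exact h2 rfl
  exact hb ((hsub hmem).2.2 rfl)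

/-- The lattices `((S * S) ⊗ S) * S` for lattices `S` of all subsets of given types. -/
abbrev MixedSet (α β γ ε : Type) : Type := Join (Join (Set α) (Set β) × Set γ) (Set ε)

/-- The joins of three lattices of all subsets of given types. -/
abbrev TripleSet (α β γ : Type) : Type := Join (Join (Set α) (Set β)) (Set γ)

variable (α β γ ε : Type) [Nontrivial α] [Nontrivial β] [Nontrivial ε]

theorem exists_isAtomModel_join_set :
    ∃ f : α ⊕ β → Join (Set α) (Set β), (∀ v, f v < ⊤) ∧ IsAtomModel f (sumRel Eq Eq True) := by
  refine ⟨_, ?_, (isAtomModel_set α).join (isAtomModel_set β) singleton_lt_top singleton_lt_top⟩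
  rintro (v | v)
  exacts [Join.mk_lt_top (ha := singleton_lt_top v) (hb := bot_lt_top),
    Join.mk_lt_top (ha := bot_lt_top) (hb := singleton_lt_top v)]

theorem exists_isAtomModel_tripleSet :
    ∃ f : (α ⊕ β) ⊕ ε → TripleSet α β ε, IsAtomModel f (sumRel (sumRel Eq Eq True) Eq True) := by
  obtain ⟨f, hf, hm⟩ := exists_isAtomModel_join_set α β
  exact ⟨_, hm.join (isAtomModel_set ε) hf singleton_lt_top⟩

theorem exists_isAtomModel_mixedSet : ∃ f : ((α ⊕ β) ⊕ γ) ⊕ ε → MixedSet α β γ ε,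
    IsAtomModel f (sumRel (sumRel (sumRel Eq Eq True) Eq False) Eq True) := by
  obtain ⟨f, hf, hm⟩ := exists_isAtomModel_join_set α β
  refine ⟨_, (hm.prod (isAtomModel_set γ)).join (isAtomModel_set ε) ?_ singleton_lt_top⟩
  rintro (v | v)
  · refine lt_top_iff_ne_top.2 fun hh => (hf v).ne (congrArg Prod.fst hh)
  · refine lt_top_iff_ne_top.2 fun hh => bot_ne_top (congrArg Prod.fst hh)

variable [Finite α] [Finite β] [Finite γ] [Finite ε]

theorem isCellularPseudomanifold_mixedSet : IsCellularPseudomanifold (MixedSet α β γ ε) :=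
  (((isCellularPseudomanifold_set α).join (isCellularPseudomanifold_set β)).prod
    (isCellularPseudomanifold_set γ)).join (isCellularPseudomanifold_set ε)

/-- Each of the two joins lowers the rank by one without losing vertices; this is the source of
excess two. -/
theorem rank_top_mixedSet : rank (⊤ : MixedSet α β γ ε) + 2 =
    Nat.card α + Nat.card β + Nat.card γ + Nat.card ε := by
  have hα := isCellularPseudomanifold_set α
  have hβ := isCellularPseudomanifold_set β
  have hγ := isCellularPseudomanifold_set γ
  have hε := isCellularPseudomanifold_set ε
  have h1 := rank_join_top hα hβ
  have h2 := rank_prod (hα.join hβ) hγ ⊤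
  have h3 := rank_join_top ((hα.join hβ).prod hγ) hε
  simp only [rank_set_top, Prod.fst_top, Prod.snd_top] at h1 h2 h3
  omega

theorem ncard_vertices_mixedSet : (vertices (MixedSet α β γ ε)).ncard =
    Nat.card α + Nat.card β + Nat.card γ + Nat.card ε := by
  obtain ⟨f, hf⟩ := exists_isAtomModel_mixedSet α β γ ε
  rw [hf.ncard_vertices (isCellularPseudomanifold_mixedSet α β γ ε)]
  simp [Nat.card_sum]

theorem dim_mixedSet : dim (MixedSet α β γ ε) =
    Nat.card α + Nat.card β + Nat.card γ + Nat.card ε - 4 := by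
  have := rank_top_mixedSet α β γ ε
  unfold dim
  omega

theorem excess_mixedSet : excess (MixedSet α β γ ε) = 2 := by
  have := ncard_vertices_mixedSet α β γ ε
  have := dim_mixedSet α β γ ε
  unfold excess
  omega

theorem isReducible_mixedSet : IsReducible (MixedSet α β γ ε) :=
  isReducible_join_set (((isCellularPseudomanifold_set α).join
    (isCellularPseudomanifold_set β)).prod (isCellularPseudomanifold_set γ)) ε

theorem isPolytopal_mixedSet : IsPolytopal (MixedSet α β γ ε) := by
  have := Fintype.ofFinite α
  have := Fintype.ofFinite β
  have := Fintype.ofFinite γ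
  have := Fintype.ofFinite ε
  exact ((((isAffineModel_set α).join (isAffineModel_set β)).prod (isAffineModel_set γ)).join
    (isAffineModel_set ε)).isPolytopal

end Families

/-! ### Standard spheres and the order of the parameters -/

section Identification

/-- The standard sphere as the lattice of all subsets of a type. -/
noncomputable def stdSphereIso (b : ℤ) : StdSphere b ≃o Set (Fin (b + 2).toNat) := Fintype.finsetOrderIsoSet

/-- The joins of three standard spheres in terms of lattices of sets. -/
noncomputable def tripleJoinIso (b₁ b₂ b₃ : ℤ) : TripleJoin b₁ b₂ b₃ ≃o
    TripleSet (Fin (b₁ + 2).toNat) (Fin (b₂ + 2).toNat) (Fin (b₃ + 2).toNat) :=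
  Join.congr (Join.congr (stdSphereIso b₁) (stdSphereIso b₂)) (stdSphereIso b₃)

/-- The members of the second family in terms of lattices of sets. -/
noncomputable def mixedJoinIso (d₁ d₂ d₃ d₄ : ℤ) : MixedJoin d₁ d₂ d₃ d₄ ≃o
    MixedSet (Fin (d₁ + 2).toNat) (Fin (d₂ + 2).toNat) (Fin (d₃ + 2).toNat)
      (Fin (d₄ + 2).toNat) :=
  Join.congr (prodCongr (Join.congr (stdSphereIso d₁) (stdSphereIso d₂)) (stdSphereIso d₃))
    (stdSphereIso d₄)

/-- The joins of three standard spheres as degenerate members of the second family. -/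
noncomputable def tripleSetIso (α β ε : Type) : TripleSet α β ε ≃o MixedSet α β (Fin 0) ε :=
  Join.congr (prodSetEmpty _ _) (OrderIso.refl _)

theorem nontrivial_fin_toNat {b : ℤ} (hb : 0 ≤ b) : Nontrivial (Fin (b + 2).toNat) :=
  Fin.nontrivial_iff_two_le.2 (by omega)

/-- The properties of cellular pseudomanifolds isomorphic to a member of the families. -/
theorem properties_of_iso {M : Type u} [PartialOrder M] [BoundedOrder M] {α β γ ε : Type}
    [Nontrivial α] [Nontrivial β] [Nontrivial ε] [Finite α] [Finite β] [Finite γ] [Finite ε]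
    (e : M ≃o MixedSet α β γ ε) {d : ℤ}
    (hd : (Nat.card α + Nat.card β + Nat.card γ + Nat.card ε : ℤ) = d + 4) :
    IsCellularPseudomanifold M ∧ IsReducible M ∧ dim M = d ∧ excess M = 2 :=
  ⟨(isCellularPseudomanifold_mixedSet α β γ ε).of_orderIso e,
    (isReducible_mixedSet α β γ ε).of_orderIso e,
    by rw [← dim_orderIso e, dim_mixedSet]; omega,
    by rw [← excess_orderIso e, excess_mixedSet]⟩

theorem properties_tripleJoin {M : Type u} [PartialOrder M] [BoundedOrder M] {d b₁ b₂ b₃ : ℤ}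
    (hp : TripleParams d b₁ b₂ b₃) (e : M ≃o TripleJoin b₁ b₂ b₃) :
    IsCellularPseudomanifold M ∧ IsReducible M ∧ dim M = d ∧ excess M = 2 := by
  obtain ⟨h1, h2, h3, h4⟩ := hp
  have := nontrivial_fin_toNat h1
  have := nontrivial_fin_toNat (h1.trans h2)
  have := nontrivial_fin_toNat (h1.trans (h2.trans h3))
  refine properties_of_iso (e.trans ((tripleJoinIso _ _ _).trans (tripleSetIso _ _ _))) ?_
  simp only [Nat.card_fin]
  omega

theorem properties_mixedJoin {M : Type u} [PartialOrder M] [BoundedOrder M] {d d₁ d₂ d₃ d₄ : ℤ}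
    (hp : MixedParams d d₁ d₂ d₃ d₄) (e : M ≃o MixedJoin d₁ d₂ d₃ d₄) :
    IsCellularPseudomanifold M ∧ IsReducible M ∧ dim M = d ∧ excess M = 2 := by
  obtain ⟨h1, h2, h3, h4, h5⟩ := hp
  have := nontrivial_fin_toNat h1
  have := nontrivial_fin_toNat (h1.trans h2)
  have := nontrivial_fin_toNat h4
  refine properties_of_iso (e.trans (mixedJoinIso _ _ _ _)) ?_
  simp only [Nat.card_fin]
  omega

theorem isPolytopal_tripleJoin {d b₁ b₂ b₃ : ℤ} (hp : TripleParams d b₁ b₂ b₃) :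
    IsPolytopal (TripleJoin b₁ b₂ b₃) := by
  obtain ⟨h1, h2, h3, h4⟩ := hp
  have := nontrivial_fin_toNat h1
  have := nontrivial_fin_toNat (h1.trans h2)
  have := nontrivial_fin_toNat (h1.trans (h2.trans h3))
  exact (isPolytopal_mixedSet _ _ _ _).of_orderIso
    ((tripleJoinIso _ _ _).trans (tripleSetIso _ _ _))

theorem isPolytopal_mixedJoin {d d₁ d₂ d₃ d₄ : ℤ} (hp : MixedParams d d₁ d₂ d₃ d₄) :
    IsPolytopal (MixedJoin d₁ d₂ d₃ d₄) := by
  obtain ⟨h1, h2, h3, h4, h5⟩ := hp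
  have := nontrivial_fin_toNat h1
  have := nontrivial_fin_toNat (h1.trans h2)
  have := nontrivial_fin_toNat h4
  exact (isPolytopal_mixedSet _ _ _ _).of_orderIso (mixedJoinIso _ _ _ _)

/-- The joins of three standard spheres can be ordered by dimension. -/
theorem exists_sorted_tripleJoin {M : Type u} [PartialOrder M] {d b₁ b₂ b₃ : ℤ} (h₁ : 0 ≤ b₁)
    (h₂ : 0 ≤ b₂) (h₃ : 0 ≤ b₃) (hd : b₁ + b₂ + b₃ = d - 2)
    (e : Nonempty (M ≃o TripleJoin b₁ b₂ b₃)) :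
    ∃ b₁ b₂ b₃ : ℤ, TripleParams d b₁ b₂ b₃ ∧ Nonempty (M ≃o TripleJoin b₁ b₂ b₃) := by
  have key : ∀ {b₁ b₂ b₃ : ℤ}, 0 ≤ b₁ → 0 ≤ b₂ → 0 ≤ b₃ → b₁ + b₂ + b₃ = d - 2 → b₁ ≤ b₃ →
      b₂ ≤ b₃ → Nonempty (M ≃o TripleJoin b₁ b₂ b₃) →
      ∃ b₁ b₂ b₃ : ℤ, TripleParams d b₁ b₂ b₃ ∧ Nonempty (M ≃o TripleJoin b₁ b₂ b₃) := by
    rintro b₁ b₂ b₃ h1 h2 h3 h4 h5 h6 ⟨e⟩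
    rcases le_total b₁ b₂ with h7 | h7
    · exact ⟨b₁, b₂, b₃, ⟨h1, h7, h6, h4⟩, ⟨e⟩⟩
    · exact ⟨b₂, b₁, b₃, ⟨h2, h7, h5, by omega⟩,
        ⟨e.trans (Join.congr Join.comm (OrderIso.refl _))⟩⟩
  obtain ⟨e⟩ := e
  by_cases h4 : b₁ ≤ b₃ ∧ b₂ ≤ b₃
  · exact key h₁ h₂ h₃ hd h4.1 h4.2 ⟨e⟩
  by_cases h5 : b₁ ≤ b₂ ∧ b₃ ≤ b₂
  · exact key h₁ h₃ h₂ (by omega) h5.1 h5.2 ⟨e.trans Join.rightComm⟩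
  -- In the remaining case `b₁` is the largest parameter.
  · exact key h₂ h₃ h₁ (by omega) (by omega) (by omega)
      ⟨e.trans ((Join.congr Join.comm (OrderIso.refl _)).trans Join.rightComm)⟩

theorem mixedJoin_comm {M : Type u} [PartialOrder M] {d d₁ d₂ d₃ d₄ : ℤ}
    (h₁ : 0 ≤ d₁) (h₂ : 0 ≤ d₂) (h₃ : -1 ≤ d₃) (h₄ : 0 ≤ d₄) (hd : d₁ + d₂ + d₃ + d₄ = d - 4)
    (e : Nonempty (M ≃o MixedJoin d₁ d₂ d₃ d₄)) : ∃ d₁ d₂ d₃ d₄ : ℤ,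
      MixedParams d d₁ d₂ d₃ d₄ ∧ Nonempty (M ≃o MixedJoin d₁ d₂ d₃ d₄) := by
  rcases le_total d₁ d₂ with h7 | h7
  · exact ⟨d₁, d₂, d₃, d₄, ⟨h₁, h7, h₃, h₄, hd⟩, e⟩
  · obtain ⟨e⟩ := e
    exact ⟨d₂, d₁, d₃, d₄, ⟨h₂, h7, h₃, h₄, by omega⟩,
      ⟨e.trans (Join.congr (prodCongr Join.comm (OrderIso.refl _)) (OrderIso.refl _))⟩⟩

end Identification

/-! ### The classification -/

section Classification

variable {M : Type u} [PartialOrder M] [BoundedOrder M]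

theorem IsCellularPseudomanifold.ncard_vertices_of_rank_le_two (h : IsCellularPseudomanifold M)
    (hr : rank (⊤ : M) ≤ 2) : (vertices M).ncard ≤ rank (⊤ : M) := by
  rcases (show rank (⊤ : M) = 0 ∨ rank (⊤ : M) = 1 ∨ rank (⊤ : M) = 2 by omega) with h0 | h0 | h0
  · have : vertices M = ∅ := by
      rw [Set.eq_empty_iff_forall_notMem]
      intro v hv
      have := h.rank_mono (le_top (a := v))
      have : rank v = 1 := hv
      omega
    simp [this]
  · have : vertices M ⊆ {⊤} := by
      intro v hv
      exact h.eq_of_le_of_rank_le le_top (by rw [h0]; exact (show rank v = 1 from hv).ge)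
    refine (Set.ncard_le_ncard this).trans ?_
    simp [h0]
  · have hbt : (⊥ : M) < ⊤ := bot_lt_iff_ne_bot.2 fun hh => by
      rw [hh, h.rank_bot] at h0
      omega
    rw [h0, ← h.diamond ⊥ ⊤ hbt (by rw [h.rank_bot, h0])]
    refine Set.ncard_le_ncard (fun v hv => ?_) (h.finite_set _)
    have hv1 : rank v = 1 := hv
    refine ⟨bot_lt_iff_ne_bot.2 ?_, lt_top_iff_ne_top.2 ?_⟩
    · rintro rfl
      rw [h.rank_bot] at hv1
      omega
    · rintro rfl
      omega

/-- Reducibility splits off a Boolean factor, the remaining interval has excess one, and its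
classification finishes the proof. The two families correspond to whether that interval is a
pyramid. -/
theorem exists_iso_of_reducible {d : ℤ} (h : IsCellularPseudomanifold M) (hred : IsReducible M)
    (hdim : dim M = d) (hex : excess M = 2) :
    (∃ b₁ b₂ b₃ : ℤ, TripleParams d b₁ b₂ b₃ ∧ Nonempty (M ≃o TripleJoin b₁ b₂ b₃)) ∨
      (∃ d₁ d₂ d₃ d₄ : ℤ, MixedParams d d₁ d₂ d₃ d₄ ∧
        Nonempty (M ≃o MixedJoin d₁ d₂ d₃ d₄)) := by
  have hfin := h.finite
  have hn : (vertices M).ncard = rank (⊤ : M) + 2 := by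
    unfold excess dim at hex
    omega
  have hr : 2 < rank (⊤ : M) := by
    by_contra hc
    have := h.ncard_vertices_of_rank_le_two (by omega)
    omega
  obtain ⟨p, A, hp, hA, ⟨e⟩⟩ := h.exists_iso_join_of_isReducible hred (by omega)
  have hN := h.Ici p
  have hS := isCellularPseudomanifold_set A
  have hNt : Nontrivial (Set.Ici p) :=
    ⟨⟨⊥, ⊤, fun hh => hp (congrArg Subtype.val hh)⟩⟩
  have hAt : Nontrivial A := Finite.one_lt_card_iff_nontrivial.1 hA
  have hrk := rank_join_top hN hS
  rw [rank_set_top, ← e.map_top, rank_orderIso] at hrk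
  -- If the interval had rank one, all vertices would come from `A`, and `rank ⊤ = card A` would
  -- contradict excess two. Rank at least two makes its vertices proper faces, as the atom model of
  -- a join requires.
  have hr2 : 2 ≤ rank (⊤ : Set.Ici p) := by
    have h1 : 0 < rank (⊤ : Set.Ici p) := by
      rw [← hN.rank_bot]
      exact hN.rank_strictMono bot_lt_top
    by_contra hc
    have hsub : vertices M ⊆ Set.range fun a : A =>
        e.symm (Join.mk ⊥ {a} bot_lt_top (singleton_lt_top a)) := by
      intro v hv
      have hv1 : rank (e v) = 1 := by rw [rank_orderIso]; exact hv
      obtain hh | ⟨x, s, hx, hs, hh⟩ := Join.eq_top_or_mk (e v)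
      · rw [hh, ← e.map_top, rank_orderIso] at hv1
        omega
      · have hx' := hN.rank_strictMono hx
        rw [hh, rank_join_mk hN hS, rank_set] at hv1
        have hx0 : ⊥ = x := hN.eq_of_le_of_rank_le bot_le (by omega)
        obtain ⟨a, rfl⟩ := Set.ncard_eq_one.1 (show s.ncard = 1 by omega)
        subst hx0
        exact ⟨a, by rw [OrderIso.symm_apply_eq, hh]⟩
    have h2 := Set.ncard_le_ncard hsub (h.finite_set _)
    rw [← Set.image_univ] at h2
    have h3 := Set.ncard_image_le (f := fun a : A =>
      e.symm (Join.mk ⊥ {a} bot_lt_top (singleton_lt_top a))) (Set.finite_univ)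
    rw [Set.ncard_univ] at h3
    omega
  have hnN : (vertices (Set.Ici p)).ncard = rank (⊤ : Set.Ici p) + 1 := by
    have hm := hN.isAtomModel
    have hne : Nonempty (vertices (Set.Ici p)) := by
      have h1 := hN.rank_top_le
      have : (vertices (Set.Ici p)).Nonempty := Set.nonempty_of_ncard_ne_zero (by omega)
      exact this.to_subtype
    have hj := hm.join (isAtomModel_set A) (fun v => lt_top_iff_ne_top.2 fun hh => by
      have : rank (v : Set.Ici p) = 1 := v.2
      rw [hh] at this
      omega) singleton_lt_top
    have h1 := (hj.of_orderIso e.symm).ncard_vertices h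
    rw [Nat.card_sum, Nat.card_coe_set_eq] at h1
    omega
  obtain ⟨a, b, c, ha, hb, ⟨e₁⟩⟩ :=
    IsCellularPseudomanifold.nonempty_iso_of_excess_one _ hN rfl hnN
  have hd : (a + b + c + Nat.card A : ℤ) = d + 4 := by
    have hat := Fin.nontrivial_iff_two_le.2 ha
    have hbt := Fin.nontrivial_iff_two_le.2 hb
    have e₂ := e.trans ((Join.congr e₁ (OrderIso.refl _)).trans (Join.congr (OrderIso.refl _)
      (Finite.equivFin A).toOrderIsoSet))
    have hct := Fin.nontrivial_iff_two_le.2 hA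
    have h1 := dim_orderIso e₂
    rw [dim_mixedSet, hdim] at h1
    simp only [Nat.card_fin] at h1
    omega
  obtain ⟨i₁⟩ := nonempty_stdSphere_iso (α := Fin a) (b := a - 2) (by simp)
  obtain ⟨i₂⟩ := nonempty_stdSphere_iso (α := Fin b) (b := b - 2) (by simp)
  obtain ⟨i₄⟩ := nonempty_stdSphere_iso (α := A) (b := Nat.card A - 2) (by simp)
  rcases Nat.eq_zero_or_pos c with rfl | hc
  · left
    refine exists_sorted_tripleJoin (b₁ := a - 2) (b₂ := b - 2) (b₃ := Nat.card A - 2) (by omega)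
      (by omega) (by omega) (by push_cast at hd; omega) ⟨e.trans (Join.congr ?_ i₄)⟩
    exact (e₁.trans (prodSetEmpty _ _).symm).trans (Join.congr i₁ i₂)
  · right
    obtain ⟨i₃⟩ := nonempty_stdSphere_iso (α := Fin c) (b := c - 2) (by simp)
    refine mixedJoin_comm (d₁ := a - 2) (d₂ := b - 2) (d₃ := c - 2) (d₄ := Nat.card A - 2)
      (by omega) (by omega) (by omega) (by omega) (by omega) ⟨e.trans (Join.congr ?_ i₄)⟩
    exact e₁.trans (prodCongr (Join.congr i₁ i₂) i₃)

end Classification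

end CPM

namespace CPM

/-! ### Recovering the parameters -/

section NonIso

/-- A bijection between labelled sets respecting relations which come from twin-free graphs on the
labels induces a bijection between the labels. -/
theorem exists_label_equiv {V W ι κ : Type} {lab : V → ι} {lab' : W → κ}
    (hlab : Function.Surjective lab) (hlab' : Function.Surjective lab') {R : V → V → Prop}
    {S : W → W → Prop} {H : ι → ι → Prop} {H' : κ → κ → Prop}
    (hR : ∀ v w, R v w ↔ v = w ∨ H (lab v) (lab w))
    (hS : ∀ v w, S v w ↔ v = w ∨ H' (lab' v) (lab' w))
    (hH : ∀ i, ¬ H i i) (hH' : ∀ i, ¬ H' i i)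
    (htw : ∀ i j, (∀ k, H i k ↔ H j k) → i = j) (htw' : ∀ i j, (∀ k, H' i k ↔ H' j k) → i = j)
    (φ : V ≃ W) (hφ : ∀ v w, R v w ↔ S (φ v) (φ w)) :
    ∃ π : ι ≃ κ, (∀ i j, H i j ↔ H' (π i) (π j)) ∧
      ∀ i, Nat.card {v // lab v = i} = Nat.card {w // lab' w = π i} := by
  have key : ∀ v w, H (lab v) (lab w) ↔ H' (lab' (φ v)) (lab' (φ w)) := by
    intro v w
    by_cases hvw : v = w
    · subst hvw
      exact iff_of_false (hH _) (hH' _)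
    · have h1 := hR v w
      have h2 := hS (φ v) (φ w)
      simp only [hvw, false_or, φ.injective.eq_iff] at h1 h2
      rw [← h1, ← h2, hφ]
  -- Labels are the twin classes of the relation, because the label graphs are twin-free.
  have hlabels : ∀ v w, lab v = lab w ↔ lab' (φ v) = lab' (φ w) := by
    intro v w
    constructor
    · intro h
      refine htw' _ _ fun k => ?_
      obtain ⟨x, rfl⟩ := hlab' k
      obtain ⟨x, rfl⟩ := φ.surjective x
      rw [← key, ← key, h]
    · intro h
      refine htw _ _ fun k => ?_
      obtain ⟨x, rfl⟩ := hlab k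
      rw [key, key, h]
  choose s hs using hlab
  have hπ : ∀ v, lab' (φ (s (lab v))) = lab' (φ v) := fun v => (hlabels _ _).1 (hs _)
  let π : ι ≃ κ := Equiv.ofBijective (fun i => lab' (φ (s i))) (by
    constructor
    · intro i j hij
      have := (hlabels _ _).2 hij
      rwa [hs, hs] at this
    · intro k
      obtain ⟨x, rfl⟩ := hlab' k
      obtain ⟨x, rfl⟩ := φ.surjective x
      exact ⟨lab x, hπ x⟩)
  have hπ' : ∀ v, π (lab v) = lab' (φ v) := hπ
  refine ⟨π, fun i j => ?_, fun i => Nat.card_congr (φ.subtypeEquiv fun v => ?_)⟩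
  · rw [← hs i, ← hs j, hπ', hπ', ← key]
  · rw [← hπ', π.injective.eq_iff]

theorem card_fiber {V ι α : Type} {lab : V → ι} {i : ι} (f : α → V) (hf : Function.Injective f)
    (h : ∀ v, lab v = i ↔ ∃ a, f a = v) : Nat.card {v // lab v = i} = Nat.card α :=
  (Nat.card_congr ((Equiv.ofInjective f hf).trans (Equiv.subtypeEquivRight fun v => (h v).symm))).symm

/-- The factors of a triple join, as labels of its vertices. -/
def tripleLabel {α β ε : Type} : (α ⊕ β) ⊕ ε → Fin 3 :=
  Sum.elim (Sum.elim (fun _ => 0) (fun _ => 1)) (fun _ => 2)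

/-- The factors of a member of the second family, as labels of its vertices. -/
def mixedLabel {α β γ ε : Type} : ((α ⊕ β) ⊕ γ) ⊕ ε → Fin 4 :=
  Sum.elim (Sum.elim (Sum.elim (fun _ => 0) (fun _ => 1)) (fun _ => 2)) (fun _ => 3)

/-- The pairs of factors of a member of the second family which contain vertices that are both
missed by a facet. -/
def mixedGraph (i j : Fin 4) : Prop := i ≠ j ∧ (i = 2 → j = 3) ∧ (j = 2 → i = 3)

instance : DecidableRel mixedGraph := fun i j =>
  inferInstanceAs (Decidable (i ≠ j ∧ (i = 2 → j = 3) ∧ (j = 2 → i = 3)))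

section

variable {α β γ ε : Type}

theorem tripleLabel_surjective [Nonempty α] [Nonempty β] [Nonempty ε] :
    Function.Surjective (tripleLabel (α := α) (β := β) (ε := ε)) := by
  intro i
  fin_cases i
  · exact ⟨.inl (.inl (Classical.arbitrary α)), rfl⟩
  · exact ⟨.inl (.inr (Classical.arbitrary β)), rfl⟩
  · exact ⟨.inr (Classical.arbitrary ε), rfl⟩

theorem mixedLabel_surjective [Nonempty α] [Nonempty β] [Nonempty γ] [Nonempty ε] :
    Function.Surjective (mixedLabel (α := α) (β := β) (γ := γ) (ε := ε)) := by
  intro i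
  fin_cases i
  · exact ⟨.inl (.inl (.inl (Classical.arbitrary α))), rfl⟩
  · exact ⟨.inl (.inl (.inr (Classical.arbitrary β))), rfl⟩
  · exact ⟨.inl (.inr (Classical.arbitrary γ)), rfl⟩
  · exact ⟨.inr (Classical.arbitrary ε), rfl⟩

theorem tripleRel_iff (v w : (α ⊕ β) ⊕ ε) : sumRel (sumRel Eq Eq True) Eq True v w ↔
    v = w ∨ tripleLabel v ≠ tripleLabel w := by
  rcases v with (v | v) | v <;> rcases w with (w | w) | w <;> simp [sumRel, tripleLabel]

theorem mixedRel_iff (v w : ((α ⊕ β) ⊕ γ) ⊕ ε) :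
    sumRel (sumRel (sumRel Eq Eq True) Eq False) Eq True v w ↔
      v = w ∨ mixedGraph (mixedLabel v) (mixedLabel w) := by
  rcases v with ((v | v) | v) | v <;> rcases w with ((w | w) | w) | w <;>
    simp [sumRel, mixedLabel, mixedGraph]

theorem card_tripleLabel (i : Fin 3) :
    Nat.card {v : (α ⊕ β) ⊕ ε // tripleLabel v = i} =
      ![Nat.card α, Nat.card β, Nat.card ε] i := by
  fin_cases i
  · refine card_fiber (fun a => .inl (.inl a)) (Sum.inl_injective.comp Sum.inl_injective) ?_
    rintro ((v | v) | v) <;> simp [tripleLabel]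
  · refine card_fiber (fun a => .inl (.inr a)) (Sum.inl_injective.comp Sum.inr_injective) ?_
    rintro ((v | v) | v) <;> simp [tripleLabel]
  · refine card_fiber (fun a => .inr a) Sum.inr_injective ?_
    rintro ((v | v) | v) <;> simp [tripleLabel]

theorem card_mixedLabel (i : Fin 4) :
    Nat.card {v : ((α ⊕ β) ⊕ γ) ⊕ ε // mixedLabel v = i} =
      ![Nat.card α, Nat.card β, Nat.card γ, Nat.card ε] i := by
  fin_cases i
  · refine card_fiber (fun a => .inl (.inl (.inl a)))
      (Sum.inl_injective.comp (Sum.inl_injective.comp Sum.inl_injective)) ?_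
    rintro (((v | v) | v) | v) <;> simp [mixedLabel]
  · refine card_fiber (fun a => .inl (.inl (.inr a)))
      (Sum.inl_injective.comp (Sum.inl_injective.comp Sum.inr_injective)) ?_
    rintro (((v | v) | v) | v) <;> simp [mixedLabel]
  · refine card_fiber (fun a => .inl (.inr a)) (Sum.inl_injective.comp Sum.inr_injective) ?_
    rintro (((v | v) | v) | v) <;> simp [mixedLabel]
  · refine card_fiber (fun a => .inr a) Sum.inr_injective ?_
    rintro (((v | v) | v) | v) <;> simp [mixedLabel]

end

theorem ne_twin_free (i j : Fin 3) (h : ∀ k, i ≠ k ↔ j ≠ k) : i = j := by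
  by_contra hij
  exact (h j).1 hij rfl

theorem mixedGraph_twin_free : ∀ i j : Fin 4, (∀ k, mixedGraph i k ↔ mixedGraph j k) → i = j := by
  decide

/-- The label graph is the triangle on 0, 1, 3 with the pendant vertex 2 attached to 3. Its only
nontrivial symmetry interchanges 0 and 1, which is why only the first two parameters need to be
ordered. -/
theorem mixedGraph_automorphism : ∀ x₀ x₁ x₂ x₃ : Fin 4, mixedGraph x₀ x₁ → mixedGraph x₀ x₃ →
    mixedGraph x₁ x₃ → mixedGraph x₂ x₃ → ¬ mixedGraph x₀ x₂ → ¬ mixedGraph x₁ x₂ → x₀ ≠ x₂ →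
    x₁ ≠ x₂ → x₂ = 2 ∧ x₃ = 3 ∧ (x₀ = 0 ∧ x₁ = 1 ∨ x₀ = 1 ∧ x₁ = 0) := by
  decide

/-- The class sizes are recovered up to a permutation of the three labels; the ordering of the
parameters removes it. -/
theorem tripleJoin_injective {d b₁ b₂ b₃ c₁ c₂ c₃ : ℤ} (hb : TripleParams d b₁ b₂ b₃)
    (hc : TripleParams d c₁ c₂ c₃)
    (e : Nonempty (TripleJoin b₁ b₂ b₃ ≃o TripleJoin c₁ c₂ c₃)) :
    b₁ = c₁ ∧ b₂ = c₂ ∧ b₃ = c₃ := by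
  obtain ⟨e⟩ := e
  obtain ⟨h1, h2, h3, h4⟩ := hb
  obtain ⟨g1, g2, g3, g4⟩ := hc
  have := nontrivial_fin_toNat h1
  have := nontrivial_fin_toNat (h1.trans h2)
  have := nontrivial_fin_toNat (h1.trans (h2.trans h3))
  have := nontrivial_fin_toNat g1
  have := nontrivial_fin_toNat (g1.trans g2)
  have := nontrivial_fin_toNat (g1.trans (g2.trans g3))
  obtain ⟨f, hf⟩ := exists_isAtomModel_tripleSet (Fin (b₁ + 2).toNat) (Fin (b₂ + 2).toNat)
    (Fin (b₃ + 2).toNat)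
  obtain ⟨g, hg⟩ := exists_isAtomModel_tripleSet (Fin (c₁ + 2).toNat) (Fin (c₂ + 2).toNat)
    (Fin (c₃ + 2).toNat)
  obtain ⟨φ, hφ⟩ := (hf.of_orderIso ((tripleJoinIso _ _ _).symm.trans
    (e.trans (tripleJoinIso _ _ _)))).exists_equiv hg
  obtain ⟨π, -, hπ⟩ := exists_label_equiv tripleLabel_surjective tripleLabel_surjective
    tripleRel_iff tripleRel_iff (by simp) (by simp) ne_twin_free ne_twin_free φ hφ
  simp only [card_tripleLabel, Nat.card_fin] at hπ
  have n1 : π 0 ≠ π 1 := π.injective.ne (by decide)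
  have n2 : π 0 ≠ π 2 := π.injective.ne (by decide)
  have n3 : π 1 ≠ π 2 := π.injective.ne (by decide)
  have e0 := hπ 0
  have e1 := hπ 1
  have e2 := hπ 2
  generalize π 0 = x at *
  generalize π 1 = y at *
  generalize π 2 = z at *
  fin_cases x <;> fin_cases y <;> fin_cases z <;> simp at n1 n2 n3 e0 e1 e2 <;> omega

theorem mixedJoin_injective {d d₁ d₂ d₃ d₄ e₁ e₂ e₃ e₄ : ℤ} (hb : MixedParams d d₁ d₂ d₃ d₄)
    (hc : MixedParams d e₁ e₂ e₃ e₄)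
    (e : Nonempty (MixedJoin d₁ d₂ d₃ d₄ ≃o MixedJoin e₁ e₂ e₃ e₄)) :
    d₁ = e₁ ∧ d₂ = e₂ ∧ d₃ = e₃ ∧ d₄ = e₄ := by
  obtain ⟨e⟩ := e
  obtain ⟨h1, h2, h3, h4, h5⟩ := hb
  obtain ⟨g1, g2, g3, g4, g5⟩ := hc
  have := nontrivial_fin_toNat h1
  have := nontrivial_fin_toNat (h1.trans h2)
  have := nontrivial_fin_toNat h4
  have := nontrivial_fin_toNat g1
  have := nontrivial_fin_toNat (g1.trans g2)
  have := nontrivial_fin_toNat g4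
  -- The bound `-1 ≤ d₃` makes the third twin class nonempty, so that all four labels occur.
  have : Nonempty (Fin (d₃ + 2).toNat) := ⟨⟨0, by omega⟩⟩
  have : Nonempty (Fin (e₃ + 2).toNat) := ⟨⟨0, by omega⟩⟩
  obtain ⟨f, hf⟩ := exists_isAtomModel_mixedSet (Fin (d₁ + 2).toNat) (Fin (d₂ + 2).toNat)
    (Fin (d₃ + 2).toNat) (Fin (d₄ + 2).toNat)
  obtain ⟨g, hg⟩ := exists_isAtomModel_mixedSet (Fin (e₁ + 2).toNat) (Fin (e₂ + 2).toNat)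
    (Fin (e₃ + 2).toNat) (Fin (e₄ + 2).toNat)
  obtain ⟨φ, hφ⟩ := (hf.of_orderIso ((mixedJoinIso _ _ _ _).symm.trans
    (e.trans (mixedJoinIso _ _ _ _)))).exists_equiv hg
  obtain ⟨π, hH, hπ⟩ := exists_label_equiv mixedLabel_surjective mixedLabel_surjective
    mixedRel_iff mixedRel_iff (by decide) (by decide) mixedGraph_twin_free mixedGraph_twin_free
    φ hφ
  simp only [card_mixedLabel, Nat.card_fin] at hπ
  have hm := mixedGraph_automorphism (π 0) (π 1) (π 2) (π 3) ((hH _ _).1 (by decide))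
    ((hH _ _).1 (by decide)) ((hH _ _).1 (by decide)) ((hH _ _).1 (by decide))
    (mt (hH _ _).2 (by decide)) (mt (hH _ _).2 (by decide)) (π.injective.ne (by decide))
    (π.injective.ne (by decide))
  have q0 := hπ 0
  have q1 := hπ 1
  have q2 := hπ 2
  have q3 := hπ 3
  obtain ⟨m2, m3, ⟨m0, m1⟩ | ⟨m0, m1⟩⟩ := hm <;> rw [m0] at q0 <;> rw [m1] at q1 <;>
    rw [m2] at q2 <;> rw [m3] at q3 <;> simp at q0 q1 q2 q3 <;> omega

/-- Three twin classes on one side, four on the other. -/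
theorem isEmpty_tripleJoin_iso_mixedJoin {d b₁ b₂ b₃ d₁ d₂ d₃ d₄ : ℤ}
    (hb : TripleParams d b₁ b₂ b₃) (hc : MixedParams d d₁ d₂ d₃ d₄) :
    IsEmpty (TripleJoin b₁ b₂ b₃ ≃o MixedJoin d₁ d₂ d₃ d₄) := by
  refine ⟨fun e => ?_⟩
  obtain ⟨h1, h2, h3, h4⟩ := hb
  obtain ⟨g1, g2, g3, g4, g5⟩ := hc
  have := nontrivial_fin_toNat h1
  have := nontrivial_fin_toNat (h1.trans h2)
  have := nontrivial_fin_toNat (h1.trans (h2.trans h3))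
  have := nontrivial_fin_toNat g1
  have := nontrivial_fin_toNat (g1.trans g2)
  have := nontrivial_fin_toNat g4
  have : Nonempty (Fin (d₃ + 2).toNat) := ⟨⟨0, by omega⟩⟩
  obtain ⟨f, hf⟩ := exists_isAtomModel_tripleSet (Fin (b₁ + 2).toNat) (Fin (b₂ + 2).toNat)
    (Fin (b₃ + 2).toNat)
  obtain ⟨g, hg⟩ := exists_isAtomModel_mixedSet (Fin (d₁ + 2).toNat) (Fin (d₂ + 2).toNat)
    (Fin (d₃ + 2).toNat) (Fin (d₄ + 2).toNat)
  obtain ⟨φ, hφ⟩ := (hf.of_orderIso ((tripleJoinIso _ _ _).symm.trans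
    (e.trans (mixedJoinIso _ _ _ _)))).exists_equiv hg
  obtain ⟨π, -, -⟩ := exists_label_equiv tripleLabel_surjective mixedLabel_surjective
    tripleRel_iff mixedRel_iff (by simp) (by decide) ne_twin_free mixedGraph_twin_free φ hφ
  have := Fintype.card_congr π
  simp at this

end NonIso

/-! ### Counting the parameters -/

section Count

/-- The parameters of the first family. -/
def tripleParamSet (d : ℤ) : Set (ℤ × ℤ × ℤ) := {b | TripleParams d b.1 b.2.1 b.2.2}

/-- The parameters of the second family. -/
def mixedParamSet (d : ℤ) : Set (ℤ × ℤ × ℤ × ℤ) :=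
  {q | MixedParams d q.1 q.2.1 q.2.2.1 q.2.2.2}

/-- The parameters of the second family with last parameter zero. -/
def mixedParamSetZero (d : ℤ) : Set (ℤ × ℤ × ℤ) := {q | MixedParams d q.1 q.2.1 q.2.2 0}

theorem finite_tripleParamSet (d : ℤ) : (tripleParamSet d).Finite := by
  refine (Set.finite_Icc ((0, 0, 0) : ℤ × ℤ × ℤ) (d, d, d)).subset ?_
  rintro ⟨a, b, c⟩ ⟨h1, h2, h3, h4⟩
  simp only at h1 h2 h3 h4
  simp only [Set.mem_Icc, Prod.mk_le_mk]
  omega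

theorem finite_mixedParamSet (d : ℤ) : (mixedParamSet d).Finite := by
  refine (Set.finite_Icc ((0, 0, -1, 0) : ℤ × ℤ × ℤ × ℤ) (d, d, d, d)).subset ?_
  rintro ⟨a, b, c, e⟩ ⟨h1, h2, h3, h4, h5⟩
  simp only at h1 h2 h3 h4 h5
  simp only [Set.mem_Icc, Prod.mk_le_mk]
  omega

theorem finite_mixedParamSetZero (d : ℤ) : (mixedParamSetZero d).Finite := by
  refine (Set.finite_Icc ((0, 0, -1) : ℤ × ℤ × ℤ) (d, d, d)).subset ?_
  rintro ⟨a, b, c⟩ ⟨h1, h2, h3, h4, h5⟩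
  simp only at h1 h2 h3 h4 h5
  simp only [Set.mem_Icc, Prod.mk_le_mk]
  omega

theorem ncard_eq_add {α β γ : Type} {S : Set α} {S₁ : Set β} {S₂ : Set γ} (f : β → α) (g : γ → α)
    (hf : Function.Injective f) (hg : Function.Injective g) (h₁ : S₁.Finite) (h₂ : S₂.Finite)
    (hS : ∀ x, x ∈ S ↔ (∃ y ∈ S₁, f y = x) ∨ ∃ z ∈ S₂, g z = x)
    (hd : ∀ y ∈ S₁, ∀ z ∈ S₂, f y ≠ g z) : S.ncard = S₁.ncard + S₂.ncard := by
  have : S = f '' S₁ ∪ g '' S₂ := Set.ext hS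
  rw [this, Set.ncard_union_eq _ (h₁.image f) (h₂.image g), Set.ncard_image_of_injective _ hf,
    Set.ncard_image_of_injective _ hg]
  rw [Set.disjoint_left]
  rintro _ ⟨y, hy, rfl⟩ ⟨z, hz, h⟩
  exact hd y hy z hz h.symm

theorem ncard_Icc_int (k : ℤ) : (Set.Icc 0 k).ncard = (k + 1).toNat := by
  rw [← Finset.coe_Icc, Set.ncard_coe_finset, Int.card_Icc]
  simp

theorem ncard_tripleParamSet_of_lt {d : ℤ} (hd : d < 2) : (tripleParamSet d).ncard = 0 := by
  rw [Set.ncard_eq_zero (finite_tripleParamSet d), Set.eq_empty_iff_forall_notMem]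
  rintro ⟨a, b, c⟩ ⟨h1, h2, h3, h4⟩
  simp only at h1 h2 h3 h4
  omega

/-- Either all parameters are positive and can be lowered by one, or the first vanishes and the
second ranges over `0, …, (d + 1) / 2`. -/
theorem ncard_tripleParamSet_add_three {d : ℤ} (hd : -1 ≤ d) :
    ((tripleParamSet (d + 3)).ncard : ℤ) = (tripleParamSet d).ncard + (d + 3) / 2 := by
  have := ncard_eq_add (S := tripleParamSet (d + 3)) (S₁ := tripleParamSet d)
    (S₂ := Set.Icc 0 ((d + 1) / 2)) (fun b => (b.1 + 1, b.2.1 + 1, b.2.2 + 1))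
    (fun x => (0, x, d + 1 - x)) ?_ ?_ (finite_tripleParamSet d) (Set.finite_Icc _ _) ?_ ?_
  · rw [this, ncard_Icc_int]
    omega
  · rintro ⟨a, b, c⟩ ⟨a', b', c'⟩ h
    simpa using h
  · intro a b h
    simp only [Prod.mk.injEq] at h
    exact h.2.1
  · rintro ⟨a, b, c⟩
    simp only [tripleParamSet, TripleParams, Set.mem_ofPred_eq, Set.mem_Icc, Prod.exists,
      Prod.mk.injEq]
    constructor
    · rintro ⟨h1, h2, h3, h4⟩
      by_cases h0 : a = 0
      · exact Or.inr ⟨b, by omega⟩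
      · exact Or.inl ⟨a - 1, b - 1, c - 1, by omega⟩
    · rintro (⟨x, y, z, h⟩ | ⟨x, h⟩) <;> omega
  · rintro ⟨a, b, c⟩ ⟨h1, -⟩ z - h
    simp only [Prod.mk.injEq] at h h1
    omega

theorem ncard_mixedParamSetZero_of_lt {d : ℤ} (hd : d < 3) :
    (mixedParamSetZero d).ncard = 0 := by
  rw [Set.ncard_eq_zero (finite_mixedParamSetZero d), Set.eq_empty_iff_forall_notMem]
  rintro ⟨a, b, c⟩ ⟨h1, h2, h3, h4, h5⟩
  simp only at h1 h2 h3 h4 h5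
  omega

/-- Either the third parameter can be lowered, or it is `-1` and the first two sum to `d - 2`. -/
theorem ncard_mixedParamSetZero_add_one {d : ℤ} (hd : 0 ≤ d) :
    ((mixedParamSetZero (d + 1)).ncard : ℤ) = (mixedParamSetZero d).ncard + d / 2 := by
  have := ncard_eq_add (S := mixedParamSetZero (d + 1)) (S₁ := mixedParamSetZero d)
    (S₂ := Set.Icc 0 ((d - 2) / 2)) (fun b => (b.1, b.2.1, b.2.2 + 1))
    (fun x => (x, d - 2 - x, -1)) ?_ ?_ (finite_mixedParamSetZero d) (Set.finite_Icc _ _) ?_ ?_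
  · rw [this, ncard_Icc_int]
    omega
  · rintro ⟨a, b, c⟩ ⟨a', b', c'⟩ h
    simpa using h
  · intro a b h
    simp only [Prod.mk.injEq] at h
    exact h.1
  · rintro ⟨a, b, c⟩
    simp only [mixedParamSetZero, MixedParams, Set.mem_ofPred_eq, Set.mem_Icc, Prod.exists,
      Prod.mk.injEq]
    constructor
    · rintro ⟨h1, h2, h3, h4⟩
      by_cases h0 : c = -1
      · exact Or.inr ⟨a, by omega⟩
      · exact Or.inl ⟨a, b, c - 1, by omega⟩
    · rintro (⟨x, y, z, h⟩ | ⟨x, h⟩) <;> omega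
  · rintro ⟨a, b, c⟩ ⟨h1, h2, h3, -⟩ z - h
    simp only [Prod.mk.injEq] at h h3
    omega

theorem ncard_mixedParamSet_of_lt {d : ℤ} (hd : d < 3) : (mixedParamSet d).ncard = 0 := by
  rw [Set.ncard_eq_zero (finite_mixedParamSet d), Set.eq_empty_iff_forall_notMem]
  rintro ⟨a, b, c, e⟩ ⟨h1, h2, h3, h4, h5⟩
  simp only at h1 h2 h3 h4 h5
  omega

/-- Either the fourth parameter can be lowered, or it is zero. -/
theorem ncard_mixedParamSet_add_one (d : ℤ) :
    (mixedParamSet (d + 1)).ncard = (mixedParamSet d).ncard +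
      (mixedParamSetZero (d + 1)).ncard := by
  refine ncard_eq_add (fun b => (b.1, b.2.1, b.2.2.1, b.2.2.2 + 1))
    (fun b => (b.1, b.2.1, b.2.2, 0)) ?_ ?_ (finite_mixedParamSet d)
    (finite_mixedParamSetZero _) ?_ ?_
  · rintro ⟨a, b, c⟩ ⟨a', b', c'⟩ h
    simpa [Prod.ext_iff] using h
  · rintro ⟨a, b, c⟩ ⟨a', b', c'⟩ h
    simpa using h
  · rintro ⟨a, b, c, e⟩
    simp only [mixedParamSetZero, mixedParamSet, MixedParams, Set.mem_ofPred_eq, Prod.exists,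
      Prod.mk.injEq]
    constructor
    · rintro ⟨h1, h2, h3, h4⟩
      by_cases h0 : e = 0
      · exact Or.inr ⟨a, b, c, by omega⟩
      · exact Or.inl ⟨a, b, c, e - 1, by omega⟩
    · rintro (⟨x, y, z, t, h⟩ | ⟨x, y, z, h⟩) <;> omega
  · rintro ⟨a, b, c, e⟩ ⟨h1, h2, h3, h4, -⟩ z - h
    simp only [Prod.mk.injEq] at h h4
    omega

theorem ncard_tripleParamSet (j : ℕ) (i c : ℤ) (hi : 0 ≤ i)
    (hc : ((tripleParamSet i).ncard : ℤ) = c) :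
    ((tripleParamSet (6 * j + i)).ncard : ℤ) = 3 * j ^ 2 + (i + 1) * j + c := by
  induction j with
  | zero => simpa using hc
  | succ j ih =>
    have h1 := ncard_tripleParamSet_add_three (d := 6 * j + i) (by omega)
    have h2 := ncard_tripleParamSet_add_three (d := 6 * j + i + 3) (by omega)
    rw [show (6 * ((j + 1 : ℕ) : ℤ) + i) = 6 * j + i + 3 + 3 by push_cast; ring, h2, h1, ih]
    -- The two numerators have opposite parity, so the rounding losses add up to exactly one half;
    -- hence the period 6.
    have h3 : (6 * (j : ℤ) + i + 3) / 2 + (6 * j + i + 3 + 3) / 2 = 6 * j + i + 4 := by omega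
    push_cast
    linear_combination h3

theorem ncard_tripleParamSet_small : ((tripleParamSet 0).ncard : ℤ) = 0 ∧
    ((tripleParamSet 1).ncard : ℤ) = 0 ∧ ((tripleParamSet 2).ncard : ℤ) = 1 ∧
    ((tripleParamSet 3).ncard : ℤ) = 1 ∧ ((tripleParamSet 4).ncard : ℤ) = 2 ∧
    ((tripleParamSet 5).ncard : ℤ) = 3 := by
  have h0 := ncard_tripleParamSet_of_lt (d := -1) (by norm_num)
  have h1 := ncard_tripleParamSet_of_lt (d := 0) (by norm_num)
  have h2 := ncard_tripleParamSet_of_lt (d := 1) (by norm_num)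
  have h3 := ncard_tripleParamSet_add_three (d := -1) (by norm_num)
  have h4 := ncard_tripleParamSet_add_three (d := 0) (by norm_num)
  have h5 := ncard_tripleParamSet_add_three (d := 1) (by norm_num)
  rw [show (-1 : ℤ) + 3 = 2 by norm_num, h0] at h3
  rw [show (0 : ℤ) + 3 = 3 by norm_num, h1] at h4
  rw [show (1 : ℤ) + 3 = 4 by norm_num, h2] at h5
  have h6 := ncard_tripleParamSet_add_three (d := 2) (by norm_num)
  rw [show (2 : ℤ) + 3 = 5 by norm_num] at h6
  refine ⟨?_, ?_, ?_, ?_, ?_, ?_⟩ <;> omega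

theorem ncard_mixedParamSetZero_even_odd (j : ℕ) :
    ((mixedParamSetZero (2 * j)).ncard : ℤ) = j ^ 2 - j ∧
      ((mixedParamSetZero (2 * j + 1)).ncard : ℤ) = j ^ 2 := by
  induction j with
  | zero => simp [ncard_mixedParamSetZero_of_lt]
  | succ j ih =>
    have h1 := ncard_mixedParamSetZero_add_one (d := 2 * j + 1) (by omega)
    have h2 := ncard_mixedParamSetZero_add_one (d := 2 * j + 1 + 1) (by omega)
    rw [show (2 * ((j + 1 : ℕ) : ℤ)) = 2 * j + 1 + 1 by push_cast; ring, h2, h1, ih.2]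
    have h3 : (2 * (j : ℤ) + 1) / 2 = j := by omega
    have h4 : (2 * (j : ℤ) + 1 + 1) / 2 = j + 1 := by omega
    rw [h3, h4]
    push_cast
    constructor <;> ring

theorem ncard_mixedParamSet_even_odd (j : ℕ) :
    6 * ((mixedParamSet (2 * j)).ncard : ℤ) = 4 * j ^ 3 - 3 * j ^ 2 - j ∧
      6 * ((mixedParamSet (2 * j + 1)).ncard : ℤ) = j * (j + 1) * (4 * j - 1) := by
  induction j with
  | zero => simp [ncard_mixedParamSet_of_lt]
  | succ j ih =>
    have h1 := ncard_mixedParamSet_add_one (2 * j + 1)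
    have h2 := ncard_mixedParamSet_add_one (2 * j + 1 + 1)
    have h3 := ncard_mixedParamSetZero_even_odd (j + 1)
    rw [show (2 * ((j + 1 : ℕ) : ℤ)) = 2 * j + 1 + 1 by push_cast; ring] at h3 ⊢
    rw [h2, h1]
    obtain ⟨h3, h4⟩ := h3
    obtain ⟨-, h5⟩ := ih
    push_cast at *
    constructor
    · linear_combination h5 + 6 * h3
    · linear_combination h5 + 6 * h3 + 6 * h4

theorem floor_eq_of_eq_add {z N r : ℤ} (h : z = 24 * N + r) (h0 : 0 ≤ r) (h1 : r < 24) :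
    N = ⌊(z : ℚ) / 24⌋ := by
  have e := Rat.floor_intCast_div_natCast z 24
  rw [show ((24 : ℕ) : ℚ) = 24 by norm_num] at e
  rw [e]
  push_cast
  omega

/-- On each residue class modulo 6 both counts are polynomials in the quotient. The values of `r`
are the remainders modulo 24 of the numerator: 8, 11, 0, 11, 8, 3, and 3 for `d = -1`. -/
theorem ncard_params {d : ℤ} (hd : -1 ≤ d) :
    (((tripleParamSet d).ncard + (mixedParamSet d).ncard : ℕ) : ℤ) =
      ⌊(((d : ℚ) ^ 2 + 1) * (2 * (d : ℚ) - 1) + 9) / 24⌋ := by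
  have hz : (((d : ℚ) ^ 2 + 1) * (2 * (d : ℚ) - 1) + 9) =
      ((((d ^ 2 + 1) * (2 * d - 1) + 9 : ℤ)) : ℚ) := by push_cast; ring
  rw [hz]
  rcases hd.eq_or_lt with rfl | hd
  · rw [ncard_tripleParamSet_of_lt (by norm_num), ncard_mixedParamSet_of_lt (by norm_num)]
    exact floor_eq_of_eq_add (r := 3) (by norm_num) (by norm_num) (by norm_num)
  obtain ⟨c0, c1, c2, c3, c4, c5⟩ := ncard_tripleParamSet_small
  obtain ⟨j, i, hi0, hi6, rfl⟩ : ∃ (j : ℕ) (i : ℤ), 0 ≤ i ∧ i < 6 ∧ d = 6 * j + i :=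
    ⟨(d / 6).toNat, d % 6, by omega, by omega, by omega⟩
  rw [Nat.cast_add]
  interval_cases i
  · have h1 := ncard_tripleParamSet j 0 _ (by norm_num) c0
    have h2 := (ncard_mixedParamSet_even_odd (3 * j)).1
    rw [show 2 * ((3 * j : ℕ) : ℤ) = 6 * j + 0 by push_cast; ring] at h2
    push_cast at h2
    refine floor_eq_of_eq_add (r := 8) ?_ (by norm_num) (by norm_num)
    linear_combination (-24) * h1 - 4 * h2
  · have h1 := ncard_tripleParamSet j 1 _ (by norm_num) c1
    have h2 := (ncard_mixedParamSet_even_odd (3 * j)).2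
    rw [show 2 * ((3 * j : ℕ) : ℤ) + 1 = 6 * j + 1 by push_cast; ring] at h2
    push_cast at h2
    refine floor_eq_of_eq_add (r := 11) ?_ (by norm_num) (by norm_num)
    linear_combination (-24) * h1 - 4 * h2
  · have h1 := ncard_tripleParamSet j 2 _ (by norm_num) c2
    have h2 := (ncard_mixedParamSet_even_odd (3 * j + 1)).1
    rw [show 2 * ((3 * j + 1 : ℕ) : ℤ) = 6 * j + 2 by push_cast; ring] at h2
    push_cast at h2
    refine floor_eq_of_eq_add (r := 0) ?_ (by norm_num) (by norm_num)
    linear_combination (-24) * h1 - 4 * h2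
  · have h1 := ncard_tripleParamSet j 3 _ (by norm_num) c3
    have h2 := (ncard_mixedParamSet_even_odd (3 * j + 1)).2
    rw [show 2 * ((3 * j + 1 : ℕ) : ℤ) + 1 = 6 * j + 3 by push_cast; ring] at h2
    push_cast at h2
    refine floor_eq_of_eq_add (r := 11) ?_ (by norm_num) (by norm_num)
    linear_combination (-24) * h1 - 4 * h2
  · have h1 := ncard_tripleParamSet j 4 _ (by norm_num) c4
    have h2 := (ncard_mixedParamSet_even_odd (3 * j + 2)).1
    rw [show 2 * ((3 * j + 2 : ℕ) : ℤ) = 6 * j + 4 by push_cast; ring] at h2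
    push_cast at h2
    refine floor_eq_of_eq_add (r := 8) ?_ (by norm_num) (by norm_num)
    linear_combination (-24) * h1 - 4 * h2
  · have h1 := ncard_tripleParamSet j 5 _ (by norm_num) c5
    have h2 := (ncard_mixedParamSet_even_odd (3 * j + 2)).2
    rw [show 2 * ((3 * j + 2 : ℕ) : ℤ) + 1 = 6 * j + 5 by push_cast; ring] at h2
    push_cast at h2
    refine floor_eq_of_eq_add (r := 3) ?_ (by norm_num) (by norm_num)
    linear_combination (-24) * h1 - 4 * h2

/-- A poset is isomorphic to its lift to another universe. -/
def uliftIso (M : Type v) [PartialOrder M] : ULift.{u} M ≃o M where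
  toEquiv := Equiv.ulift
  map_rel_iff' := Iff.rfl

/-- The isomorphism classes given by the parameters of the two families. -/
noncomputable def classOfParams (d : ℤ) : tripleParamSet d ⊕ mixedParamSet d →
    Quotient CellularPseudomanifold.isoSetoid.{u}
  | .inl b => Quotient.mk _ ⟨ULift.{u} (TripleJoin b.1.1 b.1.2.1 b.1.2.2),
      (properties_tripleJoin b.2 (uliftIso.{u} _)).1⟩
  | .inr q => Quotient.mk _ ⟨ULift.{u} (MixedJoin q.1.1 q.1.2.1 q.1.2.2.1 q.1.2.2.2),
      (properties_mixedJoin q.2 (uliftIso.{u} _)).1⟩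

theorem classOfParams_injective (d : ℤ) : Function.Injective (classOfParams.{u} d) := by
  rintro (⟨⟨a, b, c⟩, hb⟩ | ⟨⟨a, b, c, t⟩, hb⟩) (⟨⟨a', b', c'⟩, hc⟩ | ⟨⟨a', b', c', t'⟩, hc⟩) h
  all_goals
    obtain ⟨e⟩ := Quotient.exact h
    have e' := (uliftIso _).symm.trans (e.trans (uliftIso _))
  · obtain ⟨rfl, rfl, rfl⟩ := tripleJoin_injective hb hc ⟨e'⟩
    rfl
  · exact ((isEmpty_tripleJoin_iso_mixedJoin hb hc).false e').elim
  · exact ((isEmpty_tripleJoin_iso_mixedJoin hc hb).false e'.symm).elim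
  · obtain ⟨rfl, rfl, rfl, rfl⟩ := mixedJoin_injective hb hc ⟨e'⟩
    rfl

theorem range_classOfParams (d : ℤ) : Set.range (classOfParams.{u} d) = reducibleClasses.{u} d := by
  refine Set.Subset.antisymm ?_ ?_
  · rintro _ ⟨b | q, rfl⟩
    · exact ⟨_, (properties_tripleJoin b.2 (uliftIso.{u} _)).2, rfl⟩
    · exact ⟨_, (properties_mixedJoin q.2 (uliftIso.{u} _)).2, rfl⟩
  · rintro _ ⟨M, ⟨h1, h2, h3⟩, rfl⟩
    rcases exists_iso_of_reducible M.isCellular h1 h2 h3 with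
      ⟨b₁, b₂, b₃, hp, ⟨e⟩⟩ | ⟨d₁, d₂, d₃, d₄, hp, ⟨e⟩⟩
    · exact ⟨.inl ⟨(b₁, b₂, b₃), hp⟩, Quotient.sound ⟨(uliftIso _).trans e.symm⟩⟩
    · exact ⟨.inr ⟨(d₁, d₂, d₃, d₄), hp⟩, Quotient.sound ⟨(uliftIso _).trans e.symm⟩⟩

theorem finite_reducibleClasses (d : ℤ) : (reducibleClasses.{u} d).Finite := by
  have := (finite_tripleParamSet d).to_subtype
  have := (finite_mixedParamSet d).to_subtype
  rw [← range_classOfParams]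
  exact Set.finite_range _

theorem ncard_reducibleClasses (d : ℤ) : (reducibleClasses.{u} d).ncard =
    (tripleParamSet d).ncard + (mixedParamSet d).ncard := by
  have := (finite_tripleParamSet d).to_subtype
  have := (finite_mixedParamSet d).to_subtype
  rw [← range_classOfParams, ← Set.image_univ,
    Set.ncard_image_of_injective _ (classOfParams_injective d), Set.ncard_univ, Nat.card_sum,
    Nat.card_coe_set_eq, Nat.card_coe_set_eq]

end Count

end CPM

theorem theorem5p3 (d : ℤ) (hd : -1 ≤ d) :
    -- the classification
    (∀ (M : Type u) [PartialOrder M] [BoundedOrder M],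
      (CPM.IsCellularPseudomanifold M ∧ CPM.IsReducible M ∧ CPM.dim M = d ∧ CPM.excess M = 2) ↔
        ((∃ b₁ b₂ b₃ : ℤ, CPM.TripleParams d b₁ b₂ b₃ ∧
            Nonempty (M ≃o CPM.TripleJoin b₁ b₂ b₃)) ∨
         (∃ d₁ d₂ d₃ d₄ : ℤ, CPM.MixedParams d d₁ d₂ d₃ d₄ ∧
            Nonempty (M ≃o CPM.MixedJoin d₁ d₂ d₃ d₄)))) ∧
    -- the listed objects are pairwise non-isomorphic
    (∀ b₁ b₂ b₃ c₁ c₂ c₃ : ℤ, CPM.TripleParams d b₁ b₂ b₃ → CPM.TripleParams d c₁ c₂ c₃ →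
      Nonempty (CPM.TripleJoin b₁ b₂ b₃ ≃o CPM.TripleJoin c₁ c₂ c₃) →
      b₁ = c₁ ∧ b₂ = c₂ ∧ b₃ = c₃) ∧
    (∀ d₁ d₂ d₃ d₄ e₁ e₂ e₃ e₄ : ℤ,
      CPM.MixedParams d d₁ d₂ d₃ d₄ → CPM.MixedParams d e₁ e₂ e₃ e₄ →
      Nonempty (CPM.MixedJoin d₁ d₂ d₃ d₄ ≃o CPM.MixedJoin e₁ e₂ e₃ e₄) →
      d₁ = e₁ ∧ d₂ = e₂ ∧ d₃ = e₃ ∧ d₄ = e₄) ∧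
    (∀ b₁ b₂ b₃ d₁ d₂ d₃ d₄ : ℤ,
      CPM.TripleParams d b₁ b₂ b₃ → CPM.MixedParams d d₁ d₂ d₃ d₄ →
      IsEmpty (CPM.TripleJoin b₁ b₂ b₃ ≃o CPM.MixedJoin d₁ d₂ d₃ d₄)) ∧
    -- the listed objects are polytopal spheres
    (∀ b₁ b₂ b₃ : ℤ, CPM.TripleParams d b₁ b₂ b₃ →
      CPM.IsPolytopal (CPM.TripleJoin b₁ b₂ b₃)) ∧
    (∀ d₁ d₂ d₃ d₄ : ℤ, CPM.MixedParams d d₁ d₂ d₃ d₄ →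
      CPM.IsPolytopal (CPM.MixedJoin d₁ d₂ d₃ d₄)) ∧
    -- their number, counted up to isomorphism
    (CPM.reducibleClasses.{u} d).Finite ∧
    ((CPM.reducibleClasses.{u} d).ncard : ℤ) =
      ⌊(((d : ℚ) ^ 2 + 1) * (2 * (d : ℚ) - 1) + 9) / 24⌋ := by
  refine ⟨fun M _ _ => ⟨fun ⟨h1, h2, h3, h4⟩ => CPM.exists_iso_of_reducible h1 h2 h3 h4, ?_⟩,
    fun _ _ _ _ _ _ => CPM.tripleJoin_injective, fun _ _ _ _ _ _ _ _ => CPM.mixedJoin_injective,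
    fun _ _ _ _ _ _ _ => CPM.isEmpty_tripleJoin_iso_mixedJoin,
    fun _ _ _ => CPM.isPolytopal_tripleJoin, fun _ _ _ _ => CPM.isPolytopal_mixedJoin,
    CPM.finite_reducibleClasses d, ?_⟩
  · rintro (⟨b₁, b₂, b₃, hp, ⟨e⟩⟩ | ⟨d₁, d₂, d₃, d₄, hp, ⟨e⟩⟩)
    exacts [CPM.properties_tripleJoin hp e, CPM.properties_mixedJoin hp e]
  · rw [CPM.ncard_reducibleClasses]
    exact CPM.ncard_params hd
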